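/- **Setting.** Let $G$ be a Gerstenhaber algebra over $\mathbb R$: a $\mathbb Z$-graded space with a graded commutative associative product of degree $0$ and a bracket of degree $-1$ that is a graded Lie bracket for $\deg a=|a|-1$, with $[a,bc]=[a,b]c+(-1)^{|b|\deg a}b[a,c]$. Let $M$ be a graded $G$-module, with actions $a\,v$ (degree $0$, associative; $va=(-1)^{|a||v|}av$) and $a\bullet v$ (degree $-1$, a Lie module for $\deg$) such that $[a,b]v=a\bullet(bv)-(-1)^{|b|\deg a}b(a\bullet v)$ and $(ab)\bullet v=a(b\bullet v)+(-1)^{|a||b|}b(a\bullet v)$. Then $G\ltimes M=G\oplus M$ has the product $(a+u)(b+v)=ab+av+ub$ and the bracket $[a+u,b+v]=[a,b]+a\bullet v-(-1)^{\deg b\deg u}b\bullet u$. For a graded space $V$ let $\mathcal H_V=\bigoplus_{p\ge1}\underline{\otimes^pV[1]}$ (tensors modulo the images of all signed shuffles) and $S_V=S^+(\mathcal H_V[1])$. A word $X=\underline{a_1\otimes\dots\otimes a_p}$ has degree $\deg X=\sum\deg a_i-1$ in $\mathcal H_V[1]$. Let $C_N(G)\subset S_G$ be spanned by the products $X_1\cdots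 X_r$ of words with $N$ letters in total. All $\varepsilon$ are Koszul signs for the degrees of the words. $S_V$ carries the coproduct $\Delta(X_1\cdots X_n)=\sum_{I\sqcup J}\varepsilon\,X_I\otimes X_J$ ($I,J\ne\emptyset$) and the cobracket $\kappa$ of degree $1$ given by $\kappa(X)=\sum_{X=U\otimes W}(-1)^{\deg U+1}\big(U\otimes W+(-1)^{\deg U\deg W}W\otimes U\big)$ on words and on products by $$\kappa(X_1\cdots X_n)=\sum_{s,\;I\sqcup J=\{1..n\}\setminus\{s\}}(-1)^{\sum_{i<s}\deg X_i}\sum_{X_s=U\otimes W}(-1)^{\deg U+1}\big(\varepsilon\,X_IU\otimes WX_J+\varepsilon\,X_IW\otimes UX_J\big).$$ For $V=G$ and $V=G\ltimes M$ it also carries the operators * $m(a\otimes b)=(-1)^{\deg a}ab$, $\;m(a_1\otimes\dots\otimes a_p)=\sum_j(-1)^{\sum_{i<j}\deg a_i}a_1\otimes\dots\otimes m(a_j\otimes a_{j+1})\otimes\dots\otimes a_p$, $\;m(X_1\cdots X_n)=\sum_j(-1)^{\sum_{i<j}\deg X_i}X_1\cdots m(X_j)\cdots X_n$; * $\ell(X,Y)=(-1)^{\deg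 X}[X\wedge Y]$, where $[X\wedge Y]$ is the signed sum over all shuffles of the letters of $X$ and $Y$ in which one letter $a$ of $X$ immediately followed by a letter $b$ of $Y$ is replaced by $[a,b]$; $\;\ell(X_1\cdots X_n)=\sum_{i<j}\varepsilon\,\ell(X_i,X_j)X_1\cdots\hat\imath\cdots\hat\jmath\cdots X_n$. A cochain is a linear map $c:S_G\to M$, with restriction $c^{(N)}$ to $C_N(G)$; it has degree $d$ if $|c(x)|-2=\deg x+d$, and $L(\cdot,\cdot)$ denotes the graded space of linear maps spanned by the homogeneous ones. Let $C^N(G,M)=L(C_N(G),M)$ (up to a shift of the grading of $M$), and let $C^N_{p_1\dots p_n}$, $p_1+\dots+p_n=N$, be the cochains that vanish on products of words whose lengths are not $p_1,\dots,p_n$ up to order. For $a\in G$, $v\in M$ put $m(a\otimes v)=(-1)^{\deg a}av$, $m(v\otimes a)=(-1)^{|v|-1}va$, and $\ell(Y,v)=(-1)^{\deg Y}a\bullet v$ for a word $Y=a$ of length one. *The coboundary.* For $c$ of degree $0$, let $F:S_G\to S_{G\ltimes M}$ be a morphism for $\Delta$ and $\kappa$ whose projection to the cogenerators $(G\ltimes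 M)[1][1]$ is $\iota+c$, where $\iota$ is the projection of $S_G$ to $G[1][1]$; then $\partial c$ is the projection of $(m+\ell)\circ F-F\circ(m+\ell)$ to the cogenerators. For $c$ of any degree $d$ one uses in the same way a $(\Delta,\kappa)$-coderivation $D$ of degree $d$ along the inclusion $E:S_G\to S_{G\ltimes M}$, i.e. $\Delta D=(D\otimes E+E\otimes D)\Delta$ and $(-1)^d\kappa D=(D\otimes E+E\otimes D)\kappa$, whose projection is $c$, and $(m+\ell)\circ D-(-1)^dD\circ(m+\ell)$. **Proposition.** The maps $\Delta,\kappa,m,\ell$ and $E$ are well defined on the quotients. There are linear operators $d_m,d_\ell$ on cochains, raising the degree by $1$ and mapping $C^N(G,M)$ to $C^{N+1}(G,M)$, such that whenever $F$, respectively $D$, is as above, $(d_m+d_\ell)c$ is the projection to the cogenerators of $(m+\ell)F-F(m+\ell)$, respectively of $(m+\ell)D-(-1)^dD(m+\ell)$: the coboundary is $\partial=d_m+d_\ell$. They are given, for $c$ of degree $d$, by the following formulas. *(a)* $d_m$ maps $C^N_{p_1\dots p_n}$ to $\sum_jC^{N+1}_{p_1\dots(p_j+1)\dots p_n}$. With $X_j=\underline{a^j_1\otimes\dots\otimes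 a^j_{q_j}}$, $$\begin{aligned}(d_mc)(X_1\cdots X_n)=\sum_{j:\,q_j\ge2}\Big(&(-1)^{\deg a^j_1(\sum_{i<j}\deg X_i+d)}\,m\big(a^j_1\otimes c(X_1\cdots\underline{a^j_2\otimes\dots\otimes a^j_{q_j}}\cdots X_n)\big)\\&+(-1)^{\deg a^j_{q_j}\sum_{i>j}\deg X_i}\,m\big(c(X_1\cdots\underline{a^j_1\otimes\dots\otimes a^j_{q_j-1}}\cdots X_n)\otimes a^j_{q_j}\big)\\&-(-1)^{d+\sum_{i<j}\deg X_i}\,c(X_1\cdots m(X_j)\cdots X_n)\Big).\end{aligned}$$ *(b)* $d_\ell$ maps $C^N_{p_1\dots p_n}$ to $\sum_{j,\;q_1+q_2=p_j+1}C^{N+1}_{q_1,q_2,p_1\dots\hat\jmath\dots p_n}$ $(q_1,q_2\ge1)$ and $$(d_\ell c)(Z_1\cdots Z_r)=\sum_{i:\,Z_i\text{ of length }1}(-1)^{d\deg Z_i}\varepsilon\;\ell\big(Z_i,c(Z_1\cdots\hat\imath\cdots Z_r)\big)-(-1)^d\sum_{i<j}\varepsilon\;c\big(\ell(Z_i,Z_j)Z_1\cdots\hat\imath\cdots\hat\jmath\cdots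 Z_r\big).$$ In terms of two distinguished words $Y_1,Y_2$ of lengths $q_1,q_2$ and $X=L_1L_2$ a product of further words, $$(d_\ell c)(Y_1Y_2L_1L_2)=T(Y_1,Y_2)+\rho,$$ where $\rho$ consists of the terms in which a word of $L_1L_2$ acts or the bracket is that of a pair other than $(Y_1,Y_2)$ (so $\rho=0$ if there are no further words), and, with $$\begin{aligned}B&=-(-1)^{d}\,\varepsilon\tbinom{Y_1Y_2L_1}{L_1Y_1Y_2}(-1)^{\deg L_1}\,c(L_1\,\ell(Y_1,Y_2)\,L_2),\\ A_1&=(-1)^{d\deg Y_1}\varepsilon\tbinom{Y_1Y_2L_1}{Y_1L_1Y_2}\,\ell\big(Y_1,c(L_1Y_2L_2)\big),\\ A_2&=(-1)^{d\deg Y_2}\varepsilon\tbinom{Y_1Y_2L_1}{Y_2L_1Y_1}\,\ell\big(Y_2,c(L_1Y_1L_2)\big),\end{aligned}$$ 1. if $q_1>1$, $q_2>1$, then $T=B$; 2. if $q_1=1<q_2$, then $T=B+A_1$; 3. if $q_2=1<q_1$, then $T=B+A_2$; 4. if $q_1=q_2=1$, then $T=A_1+A_2+B$. *(c)* $(d_m+d_\ell)\circ(d_m+d_\ell)=0$,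 so these operators define a cohomology. -/

import Mathlib

open scoped TensorProduct

noncomputable section

namespace ChevalleyHarrison

/-! ### Gerstenhaber algebras and their modules -/

/-- A Gerstenhaber algebra over `ℝ`: a `ℤ`-graded space with a graded commutative associative
product of degree `0` and a bracket of degree `-1` which is a graded Lie bracket for the shifted
degree `deg a = |a| - 1`, such that `[a, ·]` is a derivation of the product of degree `|a| - 1`. -/
structure GerstenhaberAlgebra (G : Type*) [AddCommGroup G] [Module ℝ G] where
  gr : ℤ → Submodule ℝ G
  isInternal : DirectSum.IsInternal gr
  mul : G →ₗ[ℝ] G →ₗ[ℝ] G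
  bracket : G →ₗ[ℝ] G →ₗ[ℝ] G
  mul_mem : ∀ {i j : ℤ} {a b : G}, a ∈ gr i → b ∈ gr j → mul a b ∈ gr (i + j)
  bracket_mem : ∀ {i j : ℤ} {a b : G}, a ∈ gr i → b ∈ gr j → bracket a b ∈ gr (i + j - 1)
  mul_assoc : ∀ a b c : G, mul (mul a b) c = mul a (mul b c)
  mul_comm : ∀ {i j : ℤ} {a b : G}, a ∈ gr i → b ∈ gr j →
    mul a b = (-1 : ℝ) ^ (i * j) • mul b a
  bracket_skew : ∀ {i j : ℤ} {a b : G}, a ∈ gr i → b ∈ gr j →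
    bracket a b = -((-1 : ℝ) ^ ((i - 1) * (j - 1)) • bracket b a)
  jacobi : ∀ {i j k : ℤ} {a b c : G}, a ∈ gr i → b ∈ gr j → c ∈ gr k →
    (-1 : ℝ) ^ ((i - 1) * (k - 1)) • bracket (bracket a b) c
      + (-1 : ℝ) ^ ((j - 1) * (i - 1)) • bracket (bracket b c) a
      + (-1 : ℝ) ^ ((k - 1) * (j - 1)) • bracket (bracket c a) b = 0
  leibniz : ∀ {i j k : ℤ} {a b c : G}, a ∈ gr i → b ∈ gr j → c ∈ gr k →
    bracket a (mul b c) =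
      mul (bracket a b) c + (-1 : ℝ) ^ (j * (i - 1)) • mul b (bracket a c)

/-- A module over a Gerstenhaber algebra: a graded module for the commutative product (turned into
a symmetric bimodule by `u a = (-1)^(|a||u|) a u`) and, after a shift, for the Lie bracket, the two
actions being compatible. -/
structure GerstenhaberModule {G : Type*} [AddCommGroup G] [Module ℝ G]
    (A : GerstenhaberAlgebra G) (M : Type*) [AddCommGroup M] [Module ℝ M] where
  gr : ℤ → Submodule ℝ M
  isInternal : DirectSum.IsInternal gr
  /-- `a m` -/
  smul : G →ₗ[ℝ] M →ₗ[ℝ] M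
  /-- `a • m` -/
  act : G →ₗ[ℝ] M →ₗ[ℝ] M
  smul_mem : ∀ {i j : ℤ} {a : G} {v : M}, a ∈ A.gr i → v ∈ gr j → smul a v ∈ gr (i + j)
  act_mem : ∀ {i j : ℤ} {a : G} {v : M}, a ∈ A.gr i → v ∈ gr j → act a v ∈ gr (i + j - 1)
  mul_smul : ∀ (a b : G) (v : M), smul (A.mul a b) v = smul a (smul b v)
  bracket_act : ∀ {i j : ℤ} {a b : G} (v : M), a ∈ A.gr i → b ∈ A.gr j →
    act (A.bracket a b) v =
      act a (act b v) - (-1 : ℝ) ^ ((i - 1) * (j - 1)) • act b (act a v)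
  bracket_smul : ∀ {i j : ℤ} {a b : G} (v : M), a ∈ A.gr i → b ∈ A.gr j →
    smul (A.bracket a b) v =
      act a (smul b v) - (-1 : ℝ) ^ (j * (i - 1)) • smul b (act a v)
  mul_act : ∀ {i j : ℤ} {a b : G} (v : M), a ∈ A.gr i → b ∈ A.gr j →
    act (A.mul a b) v = smul a (act b v) + (-1 : ℝ) ^ (i * j) • smul b (act a v)

/-! ### Letters, words, sentences, and their degrees

Let `V` be a graded space and `ℋ = ⨁_{p ≥ 1} ⊗^p V[1] / (shuffles)`.  A *letter* is a homogeneous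
element of `V` together with its degree, a *word* `[a₁, …, a_p]` stands for the class of
`a₁ ⊗ ⋯ ⊗ a_p` in `ℋ[1]`, and a *sentence* `[X₁, …, X_n]` for `X₁ ⋯ X_n ∈ S^n(ℋ[1])`. -/

section Space

variable {V : Type*} [AddCommGroup V] [Module ℝ V]

abbrev Letter (gr : ℤ → Submodule ℝ V) : Type _ := {p : ℤ × V // p.2 ∈ gr p.1}

abbrev Word (gr : ℤ → Submodule ℝ V) : Type _ := List (Letter gr)

abbrev Sentence (gr : ℤ → Submodule ℝ V) : Type _ := List (Word gr)

variable {gr : ℤ → Submodule ℝ V}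

/-- The degree `deg a = |a| - 1` in `V[1]`. -/
def letterDeg (a : Letter gr) : ℤ := a.1.1 - 1

/-- The degree in `ℋ[1]`. -/
def wordDeg (X : Word gr) : ℤ := (X.map letterDeg).sum - 1

/-- The degree in `S(ℋ[1])`. -/
def sentenceDeg (L : Sentence gr) : ℤ := (L.map wordDeg).sum

/-- The number `N = p₁ + ⋯ + p_r` of letters. -/
def weight (L : Sentence gr) : ℕ := (L.map List.length).sum

/-- The type `{p₁, …, p_r}`: the lengths of the words (the product in `S(ℋ[1])` is commutative, so
only the multiset matters). -/
def sentenceType (L : Sentence gr) : Multiset ℕ := (L.map List.length : List ℕ)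

/-! ### Signed combinatorics of lists (Koszul rule for a degree function `deg`) -/

/-- All shuffles of two lists, with their Koszul signs. -/
def shuffles {α : Type*} (deg : α → ℤ) : List α → List α → List (ℝ × List α)
  | [], y => [(1, y)]
  | x, [] => [(1, x)]
  | a :: x, b :: y =>
      (shuffles deg x (b :: y)).map (fun t => (t.1, a :: t.2)) ++
      (shuffles deg (a :: x) y).map
        (fun t => ((-1 : ℝ) ^ (deg b * ((a :: x).map deg).sum) * t.1, b :: t.2))
  termination_by x y => x.length + y.length

/-- All ways to divide a list into two complementary sublists `I`, `J`, with the Koszul sign of the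
permutation which brings `I` in front of `J`. -/
def splits {α : Type*} (deg : α → ℤ) : List α → List (ℝ × List α × List α)
  | [] => [(1, [], [])]
  | x :: xs =>
      (splits deg xs).map (fun t => (t.1, x :: t.2.1, t.2.2)) ++
      (splits deg xs).map
        (fun t => ((-1 : ℝ) ^ (deg x * (t.2.1.map deg).sum) * t.1, t.2.1, x :: t.2.2))

/-- All ways to choose one entry `x_i`: the entry, the list without it, and the Koszul sign of
`(i, 1, …, î, …, n)`. -/
def picks {α : Type*} (deg : α → ℤ) : List α → List (ℝ × α × List α)
  | [] => []
  | x :: xs =>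
      (1, x, xs) ::
      (picks deg xs).map
        (fun t => ((-1 : ℝ) ^ (deg t.2.1 * deg x) * t.1, t.2.1, x :: t.2.2))

/-- All ways to choose two entries `x_i`, `x_j` with `i < j`: the two entries, the list without
them, and the Koszul sign of `(i, j, 1, …, î, …, ĵ, …, n)`. -/
def pickPairs {α : Type*} (deg : α → ℤ) : List α → List (ℝ × α × α × List α)
  | [] => []
  | x :: xs =>
      (picks deg xs).map (fun t => (t.1, x, t.2.1, t.2.2)) ++
      (pickPairs deg xs).map
        (fun t => ((-1 : ℝ) ^ ((deg t.2.1 + deg t.2.2.1) * deg x) * t.1,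
          t.2.1, t.2.2.1, x :: t.2.2.2))

/-- The factorizations `X = U ⊗ V` of a word into two nonempty words. -/
def cuts {α : Type*} (X : List α) : List (List α × List α) :=
  (List.range (X.length - 1)).map (fun k => (X.take (k + 1), X.drop (k + 1)))

/-! ### The space `S⁺(ℋ[1])` by generators and relations -/

/-- Linearity in every letter, vanishing of shuffles, graded commutativity of the product of words,
no empty words and no empty sentence. -/
inductive IsRelation (gr : ℤ → Submodule ℝ V) : (Sentence gr →₀ ℝ) → Prop
  | add (A B : Sentence gr) (u v : Word gr) (i : ℤ) (a b : V) (ha : a ∈ gr i) (hb : b ∈ gr i) :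
      IsRelation gr
        (Finsupp.single (A ++ (u ++ ⟨(i, a + b), add_mem ha hb⟩ :: v) :: B) 1
          - Finsupp.single (A ++ (u ++ ⟨(i, a), ha⟩ :: v) :: B) 1
          - Finsupp.single (A ++ (u ++ ⟨(i, b), hb⟩ :: v) :: B) 1)
  | smul (A B : Sentence gr) (u v : Word gr) (i : ℤ) (r : ℝ) (a : V) (ha : a ∈ gr i) :
      IsRelation gr
        (Finsupp.single (A ++ (u ++ ⟨(i, r • a), (gr i).smul_mem r ha⟩ :: v) :: B) 1
          - r • Finsupp.single (A ++ (u ++ ⟨(i, a), ha⟩ :: v) :: B) 1)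
  | shuffle (A B : Sentence gr) (x y : Word gr) (hx : x ≠ []) (hy : y ≠ []) :
      IsRelation gr
        ((shuffles letterDeg x y).map
          (fun t => t.1 • Finsupp.single (A ++ t.2 :: B) (1 : ℝ))).sum
  | swap (A B : Sentence gr) (X Y : Word gr) :
      IsRelation gr
        (Finsupp.single (A ++ X :: Y :: B) 1
          - (-1 : ℝ) ^ (wordDeg X * wordDeg Y) • Finsupp.single (A ++ Y :: X :: B) 1)
  | emptyWord (A B : Sentence gr) : IsRelation gr (Finsupp.single (A ++ [] :: B) 1)
  | emptySentence : IsRelation gr (Finsupp.single [] 1)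

def relations (gr : ℤ → Submodule ℝ V) : Submodule ℝ (Sentence gr →₀ ℝ) :=
  Submodule.span ℝ {x | IsRelation gr x}

/-- The space `S⁺(ℋ[1]) = ⨁_{n ≥ 1} S^n(⨁_{p ≥ 1} (⊗^p V[1] / shuffles)[1])`. -/
abbrev Space (gr : ℤ → Submodule ℝ V) : Type _ := (Sentence gr →₀ ℝ) ⧸ relations gr

/-- The class `X₁ ⋯ X_n` of a sentence. -/
def mk (L : Sentence gr) : Space gr := Submodule.Quotient.mk (Finsupp.single L 1)

/-- The linear map on `S⁺(ℋ[1])` with prescribed values on sentences, provided that the values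
respect the relations (the zero map otherwise). -/
def descend {W : Type*} [AddCommGroup W] [Module ℝ W] (f : Sentence gr → W) :
    Space gr →ₗ[ℝ] W :=
  open Classical in
  if h : relations gr ≤ LinearMap.ker (Finsupp.linearCombination ℝ f) then
    (relations gr).liftQ (Finsupp.linearCombination ℝ f) h
  else 0

/-- The prescription `f` on sentences does define a linear map on `S⁺(ℋ[1])`. -/
def Descends {W : Type*} [AddCommGroup W] [Module ℝ W] (f : Sentence gr → W) : Prop :=
  ∀ L : Sentence gr, descend f (mk L) = f L

/-! ### The bicoalgebra structure -/

/-- `Δ(X₁ ⋯ X_n) = ∑ ± X_I ⊗ X_J` over `I ⊔ J = {1, …, n}` with `I`, `J` nonempty (the terms with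
`I` or `J` empty are zero here, since the empty sentence is zero). -/
def coprodVal (L : Sentence gr) : Space gr ⊗[ℝ] Space gr :=
  ((splits wordDeg L).map (fun t => t.1 • (mk t.2.1 ⊗ₜ[ℝ] mk t.2.2))).sum

def coprod (gr : ℤ → Submodule ℝ V) : Space gr →ₗ[ℝ] Space gr ⊗[ℝ] Space gr :=
  descend coprodVal

/-- The terms of `κ` in which a fixed word of a sentence, preceded by the words `A` and followed by
the words `B`, is cut into `U ⊗ W`; the words of `A` and `B` are distributed in all ways on both
sides, first with `U` on the left and `W` on the right, then conversely. -/
def cobracketTerm (A B : Sentence gr) (U W : Word gr) : Space gr ⊗[ℝ] Space gr :=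
  ((splits wordDeg A).map (fun s =>
    ((splits wordDeg B).map (fun t =>
      ((-1 : ℝ) ^ (sentenceDeg A + wordDeg U + 1) * s.1 * t.1) •
        ((-1 : ℝ) ^ (sentenceDeg s.2.2 * wordDeg U
              + sentenceDeg t.2.1 * (sentenceDeg s.2.2 + wordDeg W)) •
            (mk (s.2.1 ++ U :: t.2.1) ⊗ₜ[ℝ] mk (s.2.2 ++ W :: t.2.2))
          + (-1 : ℝ) ^ (wordDeg U * wordDeg W + sentenceDeg s.2.2 * wordDeg W
              + sentenceDeg t.2.1 * (sentenceDeg s.2.2 + wordDeg U)) •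
            (mk (s.2.1 ++ W :: t.2.1) ⊗ₜ[ℝ] mk (s.2.2 ++ U :: t.2.2))))).sum)).sum

/-- The cobracket `κ`, of degree `1`. -/
def cobracketVal (L : Sentence gr) : Space gr ⊗[ℝ] Space gr :=
  ∑ k : Fin L.length,
    ((cuts (L.get k)).map
      (fun t => cobracketTerm (L.take k) (L.drop (k + 1)) t.1 t.2)).sum

def cobracket (gr : ℤ → Submodule ℝ V) : Space gr →ₗ[ℝ] Space gr ⊗[ℝ] Space gr :=
  descend cobracketVal

/-- The projection of `S⁺(ℋ[1])` onto the cogenerators `(V[1])[1]`, on sentences. -/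
def cogenVal : Sentence gr → V
  | [[a]] => a.1.2
  | _ => 0

def cogen (gr : ℤ → Submodule ℝ V) : Space gr →ₗ[ℝ] V := descend cogenVal

/-- The operator `x ↦ (-1)^(d deg x) x`, on sentences. -/
def signVal (d : ℤ) (L : Sentence gr) : Space gr := (-1 : ℝ) ^ (d * sentenceDeg L) • mk L

def signOp (gr : ℤ → Submodule ℝ V) (d : ℤ) : Space gr →ₗ[ℝ] Space gr := descend (signVal d)

/-! ### The codifferential `m + ℓ` -/

/-- A graded space with a product and a bracket of homogeneous elements. -/
structure Ops (V : Type*) [AddCommGroup V] [Module ℝ V] where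
  gr : ℤ → Submodule ℝ V
  mul : Letter gr → Letter gr → Letter gr
  bracket : Letter gr → Letter gr → Letter gr

variable (O : Ops V)

/-- `m(a₁ ⊗ ⋯ ⊗ a_p) = ∑_j (-1)^(∑_{i<j} deg a_i) a₁ ⊗ ⋯ ⊗ m(a_j ⊗ a_{j+1}) ⊗ ⋯ ⊗ a_p`, where
`m(a ⊗ b) = (-1)^(deg a) a b`. -/
def mWord : Word O.gr → List (ℝ × Word O.gr)
  | [] => []
  | [_] => []
  | a :: b :: w =>
      ((-1 : ℝ) ^ letterDeg a, O.mul a b :: w) ::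
        (mWord (b :: w)).map (fun t => ((-1 : ℝ) ^ letterDeg a * t.1, a :: t.2))

/-- `m(X₁ ⋯ X_n) = ∑_k (-1)^(∑_{i<k} deg X_i) X₁ ⋯ m(X_k) ⋯ X_n`. -/
def mVal (L : Sentence O.gr) : Space O.gr :=
  ∑ k : Fin L.length,
    ((mWord O (L.get k)).map (fun t =>
      ((-1 : ℝ) ^ sentenceDeg (L.take k) * t.1) • mk (L.take k ++ t.2 :: L.drop (k + 1)))).sum

/-- The bracket of two words: the signed sum over their shuffles, with one letter `a` of the first
word and one letter `b` of the second word that follows it immediately replaced by `[a, b]`. -/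
def bracketWord : Word O.gr → Word O.gr → List (ℝ × Word O.gr)
  | [], _ => []
  | _, [] => []
  | a :: x, b :: y =>
      (shuffles letterDeg x y).map
        (fun t => ((-1 : ℝ) ^ (letterDeg b * (x.map letterDeg).sum) * t.1,
          O.bracket a b :: t.2)) ++
      (bracketWord x (b :: y)).map (fun t => (t.1, a :: t.2)) ++
      (bracketWord (a :: x) y).map
        (fun t => ((-1 : ℝ) ^ (letterDeg b * ((a :: x).map letterDeg).sum) * t.1, b :: t.2))
  termination_by x y => x.length + y.length

/-- `ℓ(X, Y) = (-1)^(deg X) [X, Y]`. -/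
def ellWord (X Y : Word O.gr) : List (ℝ × Word O.gr) :=
  (bracketWord O X Y).map (fun t => ((-1 : ℝ) ^ wordDeg X * t.1, t.2))

/-- `ℓ(X₁ ⋯ X_n) = ∑_{i<j} ± ℓ(X_i, X_j) X₁ ⋯ X̂_i ⋯ X̂_j ⋯ X_n`. -/
def ellVal (L : Sentence O.gr) : Space O.gr :=
  ((pickPairs wordDeg L).map (fun p =>
    ((ellWord O p.2.1 p.2.2.1).map
      (fun t => (p.1 * t.1) • mk (t.2 :: p.2.2.2))).sum)).sum

/-- The codifferential `m + ℓ`. -/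
def codiff : Space O.gr →ₗ[ℝ] Space O.gr := descend (mVal O) + descend (ellVal O)

end Space

/-! ### Morphisms and coderivations of bicoalgebras -/

section Morphisms

variable {V V' : Type*} [AddCommGroup V] [Module ℝ V] [AddCommGroup V'] [Module ℝ V']
  {gr : ℤ → Submodule ℝ V} {gr' : ℤ → Submodule ℝ V'}

/-- `Δ ∘ F = (F ⊗ F) ∘ Δ` and `κ ∘ F = (F ⊗ F) ∘ κ`. -/
def IsBicoalgebraMorphism (F : Space gr →ₗ[ℝ] Space gr') : Prop :=
  coprod gr' ∘ₗ F = TensorProduct.map F F ∘ₗ coprod gr ∧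
  cobracket gr' ∘ₗ F = TensorProduct.map F F ∘ₗ cobracket gr

/-- `D` is a coderivation of degree `d` along the morphism `E`:
`Δ ∘ D = (D ⊗ E + E ⊗ D) ∘ Δ` and `(-1)^d κ ∘ D = (D ⊗ E + E ⊗ D) ∘ κ`, where
`(E ⊗ D)(x ⊗ y) = (-1)^(d deg x) E x ⊗ D y`. -/
def IsBicoalgebraCoderivation (d : ℤ) (E D : Space gr →ₗ[ℝ] Space gr') : Prop :=
  coprod gr' ∘ₗ D =
    (TensorProduct.map D E + TensorProduct.map (E ∘ₗ signOp gr d) D) ∘ₗ coprod gr ∧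
  (-1 : ℝ) ^ d • (cobracket gr' ∘ₗ D) =
    (TensorProduct.map D E + TensorProduct.map (E ∘ₗ signOp gr d) D) ∘ₗ cobracket gr

end Morphisms

/-! ### The algebra `G` and the semidirect product `G ⋉ M` -/

section Module

variable {G : Type*} [AddCommGroup G] [Module ℝ G]

def GerstenhaberAlgebra.ops (A : GerstenhaberAlgebra G) : Ops G where
  gr := A.gr
  mul a b := ⟨(a.1.1 + b.1.1, A.mul a.1.2 b.1.2), A.mul_mem a.2 b.2⟩
  bracket a b := ⟨(a.1.1 + b.1.1 - 1, A.bracket a.1.2 b.1.2), A.bracket_mem a.2 b.2⟩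

variable {A : GerstenhaberAlgebra G} {M : Type*} [AddCommGroup M] [Module ℝ M]
  (R : GerstenhaberModule A M)

/-- `G ⋉ M = G ⊕ M` with `(a + u)(b + v) = ab + (av + ub)`, where `ub = (-1)^(|u||b|) bu`, and
`[a + u, b + v] = [a, b] + (a • v - (-1)^(deg b deg u) b • u)`. -/
def GerstenhaberModule.semidirect : Ops (G × M) where
  gr i := (A.gr i).prod (R.gr i)
  mul a b :=
    ⟨(a.1.1 + b.1.1,
      (A.mul a.1.2.1 b.1.2.1,
        R.smul a.1.2.1 b.1.2.2 + (-1 : ℝ) ^ (a.1.1 * b.1.1) • R.smul b.1.2.1 a.1.2.2)),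
      A.mul_mem a.2.1 b.2.1,
      add_mem (R.smul_mem a.2.1 b.2.2)
        (Submodule.smul_mem _ _ (add_comm b.1.1 a.1.1 ▸ R.smul_mem b.2.1 a.2.2))⟩
  bracket a b :=
    ⟨(a.1.1 + b.1.1 - 1,
      (A.bracket a.1.2.1 b.1.2.1,
        R.act a.1.2.1 b.1.2.2
          - (-1 : ℝ) ^ ((b.1.1 - 1) * (a.1.1 - 1)) • R.act b.1.2.1 a.1.2.2)),
      A.bracket_mem a.2.1 b.2.1,
      sub_mem (R.act_mem a.2.1 b.2.2)
        (Submodule.smul_mem _ _ (add_comm b.1.1 a.1.1 ▸ R.act_mem b.2.1 a.2.2))⟩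

/-- The letter `(a, 0)` of `G ⋉ M`. -/
def inclLetter (a : Letter A.gr) : Letter R.semidirect.gr :=
  ⟨(a.1.1, (a.1.2, 0)), a.2, zero_mem _⟩

/-- The inclusion of `S⁺(ℋ_G[1])` in `S⁺(ℋ_{G ⋉ M}[1])`, on sentences. -/
def inclVal (L : Sentence A.gr) : Space R.semidirect.gr :=
  mk (L.map (List.map (inclLetter R)))

def incl : Space A.gr →ₗ[ℝ] Space R.semidirect.gr := descend (inclVal R)

/-! ### Cochains -/

/-- The cochains of degree `d`: linear maps from `S⁺(ℋ_G[1]) = ⨁_N C_N(G)` to `M` that are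
homogeneous of degree `d` for the degree `|v| - 2` on `(M[1])[1]`. -/
def cochains (d : ℤ) : Submodule ℝ (Space A.gr →ₗ[ℝ] M) where
  carrier := {c | ∀ L : Sentence A.gr, c (mk L) ∈ R.gr (sentenceDeg L + d + 2)}
  add_mem' hc hc' L := add_mem (hc L) (hc' L)
  zero_mem' _ := zero_mem _
  smul_mem' r _ hc L := Submodule.smul_mem _ r (hc L)

/-- The degree `d` part of `C^N(G, M)`: the cochains of degree `d` that vanish on `C_{N'}(G)` for
`N' ≠ N`. -/
def cochainsOfWeight (d : ℤ) (N : ℕ) : Submodule ℝ (cochains R d) where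
  carrier := {c | ∀ L : Sentence A.gr, weight L ≠ N → c.1 (mk L) = 0}
  add_mem' hc hc' L hL := by simp [hc L hL, hc' L hL]
  zero_mem' _ _ := rfl
  smul_mem' r _ hc L hL := by simp [hc L hL]

/-- The degree `d` part of `C^N_{p₁, …, p_n}`: the cochains of degree `d` that vanish on all
products `X₁ ⋯ X_r` of words whose lengths are not `p₁, …, p_n` (in some order). -/
def cochainsOfType (d : ℤ) (p : Multiset ℕ) : Submodule ℝ (cochains R d) where
  carrier := {c | ∀ L : Sentence A.gr, sentenceType L ≠ p → c.1 (mk L) = 0}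
  add_mem' hc hc' L hL := by simp [hc L hL, hc' L hL]
  zero_mem' _ _ := rfl
  smul_mem' r _ hc L hL := by simp [hc L hL]

/-! ### The explicit formulas -/

/-- `m(a ⊗ v) = (-1)^(deg a) a v`. -/
def mLeft (a : Letter A.gr) (v : M) : M := (-1 : ℝ) ^ letterDeg a • R.smul a.1.2 v

/-- `m(v ⊗ a) = (-1)^(e - 1) v a` for `v` of degree `|v| = e`, where `v a = (-1)^(e |a|) a v`. -/
def mRight (e : ℤ) (v : M) (a : Letter A.gr) : M :=
  (-1 : ℝ) ^ (e - 1) • (-1 : ℝ) ^ (e * a.1.1) • R.smul a.1.2 v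

/-- `ℓ(Y, v) = (-1)^(deg Y) a • v` for the word `Y = [a]` of length one; there is no such term for
the other words. -/
def ellAct : Word A.gr → M → M
  | [a], v => (-1 : ℝ) ^ wordDeg [a] • R.act a.1.2 v
  | _, _ => 0

/-- The terms of `(d_m c)(X₁ ⋯ X_n)` that come from `X_j = X`, where `L₁ = X₁ ⋯ X_{j-1}`,
`L₂ = X_{j+1} ⋯ X_n`, for a cochain `c` of degree `d`; zero if `X` has length one. -/
def dmTerm (d : ℤ) (c : Space A.gr →ₗ[ℝ] M) (L₁ L₂ : Sentence A.gr) : Word A.gr → M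
  | [] => 0
  | [_] => 0
  | a :: b :: w =>
      let X : Word A.gr := a :: b :: w
      let z : Letter A.gr := X.getLast (List.cons_ne_nil _ _)
      (-1 : ℝ) ^ (letterDeg a * (sentenceDeg L₁ + d)) •
          mLeft R a (c (mk (L₁ ++ (b :: w) :: L₂)))
        + (-1 : ℝ) ^ (letterDeg z * sentenceDeg L₂) •
          mRight R (sentenceDeg (L₁ ++ X.dropLast :: L₂) + d + 2)
            (c (mk (L₁ ++ X.dropLast :: L₂))) z
        - (-1 : ℝ) ^ (d + sentenceDeg L₁) •
          ((mWord A.ops X).map (fun t => t.1 • c (mk (L₁ ++ t.2 :: L₂)))).sum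

/-- `(d_m c)(X₁ ⋯ X_n)`, for `c` of degree `d`. -/
def dmFormula (d : ℤ) (c : Space A.gr →ₗ[ℝ] M) (L : Sentence A.gr) : M :=
  ∑ j : Fin L.length, dmTerm R d c (L.take j) (L.drop (j + 1)) (L.get j)

/-- `c(L₁ ℓ(X, Y) L₂)`. -/
def evalEll (c : Space A.gr →ₗ[ℝ] M) (L₁ : Sentence A.gr) (X Y : Word A.gr)
    (L₂ : Sentence A.gr) : M :=
  ((ellWord A.ops X Y).map (fun t => t.1 • c (mk (L₁ ++ t.2 :: L₂)))).sum

/-- `(d_ℓ c)(Z₁ ⋯ Z_r)`, for `c` of degree `d`: an action term for every word of length one and a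
bracket term for every pair `i < j`. -/
def dellFormula (d : ℤ) (c : Space A.gr →ₗ[ℝ] M) (L : Sentence A.gr) : M :=
  ((picks wordDeg L).map (fun t =>
      (t.1 * (-1 : ℝ) ^ (d * wordDeg t.2.1)) • ellAct R t.2.1 (c (mk t.2.2)))).sum
    - (-1 : ℝ) ^ d •
      ((pickPairs wordDeg L).map (fun t =>
        t.1 • evalEll c [] t.2.1 t.2.2.1 t.2.2.2)).sum

/-- The part of `(d_ℓ c)(Y₁ Y₂ X)`, `X = X₁ ⋯ X_n`, formed by the action terms of the `X_i` and by
the bracket terms of all pairs other than `(Y₁, Y₂)`. -/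
def dellOther (d : ℤ) (c : Space A.gr →ₗ[ℝ] M) (Y₁ Y₂ : Word A.gr) (X : Sentence A.gr) : M :=
  ((picks wordDeg X).map (fun t =>
      (t.1 * (-1 : ℝ) ^ (wordDeg t.2.1 * (wordDeg Y₁ + wordDeg Y₂))
          * (-1 : ℝ) ^ (d * wordDeg t.2.1)) •
        ellAct R t.2.1 (c (mk (Y₁ :: Y₂ :: t.2.2))))).sum
    - (-1 : ℝ) ^ d •
      (((picks wordDeg X).map (fun t =>
          (t.1 * (-1 : ℝ) ^ (wordDeg t.2.1 * wordDeg Y₂)) •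
              evalEll c [] Y₁ t.2.1 (Y₂ :: t.2.2)
            + (t.1 * (-1 : ℝ) ^ (wordDeg Y₁ * (wordDeg Y₂ + wordDeg t.2.1))) •
              evalEll c [] Y₂ t.2.1 (Y₁ :: t.2.2))).sum
        + ((pickPairs wordDeg X).map (fun t =>
          (t.1 * (-1 : ℝ) ^ ((wordDeg t.2.1 + wordDeg t.2.2.1) * (wordDeg Y₁ + wordDeg Y₂))) •
            evalEll c [] t.2.1 t.2.2.1 (Y₁ :: Y₂ :: t.2.2.2))).sum)

/-- The bracket term of the pair `(Y₁, Y₂)` in `(d_ℓ c)(Y₁ Y₂ L₁ L₂)`, with `ℓ(Y₁, Y₂)` put between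
`L₁` and `L₂`. -/
def dellBracket (d : ℤ) (c : Space A.gr →ₗ[ℝ] M) (Y₁ Y₂ : Word A.gr)
    (L₁ L₂ : Sentence A.gr) : M :=
  -((-1 : ℝ) ^ d • (-1 : ℝ) ^ ((wordDeg Y₁ + wordDeg Y₂) * sentenceDeg L₁) •
    (-1 : ℝ) ^ sentenceDeg L₁ • evalEll c L₁ Y₁ Y₂ L₂)

/-- The action term of `Y₁` in `(d_ℓ c)(Y₁ Y₂ L₁ L₂)`, with `Y₂` put between `L₁` and `L₂`. -/
def dellActFirst (d : ℤ) (c : Space A.gr →ₗ[ℝ] M) (Y₁ Y₂ : Word A.gr)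
    (L₁ L₂ : Sentence A.gr) : M :=
  (-1 : ℝ) ^ (d * wordDeg Y₁) • (-1 : ℝ) ^ (wordDeg Y₂ * sentenceDeg L₁) •
    ellAct R Y₁ (c (mk (L₁ ++ Y₂ :: L₂)))

/-- The action term of `Y₂` in `(d_ℓ c)(Y₁ Y₂ L₁ L₂)`, with `Y₁` put between `L₁` and `L₂`. -/
def dellActSecond (d : ℤ) (c : Space A.gr →ₗ[ℝ] M) (Y₁ Y₂ : Word A.gr)
    (L₁ L₂ : Sentence A.gr) : M :=
  (-1 : ℝ) ^ (d * wordDeg Y₂) •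
    (-1 : ℝ) ^ (wordDeg Y₁ * wordDeg Y₂ + wordDeg Y₁ * sentenceDeg L₁) •
    ellAct R Y₂ (c (mk (L₁ ++ Y₁ :: L₂)))

end Module

/-- All prescriptions on sentences that define the bicoalgebra structure and the operators `m` and
`ℓ` are compatible with the relations. -/
def StructureMapsDescend {V : Type*} [AddCommGroup V] [Module ℝ V] (O : Ops V) : Prop :=
  Descends (coprodVal (gr := O.gr)) ∧ Descends (cobracketVal (gr := O.gr)) ∧
  Descends (cogenVal (gr := O.gr)) ∧ (∀ d : ℤ, Descends (signVal (gr := O.gr) d)) ∧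
  Descends (mVal O) ∧ Descends (ellVal O)

end ChevalleyHarrison

end

open ChevalleyHarrison

noncomputable section

set_option linter.unusedSimpArgs false
set_option linter.unusedSectionVars false
set_option linter.unusedVariables false
set_option linter.unnecessarySeqFocus false

namespace ChevalleyHarrison

/-! ### Signs -/

/-! The argument is carried out on functions instead of elements. For every operation on words or
sentences (shuffle product, bracket, `m`, `ℓ`, `Δ`, `κ`), the value of an arbitrary function on the
result is defined by recursion on the first letter or the first word: `SH`, `BR`, `MW`, `der`,
`ells`, `cop`, `kap`. The functions that respect the relations are called `NGood` (on words) and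
`Good` (on sentences). A `Good` function that vanishes on the empty sentence descends to the
quotient (`Good.descends`), and the class map itself is `Good` (`mk_good`). An operation is
therefore well defined as soon as composing with it preserves goodness.

On words this comes down to three facts. The bracket with a word is a derivation of the shuffle
product (`BR_shuffle`). So is `m` (`SH_MW`), because products of a letter of one word with a letter
of the other occur twice and cancel by graded commutativity. Modulo shuffles, the cuts of a shuffle
of `X` and `Y` reduce to `X ⊗ Y` and `Y ⊗ X` (`FC_shuffle`), and the symmetrization in `κ` makes
these two cancel (`NGood.FC_cobracket`).

The coboundary is computed from the corestriction of `m + ℓ`. The projection of `m` to the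
cogenerators is half the product paired with `κ`, and that of `ℓ` is half the bracket paired with
`Δ` (`cogen_codiff`). If `F` is compatible with `Δ` and `κ`, the projection of `(m + ℓ) F` thus
depends only on the projection `ι + c` of `F`, and it is affine in `c` because products and brackets
of two elements of `M` vanish. This yields `d_m` and `d_ℓ` without constructing `F` or `D`. Since
the projection to the cogenerators only sees single letters, few terms of `κ` and `Δ` survive, and
these are the explicit formulas. For `G ⋉ M` only bilinearity, degrees and symmetries of the
operations are used (`Ops.Regular`).

As no coderivation is constructed, the square of the coboundary is treated directly. Splitting off
the first word gives `∂ = θ_X + ∂'`, where `θ_X` (`theta`) collects the terms in which `X` takes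
part and `∂'` is the coboundary of `f(X ·)`. By induction on the remaining words, `θ_X` and `θ_Y`
anticommute up to `θ` of the bracket of `X` and `Y` (`theta_theta`), `θ_X` anticommutes with `∂`
(`theta_dT`), and `∂² = 0` follows (`dT_dT`). The inductive step uses the Jacobi identity for words.
The base cases are the module axioms: the Hochschild coboundary of one word squares to zero
(`hoch_hoch`), those of two words commute with sign (`hoch_comm`), the bracket acts as a Lie action
(`actLin_actLin`), and the mixed terms cancel by the compatibility of the two actions together with
vanishing on shuffles (`mixed_hoch`). -/

/-- The sign `(-1)^n`. -/
def sg (n : ℤ) : ℝ := (-1) ^ n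

theorem neg_one_zpow_eq_sg (n : ℤ) : (-1 : ℝ) ^ n = sg n := rfl

theorem sg_add (m n : ℤ) : sg (m + n) = sg m * sg n := zpow_add₀ (by norm_num) m n

theorem sg_neg (n : ℤ) : sg (-n) = sg n := by
  rw [sg, sg, zpow_neg, ← inv_zpow]; norm_num

theorem sg_sub (m n : ℤ) : sg (m - n) = sg m * sg n := by
  rw [sub_eq_add_neg, sg_add, sg_neg]

theorem sg_zero : sg 0 = 1 := zpow_zero _

theorem sg_one : sg 1 = -1 := zpow_one _

theorem sg_mul_self (n : ℤ) : sg n * sg n = 1 := by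
  rw [← sg_add, sg, ← two_mul, zpow_mul]; norm_num

theorem sg_mul_self_assoc (n : ℤ) (r : ℝ) : sg n * (sg n * r) = r := by
  rw [← mul_assoc, sg_mul_self, one_mul]

theorem sg_sq (n : ℤ) : sg (n * n) = sg n := by
  rcases Int.even_or_odd n with h | h
  · rw [sg, sg, h.neg_one_zpow, (h.mul_right n).neg_one_zpow]
  · rw [sg, sg, h.neg_one_zpow, (h.mul h).neg_one_zpow]

theorem sg_two : sg 2 = 1 := by rw [sg]; norm_num

theorem sg_smul_self {W : Type*} [AddCommGroup W] [Module ℝ W] (n : ℤ) (v : W) :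
    sg n • sg n • v = v := by rw [smul_smul, sg_mul_self, one_smul]

/-- Rewriting rules which bring a product of signs into normal form. -/
theorem sign_rules :
    (∀ a b c : ℤ, a * (b + c) = a * b + a * c) ∧ (∀ a b c : ℤ, (a + b) * c = a * c + b * c) ∧
    (∀ a b c : ℤ, a * (b - c) = a * b - a * c) ∧ (∀ a b c : ℤ, (a - b) * c = a * c - b * c) ∧
    (∀ a b : ℤ, -a * b = -(a * b)) ∧ (∀ a b : ℤ, a * -b = -(a * b)) ∧
    (∀ a : ℤ, a * 1 = a) ∧ (∀ a : ℤ, 1 * a = a) ∧ (∀ a : ℤ, a * 0 = 0) ∧ (∀ a : ℤ, 0 * a = 0) ∧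
    (∀ a : ℤ, a + 0 = a) ∧ (∀ a : ℤ, 0 + a = a) ∧
    (∀ a b : ℤ, a * b = b * a) ∧ (∀ a b c : ℤ, a * (b * c) = b * (a * c)) ∧
    (∀ a b c : ℤ, a * b * c = a * (b * c)) ∧
    (∀ m n, sg (m + n) = sg m * sg n) ∧ (∀ m n, sg (m - n) = sg m * sg n) ∧
    (∀ n, sg (-n) = sg n) ∧ sg 0 = 1 ∧ sg 1 = -1 ∧ sg 2 = 1 ∧ (∀ n, sg (n * n) = sg n) ∧
    (∀ n, sg n * sg n = 1) ∧ (∀ n r, sg n * (sg n * r) = r) ∧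
    (∀ r s : ℝ, r * s = s * r) ∧ (∀ r s t : ℝ, r * (s * t) = s * (r * t)) ∧
    (∀ r s t : ℝ, r * s * t = r * (s * t)) ∧ (∀ r s : ℝ, r * -s = -(r * s)) ∧
    (∀ r s : ℝ, -r * s = -(r * s)) ∧ (∀ r : ℝ, r * 1 = r) ∧ (∀ r : ℝ, 1 * r = r) ∧
    (∀ r : ℝ, - -r = r) :=
  ⟨mul_add, add_mul, mul_sub, sub_mul, neg_mul, mul_neg, mul_one, one_mul, mul_zero, zero_mul,
    add_zero, zero_add, mul_comm, mul_left_comm, mul_assoc, sg_add, sg_sub, sg_neg, sg_zero,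
    sg_one, sg_two, sg_sq, sg_mul_self, sg_mul_self_assoc, mul_comm, mul_left_comm, mul_assoc,
    mul_neg, neg_mul, mul_one, one_mul, neg_neg⟩

/-! ### Finite linear combinations given by lists -/

section LC

variable {W W' : Type*} [AddCommGroup W] [Module ℝ W] [AddCommGroup W'] [Module ℝ W']
  {α β : Type*}

/-- The value `∑ r g(x)` of `g` on the formal combination `∑ r x`. -/
def lc (l : List (ℝ × α)) (g : α → W) : W := (l.map fun t => t.1 • g t.2).sum

@[simp] theorem lc_nil (g : α → W) : lc [] g = 0 := rfl

@[simp] theorem lc_cons (t : ℝ × α) (l : List (ℝ × α)) (g : α → W) :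
    lc (t :: l) g = t.1 • g t.2 + lc l g := by simp [lc]

@[simp] theorem lc_append (l l' : List (ℝ × α)) (g : α → W) :
    lc (l ++ l') g = lc l g + lc l' g := by simp [lc]

theorem lc_map (l : List (ℝ × β)) (h : β → α) (g : α → W) :
    lc (l.map fun t => (t.1, h t.2)) g = lc l fun b => g (h b) := by
  simp [lc, Function.comp_def]

theorem lc_map_mul (r : ℝ) (l : List (ℝ × β)) (h : β → α) (g : α → W) :
    lc (l.map fun t => (r * t.1, h t.2)) g = r • lc l fun b => g (h b) := by
  simp [lc, Function.comp_def, List.smul_sum, mul_smul]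

theorem lc_congr {l : List (ℝ × α)} {g g' : α → W} (h : ∀ t ∈ l, g t.2 = g' t.2) :
    lc l g = lc l g' := by
  unfold lc
  congr 1
  exact List.map_congr_left fun t ht => by rw [h t ht]

theorem lc_zero (l : List (ℝ × α)) : lc l (fun _ => (0 : W)) = 0 := by
  simp [lc]

theorem lc_add (l : List (ℝ × α)) (g g' : α → W) :
    lc l (fun a => g a + g' a) = lc l g + lc l g' := by
  induction l with
  | nil => simp
  | cons t l ih => simp only [lc_cons, ih, smul_add]; abel

theorem lc_smul (l : List (ℝ × α)) (r : ℝ) (g : α → W) :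
    lc l (fun a => r • g a) = r • lc l g := by
  induction l with
  | nil => simp
  | cons t l ih => simp only [lc_cons, ih, smul_add]; rw [smul_comm]

theorem lc_neg (l : List (ℝ × α)) (g : α → W) : lc l (fun a => -g a) = -lc l g := by
  induction l with
  | nil => simp
  | cons t l ih => simp only [lc_cons, ih, smul_neg]; abel

theorem lc_sub (l : List (ℝ × α)) (g g' : α → W) :
    lc l (fun a => g a - g' a) = lc l g - lc l g' := by
  simp only [sub_eq_add_neg, lc_add, lc_neg]

theorem lc_comm (l : List (ℝ × α)) (l' : List (ℝ × β)) (g : α → β → W) :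
    lc l (fun a => lc l' (g a)) = lc l' (fun b => lc l fun a => g a b) := by
  induction l with
  | nil => simp [lc_zero]
  | cons t l ih => simp only [lc_cons, ih, lc_add, lc_smul]

theorem map_lc (φ : W →ₗ[ℝ] W') (l : List (ℝ × α)) (g : α → W) :
    φ (lc l g) = lc l fun a => φ (g a) := by
  induction l with
  | nil => simp
  | cons t l ih => simp [ih]

end LC

/-! ### Words -/

section Words

variable {V : Type*} [AddCommGroup V] [Module ℝ V] {gr : ℤ → Submodule ℝ V}
  {W : Type*} [AddCommGroup W] [Module ℝ W]

/-- The sum of the degrees of the letters. -/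
def lettersDeg (X : Word gr) : ℤ := (X.map letterDeg).sum

@[simp] theorem lettersDeg_nil : lettersDeg ([] : Word gr) = 0 := rfl

@[simp] theorem lettersDeg_cons (a : Letter gr) (X : Word gr) :
    lettersDeg (a :: X) = letterDeg a + lettersDeg X := by simp [lettersDeg]

@[simp] theorem lettersDeg_append (X Y : Word gr) :
    lettersDeg (X ++ Y) = lettersDeg X + lettersDeg Y := by simp [lettersDeg]

theorem wordDeg_eq (X : Word gr) : wordDeg X = lettersDeg X - 1 := rfl

/-- The value of `g` on the shuffle product of two words. -/
def SH (X Y : Word gr) (g : Word gr → W) : W := lc (shuffles letterDeg X Y) g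

@[simp] theorem SH_nil_left (Y : Word gr) (g : Word gr → W) : SH [] Y g = g Y := by
  simp [SH, shuffles]

@[simp] theorem SH_nil_right (X : Word gr) (g : Word gr → W) : SH X [] g = g X := by
  cases X <;> simp [SH, shuffles]

theorem SH_cons (a b : Letter gr) (x y : Word gr) (g : Word gr → W) :
    SH (a :: x) (b :: y) g = SH x (b :: y) (fun w => g (a :: w))
      + sg (letterDeg b * (letterDeg a + lettersDeg x)) • SH (a :: x) y (fun w => g (b :: w)) := by
  simp only [SH, shuffles, lc_append, lc_map, lc_map_mul]
  rw [neg_one_zpow_eq_sg]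
  simp [lettersDeg]

variable (O : Ops V)

/-- The value of `g` on the bracket of two words. -/
def BR (X Y : Word O.gr) (g : Word O.gr → W) : W := lc (bracketWord O X Y) g

@[simp] theorem BR_nil_left (Y : Word O.gr) (g : Word O.gr → W) : BR O [] Y g = 0 := by
  simp [BR, bracketWord]

@[simp] theorem BR_nil_right (X : Word O.gr) (g : Word O.gr → W) : BR O X [] g = 0 := by
  cases X <;> simp [BR, bracketWord]

theorem BR_cons (a b : Letter O.gr) (x y : Word O.gr) (g : Word O.gr → W) :
    BR O (a :: x) (b :: y) g =
      sg (letterDeg b * lettersDeg x) • SH x y (fun w => g (O.bracket a b :: w))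
      + BR O x (b :: y) (fun w => g (a :: w))
      + sg (letterDeg b * (letterDeg a + lettersDeg x)) •
        BR O (a :: x) y (fun w => g (b :: w)) := by
  simp only [SH, BR, bracketWord, lc_append, lc_map, lc_map_mul]
  simp only [neg_one_zpow_eq_sg]
  simp [lettersDeg]

/-- The value of `g` on the product of `a` with the first letter of a word. -/
def M1 (a : Letter O.gr) : Word O.gr → (Word O.gr → W) → W
  | [], _ => 0
  | b :: w, g => sg (letterDeg a) • g (O.mul a b :: w)

/-- The value of `g` on `m(X)`. -/
def MW (X : Word O.gr) (g : Word O.gr → W) : W := lc (mWord O X) g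

@[simp] theorem MW_nil (g : Word O.gr → W) : MW O [] g = 0 := rfl

theorem MW_cons (a : Letter O.gr) (x : Word O.gr) (g : Word O.gr → W) :
    MW O (a :: x) g = M1 O a x g + sg (letterDeg a) • MW O x (fun w => g (a :: w)) := by
  cases x with
  | nil => simp [MW, M1, mWord]
  | cons b w =>
    simp only [MW, mWord, lc_cons, lc_map_mul, M1, neg_one_zpow_eq_sg]

/-! Linearity in `g`. -/

theorem SH_add (X Y : Word gr) (g g' : Word gr → W) :
    SH X Y (fun w => g w + g' w) = SH X Y g + SH X Y g' := lc_add _ _ _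

theorem SH_smul (X Y : Word gr) (r : ℝ) (g : Word gr → W) :
    SH X Y (fun w => r • g w) = r • SH X Y g := lc_smul _ _ _

theorem BR_add (X Y : Word O.gr) (g g' : Word O.gr → W) :
    BR O X Y (fun w => g w + g' w) = BR O X Y g + BR O X Y g' := lc_add _ _ _

theorem BR_smul (X Y : Word O.gr) (r : ℝ) (g : Word O.gr → W) :
    BR O X Y (fun w => r • g w) = r • BR O X Y g := lc_smul _ _ _

theorem MW_add (X : Word O.gr) (g g' : Word O.gr → W) :
    MW O X (fun w => g w + g' w) = MW O X g + MW O X g' := lc_add _ _ _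

theorem MW_smul (X : Word O.gr) (r : ℝ) (g : Word O.gr → W) :
    MW O X (fun w => r • g w) = r • MW O X g := lc_smul _ _ _

/-! Degrees and lengths. -/

theorem shuffles_spec : ∀ (X Y : Word gr), ∀ t ∈ shuffles letterDeg X Y,
    lettersDeg t.2 = lettersDeg X + lettersDeg Y ∧ t.2.length = X.length + Y.length
  | [], Y => by simp [shuffles]
  | a :: x, [] => by simp [shuffles]
  | a :: x, b :: y => by
    intro t ht
    rw [shuffles] at ht
    simp only [List.mem_append, List.mem_map] at ht
    rcases ht with ⟨s, hs, rfl⟩ | ⟨s, hs, rfl⟩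
    · have := shuffles_spec x (b :: y) s hs
      simp only [lettersDeg_cons, List.length_cons] at this ⊢
      omega
    · have := shuffles_spec (a :: x) y s hs
      simp only [lettersDeg_cons, List.length_cons] at this ⊢
      omega
  termination_by X Y => X.length + Y.length

theorem SH_congr {X Y : Word gr} {g g' : Word gr → W}
    (h : ∀ w, lettersDeg w = lettersDeg X + lettersDeg Y → w.length = X.length + Y.length →
      g w = g' w) : SH X Y g = SH X Y g' :=
  lc_congr fun t ht => h _ (shuffles_spec X Y t ht).1 (shuffles_spec X Y t ht).2

end Words

theorem smul_of_eq {W : Type*} [AddCommGroup W] [Module ℝ W] (r : ℝ) {v w : W} (h : v = w) :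
    r • v = r • w := by rw [h]

section Words

variable {V : Type*} [AddCommGroup V] [Module ℝ V] {gr : ℤ → Submodule ℝ V}
  {W : Type*} [AddCommGroup W] [Module ℝ W]

/-! ### The shuffle product -/

/-- All words in a shuffle product have the same degree, so a sign that depends on this degree is a
common factor. The later inductions use this to pull all signs outside the sums. -/
theorem SH_sg (X Y : Word gr) (p q : ℤ) (g : Word gr → W) :
    SH X Y (fun w => sg (p * (q + lettersDeg w)) • g w) =
      sg (p * (q + (lettersDeg X + lettersDeg Y))) • SH X Y g := by
  rw [← SH_smul]
  exact SH_congr fun w hw _ => by rw [hw]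

theorem SH_sg' (X Y : Word gr) (p : ℤ) (g : Word gr → W) :
    SH X Y (fun w => sg (p * lettersDeg w) • g w) =
      sg (p * (lettersDeg X + lettersDeg Y)) • SH X Y g := by
  rw [← SH_smul]
  exact SH_congr fun w hw _ => by rw [hw]

theorem SH_comm : ∀ (X Y : Word gr) (g : Word gr → W),
    SH X Y g = sg (lettersDeg X * lettersDeg Y) • SH Y X g
  | [], Y, g => by simp [sg_zero]
  | a :: x, [], g => by simp [sg_zero]
  | a :: x, b :: y, g => by
    rw [SH_cons, SH_cons, SH_comm x (b :: y), SH_comm (a :: x) y]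
    simp only [lettersDeg_cons, smul_add, smul_smul, sign_rules]
    module
  termination_by X Y => X.length + Y.length

/-- The first letter of a triple shuffle comes from `X`, `Y` or `Z`, and each case is the induction
hypothesis for a shorter word, multiplied by the sign of moving that letter to the front. The later
word identities follow the same pattern. -/
theorem SH_assoc : ∀ (X Y Z : Word gr) (g : Word gr → W),
    SH X Y (fun w => SH w Z g) = SH Y Z (fun w => SH X w g)
  | [], Y, Z, g => by simp
  | a :: x, [], Z, g => by simp
  | a :: x, b :: y, [], g => by simp
  | a :: x, b :: y, c :: z, g => by
    have h1 := SH_assoc x (b :: y) (c :: z) fun w => g (a :: w)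
    have h2 := smul_of_eq (sg (letterDeg b * (letterDeg a + lettersDeg x)))
      (SH_assoc (a :: x) y (c :: z) fun w => g (b :: w))
    have h3 := smul_of_eq
      (sg (letterDeg c * (letterDeg a + lettersDeg x + letterDeg b + lettersDeg y)))
      (SH_assoc (a :: x) (b :: y) z fun w => g (c :: w))
    simp only [SH_cons, SH_add, SH_smul, SH_sg] at h1 h2 h3 ⊢
    simp only [lettersDeg_cons, smul_add, smul_smul, sign_rules] at h1 h2 h3 ⊢
    linear_combination (norm := module) h1 + h2 + h3
  termination_by X Y Z => X.length + Y.length + Z.length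

/-! ### Linearity in the letters -/

/-- Formal combinations of letters of the same degree whose sum is zero. -/
def IsLetterNull (N : List (ℝ × Letter gr)) : Prop :=
  ∃ i : ℤ, (∀ t ∈ N, t.2.1.1 = i) ∧ lc N (fun p => p.1.2) = 0

/-- The function `g` is linear in every letter. -/
def LLin (g : Word gr → W) : Prop :=
  ∀ (u v : Word gr) (N : List (ℝ × Letter gr)), IsLetterNull N → lc N (fun p => g (u ++ p :: v)) = 0

theorem LLin.cons {g : Word gr → W} (h : LLin g) (a : Letter gr) : LLin fun w => g (a :: w) :=
  fun u v N hN => h (a :: u) v N hN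

/-- All letters of a null combination have one common degree, so a sign depending on the letter
factors out. -/
theorem IsLetterNull.lc_sg {N : List (ℝ × Letter gr)} (hN : IsLetterNull N) (e : ℤ → ℤ)
    {g : Letter gr → W} (h : lc N g = 0) : lc N (fun p => sg (e (letterDeg p)) • g p) = 0 := by
  obtain ⟨i, hi, -⟩ := hN
  have : lc N (fun p => sg (e (letterDeg p)) • g p) = lc N (fun p => sg (e (i - 1)) • g p) :=
    lc_congr fun t ht => by rw [letterDeg, hi t ht]
  rw [this, lc_smul, h, smul_zero]

theorem lc_SH_eq_zero {α : Type*} (N : List (ℝ × α)) (X Y : Word gr) (g : α → Word gr → W)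
    (h : ∀ w, lc N (fun p => g p w) = 0) : lc N (fun p => SH X Y (g p)) = 0 := by
  unfold SH
  rw [lc_comm]
  simp only [h, lc_zero]

theorem LLin.SH_left : ∀ (u v Y : Word gr) {g : Word gr → W}, LLin g →
    ∀ N : List (ℝ × Letter gr), IsLetterNull N → lc N (fun p => SH (u ++ p :: v) Y g) = 0
  | u, v, [], g, h, N, hN => by simpa using h u v N hN
  | [], v, b :: y, g, h, N, hN => by
    have e1 : lc N (fun p => SH v (b :: y) fun w => g (p :: w)) = 0 :=
      lc_SH_eq_zero _ _ _ _ fun w => h [] w N hN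
    have e2 := hN.lc_sg (fun n => letterDeg b * (n + lettersDeg v))
      (LLin.SH_left [] v y (h.cons b) N hN)
    simp only [List.nil_append] at e2
    simp only [List.nil_append, SH_cons, lc_add, e1, e2, add_zero]
  | a :: u, v, b :: y, g, h, N, hN => by
    have e1 := LLin.SH_left u v (b :: y) (h.cons a) N hN
    have e2 := hN.lc_sg (fun n => letterDeg b * (letterDeg a + (lettersDeg u + (n + lettersDeg v))))
      (LLin.SH_left (a :: u) v y (h.cons b) N hN)
    simp only [List.cons_append] at e2
    simp only [List.cons_append, SH_cons, lc_add, lettersDeg_append, lettersDeg_cons, e1, e2,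
      add_zero]
  termination_by u _ Y => u.length + Y.length

end Words

/-! ### Degrees and symmetries of the operations -/

/-- The operations are bilinear and of the expected degrees, the product is graded commutative and
the bracket is graded skew symmetric. -/
structure Ops.Regular {V : Type*} [AddCommGroup V] [Module ℝ V] (O : Ops V) : Prop where
  mul_deg : ∀ a b, letterDeg (O.mul a b) = letterDeg a + letterDeg b + 1
  bracket_deg : ∀ a b, letterDeg (O.bracket a b) = letterDeg a + letterDeg b
  mul_null_left : ∀ N b, IsLetterNull N → IsLetterNull (N.map fun t => (t.1, O.mul t.2 b))
  mul_null_right : ∀ N a, IsLetterNull N → IsLetterNull (N.map fun t => (t.1, O.mul a t.2))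
  bracket_null_left : ∀ N b, IsLetterNull N → IsLetterNull (N.map fun t => (t.1, O.bracket t.2 b))
  mul_comm : ∀ a b, IsLetterNull
    [(1, O.mul a b), (-sg ((letterDeg a + 1) * (letterDeg b + 1)), O.mul b a)]
  bracket_skew : ∀ a b, IsLetterNull
    [(1, O.bracket a b), (sg (letterDeg a * letterDeg b), O.bracket b a)]

section Regular

variable {V : Type*} [AddCommGroup V] [Module ℝ V] {O : Ops V}
  {W : Type*} [AddCommGroup W] [Module ℝ W]

theorem bracketWord_spec (hO : O.Regular) : ∀ (X Y : Word O.gr), ∀ t ∈ bracketWord O X Y,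
    lettersDeg t.2 = lettersDeg X + lettersDeg Y ∧ t.2.length + 1 = X.length + Y.length ∧
      X ≠ [] ∧ Y ≠ []
  | [], Y => by simp [bracketWord]
  | a :: x, [] => by simp [bracketWord]
  | a :: x, b :: y => by
    intro t ht
    rw [bracketWord] at ht
    simp only [List.mem_append, List.mem_map] at ht
    rcases ht with (⟨s, hs, rfl⟩ | ⟨s, hs, rfl⟩) | ⟨s, hs, rfl⟩
    · have := shuffles_spec x y s hs
      have h2 := hO.bracket_deg a b
      simp only [lettersDeg_cons, List.length_cons] at this ⊢
      refine ⟨by omega, by omega, by simp, by simp⟩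
    · have := bracketWord_spec hO x (b :: y) s hs
      simp only [lettersDeg_cons, List.length_cons] at this ⊢
      refine ⟨by omega, by omega, by simp, by simp⟩
    · have := bracketWord_spec hO (a :: x) y s hs
      simp only [lettersDeg_cons, List.length_cons] at this ⊢
      refine ⟨by omega, by omega, by simp, by simp⟩
  termination_by X Y => X.length + Y.length

theorem BR_congr (hO : O.Regular) {X Y : Word O.gr} {g g' : Word O.gr → W}
    (h : ∀ w, lettersDeg w = lettersDeg X + lettersDeg Y → w.length + 1 = X.length + Y.length →
      X ≠ [] → Y ≠ [] → g w = g' w) : BR O X Y g = BR O X Y g' :=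
  lc_congr fun t ht => by
    obtain ⟨h1, h2, h3, h4⟩ := bracketWord_spec hO X Y t ht
    exact h _ h1 h2 h3 h4

theorem mWord_spec (hO : O.Regular) : ∀ (X : Word O.gr), ∀ t ∈ mWord O X,
    lettersDeg t.2 = lettersDeg X + 1 ∧ t.2.length + 1 = X.length ∧ t.2 ≠ []
  | [] => by simp [mWord]
  | [a] => by simp [mWord]
  | a :: b :: w => by
    intro t ht
    rw [mWord] at ht
    simp only [List.mem_cons, List.mem_map] at ht
    rcases ht with rfl | ⟨s, hs, rfl⟩
    · have h2 := hO.mul_deg a b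
      refine ⟨?_, by simp, by simp⟩
      simp only [lettersDeg_cons]
      omega
    · have := mWord_spec hO (b :: w) s hs
      simp only [lettersDeg_cons, List.length_cons] at this ⊢
      refine ⟨by omega, by omega, by simp⟩

theorem MW_congr (hO : O.Regular) {X : Word O.gr} {g g' : Word O.gr → W}
    (h : ∀ w, lettersDeg w = lettersDeg X + 1 → w.length + 1 = X.length → w ≠ [] →
      g w = g' w) : MW O X g = MW O X g' :=
  lc_congr fun t ht => by
    obtain ⟨h1, h2, h3⟩ := mWord_spec hO X t ht
    exact h _ h1 h2 h3

theorem BR_sg (hO : O.Regular) (X Y : Word O.gr) (p q : ℤ) (g : Word O.gr → W) :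
    BR O X Y (fun w => sg (p * (q + lettersDeg w)) • g w) =
      sg (p * (q + (lettersDeg X + lettersDeg Y))) • BR O X Y g := by
  rw [← BR_smul]
  exact BR_congr hO fun w hw _ _ _ => by rw [hw]

theorem BR_sg' (hO : O.Regular) (X Y : Word O.gr) (p : ℤ) (g : Word O.gr → W) :
    BR O X Y (fun w => sg (p * lettersDeg w) • g w) =
      sg (p * (lettersDeg X + lettersDeg Y)) • BR O X Y g := by
  rw [← BR_smul]
  exact BR_congr hO fun w hw _ _ _ => by rw [hw]

theorem MW_sg (hO : O.Regular) (X : Word O.gr) (p q : ℤ) (g : Word O.gr → W) :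
    MW O X (fun w => sg (p * (q + lettersDeg w)) • g w) =
      sg (p * (q + (lettersDeg X + 1))) • MW O X g := by
  rw [← MW_smul]
  exact MW_congr hO fun w hw _ _ => by rw [hw]

theorem MW_sg' (hO : O.Regular) (X : Word O.gr) (p : ℤ) (g : Word O.gr → W) :
    MW O X (fun w => sg (p * lettersDeg w) • g w) =
      sg (p * (lettersDeg X + 1)) • MW O X g := by
  rw [← MW_smul]
  exact MW_congr hO fun w hw _ _ => by rw [hw]

theorem LLin.mul_comm (hO : O.Regular) {g : Word O.gr → W} (hg : LLin g) (a b : Letter O.gr)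
    (w : Word O.gr) : g (O.mul b a :: w) =
      sg ((letterDeg a + 1) * (letterDeg b + 1)) • g (O.mul a b :: w) := by
  have h := hg [] w _ (hO.mul_comm b a)
  simp only [lc_cons, lc_nil, List.nil_append, one_smul, add_zero, neg_smul] at h
  rw [add_neg_eq_zero.1 h, _root_.mul_comm]

theorem LLin.bracket_skew (hO : O.Regular) {g : Word O.gr → W} (hg : LLin g) (a b : Letter O.gr)
    (w : Word O.gr) : g (O.bracket b a :: w) =
      -sg (letterDeg a * letterDeg b) • g (O.bracket a b :: w) := by
  have h := hg [] w _ (hO.bracket_skew b a)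
  simp only [lc_cons, lc_nil, List.nil_append, one_smul, add_zero] at h
  rw [eq_neg_of_add_eq_zero_left h, _root_.mul_comm, neg_smul]

/-! ### The bracket of words -/

/-- Exchanging the words interchanges the terms that begin with an untouched letter of `X` and those
that begin with one of `Y`. The terms that begin with the bracket of the first letters are handled
by skew symmetry of letters and commutativity of shuffles. -/
theorem BR_skew (hO : O.Regular) : ∀ (X Y : Word O.gr) {g : Word O.gr → W}, LLin g →
    BR O X Y g = -sg (lettersDeg X * lettersDeg Y) • BR O Y X g
  | [], Y, g, _ => by simp
  | a :: x, [], g, _ => by simp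
  | a :: x, b :: y, g, hg => by
    rw [BR_cons, BR_cons, BR_skew hO x (b :: y) (hg.cons a), BR_skew hO (a :: x) y (hg.cons b)]
    simp only [hg.bracket_skew hO a b, SH_smul]
    rw [SH_comm x y]
    simp only [lettersDeg_cons, smul_add, smul_smul, sign_rules]
    module
  termination_by X Y => X.length + Y.length

theorem lc_BR_eq_zero {α : Type*} (N : List (ℝ × α)) (X Y : Word O.gr) (g : α → Word O.gr → W)
    (h : ∀ w, lc N (fun p => g p w) = 0) : lc N (fun p => BR O X Y (g p)) = 0 := by
  unfold BR
  rw [lc_comm]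
  simp only [h, lc_zero]

theorem LLin.BR_left (hO : O.Regular) : ∀ (u v Y : Word O.gr) {g : Word O.gr → W}, LLin g →
    ∀ N : List (ℝ × Letter O.gr), IsLetterNull N → lc N (fun p => BR O (u ++ p :: v) Y g) = 0
  | u, v, [], g, h, N, hN => by simp [lc_zero]
  | [], v, b :: y, g, h, N, hN => by
    have e1 : lc N (fun p => BR O v (b :: y) fun w => g (p :: w)) = 0 :=
      lc_BR_eq_zero _ _ _ _ fun w => h [] w N hN
    have e2 := hN.lc_sg (fun n => letterDeg b * (n + lettersDeg v))
      (LLin.BR_left hO [] v y (h.cons b) N hN)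
    have e3 : lc N (fun p => SH v y fun w => g (O.bracket p b :: w)) = 0 :=
      lc_SH_eq_zero _ _ _ _ fun w => by
        have := h [] w _ (hO.bracket_null_left N b hN)
        rwa [lc_map N fun p => O.bracket p b] at this
    simp only [List.nil_append] at e2
    simp only [List.nil_append, BR_cons, lc_add, lc_smul, e1, e2, e3, add_zero, smul_zero]
  | a :: u, v, b :: y, g, h, N, hN => by
    have e1 := LLin.BR_left hO u v (b :: y) (h.cons a) N hN
    have e2 := hN.lc_sg (fun n => letterDeg b * (letterDeg a + (lettersDeg u + (n + lettersDeg v))))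
      (LLin.BR_left hO (a :: u) v y (h.cons b) N hN)
    have e3 := hN.lc_sg (fun n => letterDeg b * (lettersDeg u + (n + lettersDeg v)))
      (LLin.SH_left u v y (h.cons (O.bracket a b)) N hN)
    simp only [List.cons_append] at e2
    simp only [List.cons_append, BR_cons, lc_add, lettersDeg_append, lettersDeg_cons, e1, e2, e3,
      add_zero]
  termination_by u _ Y => u.length + Y.length

theorem LLin.BR (hO : O.Regular) {g : Word O.gr → W} (h : LLin g) (Y : Word O.gr) :
    LLin fun X => BR O X Y g :=
  fun u v N hN => LLin.BR_left hO u v Y h N hN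

/-- Bracketing with `Z` is a derivation of the shuffle product. Terms beginning with an untouched
letter `a`, `b` or `c` are induction hypotheses (`h1`, `h2`, `h3`). Terms beginning with `[a, c]` or
`[b, c]` continue with a triple shuffle of the remaining letters and match by associativity (`h4`,
`h5`). Of the bracket of letters, only its degree matters. -/
theorem BR_shuffle (hO : O.Regular) : ∀ (X Y Z : Word O.gr) (g : Word O.gr → W),
    SH X Y (fun w => BR O w Z g) = BR O Y Z (fun w => SH X w g)
      + sg (lettersDeg Y * lettersDeg Z) • BR O X Z (fun w => SH w Y g)
  | [], Y, Z, g => by simp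
  | a :: x, [], Z, g => by simp [sg_zero]
  | a :: x, b :: y, [], g => by simp [SH, lc_zero]
  | a :: x, b :: y, c :: z, g => by
    have h1 := BR_shuffle hO x (b :: y) (c :: z) fun w => g (a :: w)
    have h2 := smul_of_eq (sg (letterDeg b * (letterDeg a + lettersDeg x)))
      (BR_shuffle hO (a :: x) y (c :: z) fun w => g (b :: w))
    have h3 := smul_of_eq
      (sg (letterDeg c * (letterDeg a + lettersDeg x + letterDeg b + lettersDeg y)))
      (BR_shuffle hO (a :: x) (b :: y) z fun w => g (c :: w))
    have h4 := SH_assoc x (b :: y) z fun w => g (O.bracket a c :: w)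
    -- On the right of the derivation rule the word `b :: y` is shuffled in after `z`, so it has to
    -- be moved past `z` at the cost of a Koszul sign.
    have h4' : SH (b :: y) z (fun w => SH x w fun w => g (O.bracket a c :: w)) =
        sg ((letterDeg b + lettersDeg y) * lettersDeg z) •
          SH x z (fun w => SH w (b :: y) fun w => g (O.bracket a c :: w)) := by
      rw [SH_assoc x z (b :: y), SH_comm (b :: y) z, lettersDeg_cons]
    rw [h4'] at h4
    have h4 := smul_of_eq (sg (letterDeg c * (lettersDeg x + letterDeg b + lettersDeg y))) h4
    have h5 := SH_assoc (a :: x) y z fun w => g (O.bracket b c :: w)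
    have h5 := smul_of_eq (sg (letterDeg b * (letterDeg a + lettersDeg x)
      + letterDeg c * (letterDeg a + lettersDeg x + lettersDeg y))) h5
    simp only [SH_cons, BR_cons, SH_add, SH_smul, BR_add, BR_smul, SH_sg, SH_sg', BR_sg hO,
      hO.bracket_deg, lettersDeg_cons] at h1 h2 h3 h4 h5 ⊢
    generalize letterDeg a = da, letterDeg b = db, letterDeg c = dc, lettersDeg x = dx,
      lettersDeg y = dy, lettersDeg z = dz at h1 h2 h3 h4 h5 ⊢
    simp only [smul_add, smul_smul, sign_rules] at h1 h2 h3 h4 h5 ⊢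
    linear_combination (norm := module) h1 + h2 + h3 + h4 + h5
  termination_by X Y Z => X.length + Y.length + Z.length

end Regular

/-- The operations satisfy the identities of a Gerstenhaber algebra. -/
structure Ops.Gerstenhaber {V : Type*} [AddCommGroup V] [Module ℝ V] (O : Ops V) : Prop
    extends O.Regular where
  jacobi : ∀ a b c, IsLetterNull
    [(sg (letterDeg a * letterDeg c), O.bracket (O.bracket a b) c),
      (sg (letterDeg b * letterDeg a), O.bracket (O.bracket b c) a),
      (sg (letterDeg c * letterDeg b), O.bracket (O.bracket c a) b)]
  mul_assoc : ∀ a b c, IsLetterNull [(1, O.mul (O.mul a b) c), (-1, O.mul a (O.mul b c))]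
  leibniz : ∀ a b c, IsLetterNull
    [(1, O.bracket a (O.mul b c)), (-1, O.mul (O.bracket a b) c),
      (-sg ((letterDeg b + 1) * letterDeg a), O.mul b (O.bracket a c))]
  leibniz' : ∀ a b c, IsLetterNull
    [(1, O.bracket (O.mul a b) c), (-1, O.mul a (O.bracket b c)),
      (-sg ((letterDeg b + 1) * letterDeg c), O.mul (O.bracket a c) b)]

/-! ### The Jacobi identity for words and the compatibility of `m` with shuffles and brackets -/

section Regular

variable {V : Type*} [AddCommGroup V] [Module ℝ V] {O : Ops V}
  {W : Type*} [AddCommGroup W] [Module ℝ W]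

/-- In the Jacobi identity the three double brackets of first letters come with cyclically permuted
shuffles of the tails. This brings them to one common shuffle. -/
theorem SH_rotate (x y z : Word O.gr) (g : Word O.gr → W) :
    SH x y (fun w => SH w z g) =
      sg (lettersDeg x * (lettersDeg y + lettersDeg z)) • SH y z (fun w => SH w x g) := by
  rw [SH_assoc, ← SH_sg']
  congr 1
  funext w
  rw [SH_comm, mul_comm, mul_comm]

theorem LLin.SH {g : Word O.gr → W} (h : LLin g) (Y : Word O.gr) :
    LLin fun X => SH X Y g :=
  fun u v N hN => LLin.SH_left u v Y h N hN

/-- This is the derivation rule with one bracket reversed by skew symmetry, so that its terms appear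
in the cyclic order of the Jacobi identity. -/
theorem SH_BR_rotate (hO : O.Regular) (x y z : Word O.gr) {g : Word O.gr → W} (hg : LLin g) :
    SH x y (fun w => BR O w z g) =
      sg (lettersDeg x * (lettersDeg y + lettersDeg z)) • BR O y z (fun w => SH w x g)
      - sg (lettersDeg z * (lettersDeg x + lettersDeg y)) • BR O z x (fun w => SH w y g) := by
  rw [BR_shuffle hO, BR_skew hO x z (hg.SH y), ← BR_sg' hO]
  simp only [SH_comm x]
  simp only [smul_smul, sign_rules, BR_sg' hO]
  module

theorem BR_zero (X Y : Word O.gr) : BR O X Y (fun _ => (0 : W)) = 0 := lc_zero _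

/-- Terms are sorted by the first letter of the result. Those beginning with an untouched letter
form the Jacobi identity of shorter words (`h1`, `h2`, `h3`). Those beginning with a single bracket
of letters cancel by the derivation rule for the tails (`k1`, `k2`, `k3`). Those beginning with a
double bracket share one triple shuffle of the tails and cancel by the Jacobi identity of letters
(`j`). -/
theorem BR_jacobi (hO : O.Gerstenhaber) : ∀ (X Y Z : Word O.gr) {g : Word O.gr → W}, LLin g →
    sg (lettersDeg X * lettersDeg Z) • BR O X Y (fun w => BR O w Z g)
      + sg (lettersDeg Y * lettersDeg X) • BR O Y Z (fun w => BR O w X g)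
      + sg (lettersDeg Z * lettersDeg Y) • BR O Z X (fun w => BR O w Y g) = 0
  | [], Y, Z, g, _ => by simp [BR_zero]
  | a :: x, [], Z, g, _ => by simp [BR_zero]
  | a :: x, b :: y, [], g, _ => by simp [BR_zero]
  | a :: x, b :: y, c :: z, g, hg => by
    have hR := hO.toRegular
    have h1 := BR_jacobi hO x (b :: y) (c :: z) (hg.cons a)
    have h2 := BR_jacobi hO (a :: x) y (c :: z) (hg.cons b)
    have h3 := BR_jacobi hO (a :: x) (b :: y) z (hg.cons c)
    have k1 := SH_BR_rotate hR x y (c :: z) (hg.cons (O.bracket a b))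
    have k2 := SH_BR_rotate hR y z (a :: x) (hg.cons (O.bracket b c))
    have k3 := SH_BR_rotate hR z x (b :: y) (hg.cons (O.bracket c a))
    have j : SH x y (fun w => SH w z fun w => sg (letterDeg a * letterDeg c) •
          g (O.bracket (O.bracket a b) c :: w)
        + sg (letterDeg b * letterDeg a) • g (O.bracket (O.bracket b c) a :: w)
        + sg (letterDeg c * letterDeg b) • g (O.bracket (O.bracket c a) b :: w)) = 0 := by
      have : ∀ w, sg (letterDeg a * letterDeg c) • g (O.bracket (O.bracket a b) c :: w)
        + sg (letterDeg b * letterDeg a) • g (O.bracket (O.bracket b c) a :: w)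
        + sg (letterDeg c * letterDeg b) • g (O.bracket (O.bracket c a) b :: w) = 0 := fun w => by
        simpa [add_assoc] using hg [] w _ (hO.jacobi a b c)
      simp only [this]
      simp [SH, lc_zero]
    simp only [SH_add, SH_smul] at j
    rw [SH_rotate x y z fun w => g (O.bracket (O.bracket b c) a :: w),
      ← sg_smul_self (lettersDeg z * (lettersDeg x + lettersDeg y))
        (SH x y fun w => SH w z fun w => g (O.bracket (O.bracket c a) b :: w)),
      ← SH_rotate z x y] at j
    simp only [BR_cons, SH_add, SH_smul, BR_add, BR_smul, SH_sg, SH_sg', BR_sg hR, BR_sg' hR,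
      hR.bracket_deg, lettersDeg_cons] at h1 h2 h3 k1 k2 k3 j ⊢
    simp only [hg.bracket_skew hR a b, hg.bracket_skew hR b c, hg.bracket_skew hR c a,
      SH_smul, BR_smul] at h1 h2 h3 k1 k2 k3 j ⊢
    generalize letterDeg a = da, letterDeg b = db, letterDeg c = dc, lettersDeg x = dx,
      lettersDeg y = dy, lettersDeg z = dz at h1 h2 h3 k1 k2 k3 j ⊢
    replace h1 := smul_of_eq (sg (da * (dc + dz))) h1
    replace h2 := smul_of_eq (sg (db * (da + dx))) h2
    replace h3 := smul_of_eq (sg (dc * (db + dy))) h3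
    replace k1 := smul_of_eq (sg ((da + dx) * (dc + dz) + db * dx)) k1
    replace k2 := smul_of_eq (sg ((db + dy) * (da + dx) + dc * dy)) k2
    replace k3 := smul_of_eq (sg ((dc + dz) * (db + dy) + da * dz)) k3
    replace j := smul_of_eq (sg ((da + dx) * (dc + dz) + db * dx + dc * (dx + dy) + da * dc)) j
    simp only [smul_add, smul_sub, smul_smul, smul_zero, sign_rules] at h1 h2 h3 k1 k2 k3 j ⊢
    linear_combination (norm := module) h1 + h2 + h3 + k1 + k2 + k3 + j
  termination_by X Y Z => X.length + Y.length + Z.length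

/-! ### The operator `m` on words -/

@[simp] theorem M1_nil (a : Letter O.gr) (g : Word O.gr → W) : M1 O a [] g = 0 := rfl

@[simp] theorem M1_cons (a b : Letter O.gr) (w : Word O.gr) (g : Word O.gr → W) :
    M1 O a (b :: w) g = sg (letterDeg a) • g (O.mul a b :: w) := rfl

/-- These are the terms in which the product involves the first letter of a shuffle. When `a` and
`b` become neighbours at the front, in either order, the products `a b` and `b a` cancel by graded
commutativity. Only products inside `X` or inside `Y` remain, and the subtracted terms remove those
where the first letter of the other word comes in front. -/
theorem SH_M1 (hO : O.Regular) (a b : Letter O.gr) (x y : Word O.gr) {g : Word O.gr → W}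
    (hg : LLin g) :
    SH x (b :: y) (fun w => M1 O a w g)
      + sg (letterDeg b * (letterDeg a + lettersDeg x)) • SH (a :: x) y (fun w => M1 O b w g) =
    M1 O a x (fun w => SH w (b :: y) g)
      - sg (letterDeg b * (letterDeg a + 1 + lettersDeg x)) •
        M1 O a x (fun w => SH w y fun w => g (b :: w))
      + sg (letterDeg a + lettersDeg x) • (M1 O b y (fun w => SH (a :: x) w g)
        - M1 O b y (fun w => SH x w fun w => g (a :: w))) := by
  rcases x with _ | ⟨a', x⟩ <;> rcases y with _ | ⟨b', y⟩ <;>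
  · simp only [M1_nil, M1_cons, SH_nil_left, SH_nil_right, SH_cons, SH_smul, hO.mul_deg,
      lettersDeg_cons, lettersDeg_nil, hg.mul_comm hO a b]
    generalize letterDeg a = da, letterDeg b = db
    try generalize letterDeg a' = da', lettersDeg x = dx
    try generalize letterDeg b' = db', lettersDeg y = dy
    simp only [smul_add, smul_sub, smul_smul, smul_zero, sign_rules]
    module

/-- This is the place where commutativity of the product makes the Hochschild operator compatible
with shuffles, as in Harrison cohomology. The cancellation at the front is `SH_M1`, and the rest is
induction. -/
theorem SH_MW (hO : O.Regular) : ∀ (X Y : Word O.gr) {g : Word O.gr → W}, LLin g →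
    SH X Y (fun w => MW O w g) = MW O X (fun w => SH w Y g)
      + sg (lettersDeg X) • MW O Y (fun w => SH X w g)
  | [], Y, g, _ => by simp [sg_zero]
  | a :: x, [], g, _ => by simp
  | a :: x, b :: y, g, hg => by
    have h1 := SH_MW hO x (b :: y) (hg.cons a)
    have h2 := SH_MW hO (a :: x) y (hg.cons b)
    have k := SH_M1 hO a b x y hg
    simp only [MW_cons, SH_cons, SH_add, SH_smul, MW_add, MW_smul, MW_sg hO, lettersDeg_cons]
      at h1 h2 k ⊢
    generalize letterDeg a = da, letterDeg b = db, lettersDeg x = dx,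
      lettersDeg y = dy at h1 h2 k ⊢
    replace h1 := smul_of_eq (sg da) h1
    replace h2 := smul_of_eq (sg (db * (da + dx) + db)) h2
    simp only [smul_add, smul_sub, smul_smul, smul_zero, sign_rules] at h1 h2 k ⊢
    linear_combination (norm := module) h1 + h2 + k
  termination_by X Y => X.length + Y.length

theorem MW_zero (X : Word O.gr) : MW O X (fun _ => (0 : W)) = 0 := lc_zero _

theorem LLin.leibniz (hO : O.Gerstenhaber) {g : Word O.gr → W} (hg : LLin g) (a b c : Letter O.gr)
    (w : Word O.gr) : g (O.bracket a (O.mul b c) :: w) = g (O.mul (O.bracket a b) c :: w)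
      + sg ((letterDeg b + 1) * letterDeg a) • g (O.mul b (O.bracket a c) :: w) := by
  have h := hg [] w _ (hO.leibniz a b c)
  simp only [lc_cons, lc_nil, List.nil_append, one_smul, add_zero] at h
  linear_combination (norm := module) h

theorem LLin.leibniz' (hO : O.Gerstenhaber) {g : Word O.gr → W} (hg : LLin g) (a b c : Letter O.gr)
    (w : Word O.gr) : g (O.bracket (O.mul a b) c :: w) = g (O.mul a (O.bracket b c) :: w)
      + sg ((letterDeg b + 1) * letterDeg c) • g (O.mul (O.bracket a c) b :: w) := by
  have h := hg [] w _ (hO.leibniz' a b c)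
  simp only [lc_cons, lc_nil, List.nil_append, one_smul, add_zero] at h
  linear_combination (norm := module) h

theorem LLin.mul_assoc (hO : O.Gerstenhaber) {g : Word O.gr → W} (hg : LLin g) (a b c : Letter O.gr)
    (w : Word O.gr) : g (O.mul (O.mul a b) c :: w) = g (O.mul a (O.mul b c) :: w) := by
  have h := hg [] w _ (hO.mul_assoc a b c)
  simp only [lc_cons, lc_nil, List.nil_append, one_smul, add_zero] at h
  linear_combination (norm := module) h

/-- As in `SH_M1`, products of the two first letters cancel. In addition, a bracket next to a
product of neighbouring letters is expanded by the Leibniz rule in the first or the second argument,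
which produces exactly the terms on the other side. -/
theorem BR_M1 (hO : O.Gerstenhaber) (a b : Letter O.gr) (x y : Word O.gr) {g : Word O.gr → W}
    (hg : LLin g) :
    sg (letterDeg b * lettersDeg x) • SH x y (fun w => M1 O (O.bracket a b) w g)
      + BR O x (b :: y) (fun w => M1 O a w g)
      + sg (letterDeg b * (letterDeg a + lettersDeg x)) • BR O (a :: x) y (fun w => M1 O b w g) =
    M1 O a x (fun w => BR O w (b :: y) g)
      - sg (letterDeg b * (letterDeg a + 1 + lettersDeg x)) •
        M1 O a x (fun w => BR O w y fun w => g (b :: w))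
      + sg (letterDeg a + lettersDeg x) • (M1 O b y (fun w => BR O (a :: x) w g)
        - M1 O b y (fun w => BR O x w fun w => g (a :: w))) := by
  have hR := hO.toRegular
  rcases x with _ | ⟨a', x⟩ <;> rcases y with _ | ⟨b', y⟩ <;>
  · simp only [M1_nil, M1_cons, SH_nil_left, SH_nil_right, SH_cons, SH_smul, BR_nil_left,
      BR_nil_right, BR_cons, BR_smul, hO.mul_deg, hO.bracket_deg, hg.leibniz hO, hg.leibniz' hO,
      SH_add, lettersDeg_cons, lettersDeg_nil, hg.mul_comm hR a b]
    generalize letterDeg a = da, letterDeg b = db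
    try generalize letterDeg a' = da', lettersDeg x = dx
    try generalize letterDeg b' = db', lettersDeg y = dy
    simp only [smul_add, smul_sub, smul_smul, smul_zero, sign_rules]
    module

/-- Terms beginning with an untouched letter are induction hypotheses, terms beginning with an
untouched `[a, b]` are `SH_MW` for the tails, and the terms with a product at the front are `BR_M1`.
-/
theorem BR_MW (hO : O.Gerstenhaber) : ∀ (X Y : Word O.gr) {g : Word O.gr → W}, LLin g →
    BR O X Y (fun w => MW O w g) = MW O X (fun w => BR O w Y g)
      + sg (lettersDeg X) • MW O Y (fun w => BR O X w g)
  | [], Y, g, _ => by simp [MW_zero]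
  | a :: x, [], g, _ => by simp [MW_zero]
  | a :: x, b :: y, g, hg => by
    have hR := hO.toRegular
    have h1 := BR_MW hO x (b :: y) (hg.cons a)
    have h2 := BR_MW hO (a :: x) y (hg.cons b)
    have k := BR_M1 hO a b x y hg
    have h3 := SH_MW hR x y (hg.cons (O.bracket a b))
    simp only [MW_cons, SH_cons, BR_cons, SH_add, SH_smul, BR_add, BR_smul, MW_add, MW_smul,
      MW_sg hR, MW_sg' hR, lettersDeg_cons, hO.bracket_deg] at h1 h2 h3 k ⊢
    generalize letterDeg a = da, letterDeg b = db, lettersDeg x = dx,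
      lettersDeg y = dy at h1 h2 h3 k ⊢
    replace h1 := smul_of_eq (sg da) h1
    replace h2 := smul_of_eq (sg (db * (da + dx) + db)) h2
    replace h3 := smul_of_eq (sg (db * dx + da + db)) h3
    simp only [smul_add, smul_sub, smul_smul, smul_zero, sign_rules] at h1 h2 h3 k ⊢
    linear_combination (norm := module) h1 + h2 + h3 + k
  termination_by X Y => X.length + Y.length

/-- Two products at disjoint places occur in both orders with opposite signs. Two overlapping
products give `(a b) c` and `a (b c)`, which cancel by associativity since `m` has degree one. -/
theorem MW_MW (hO : O.Gerstenhaber) : ∀ (X : Word O.gr) {g : Word O.gr → W}, LLin g →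
    MW O X (fun w => MW O w g) = 0
  | [], g, _ => rfl
  | [a], g, _ => rfl
  | a :: b :: x, g, hg => by
    have hR := hO.toRegular
    have h := MW_MW hO (b :: x) (hg.cons a)
    have k : M1 O (O.mul a b) x g + M1 O b x (fun w => M1 O a w g) = 0 := by
      cases x with
      | nil => simp
      | cons c x =>
        simp only [M1_cons, hg.mul_assoc hO, hO.mul_deg, smul_smul, sign_rules]
        module
    simp only [MW_cons, MW_add, MW_smul, M1_cons, hO.mul_deg] at h k ⊢
    replace h := smul_of_eq (sg (letterDeg a) * sg (letterDeg a)) h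
    replace k := smul_of_eq (sg (letterDeg a)) k
    simp only [smul_add, smul_sub, smul_smul, smul_zero, sign_rules] at h k ⊢
    linear_combination (norm := module) h + k

theorem LLin.MW_aux (hO : O.Regular) : ∀ (u v : Word O.gr) {g : Word O.gr → W}, LLin g →
    ∀ N : List (ℝ × Letter O.gr), IsLetterNull N → lc N (fun p => MW O (u ++ p :: v) g) = 0
  | [], v, g, h, N, hN => by
    have e1 : lc N (fun p => MW O v fun w => g (p :: w)) = 0 := by
      unfold MW
      rw [lc_comm]
      simp only [show ∀ w, lc N (fun p => g (p :: w)) = 0 from fun w => h [] w N hN, lc_zero]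
    have e2 : lc N (fun p => M1 O p v g) = 0 := by
      cases v with
      | nil => simp [lc_zero]
      | cons b v =>
        have := h [] v _ (hO.mul_null_left N b hN)
        rw [lc_map N fun p => O.mul p b] at this
        exact hN.lc_sg (fun n => n) this
    simp only [List.nil_append, MW_cons, lc_add, e2, zero_add]
    exact hN.lc_sg (fun n => n) e1
  | a :: u, v, g, h, N, hN => by
    have e1 := LLin.MW_aux hO u v (h.cons a) N hN
    simp only [List.cons_append, MW_cons, lc_add, lc_smul, e1, smul_zero, add_zero]
    cases u with
    | nil =>
      have := h [] v _ (hO.mul_null_right N a hN)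
      rw [lc_map N fun p => O.mul a p] at this
      simp only [List.nil_append] at this
      simp only [List.nil_append, M1_cons, lc_smul, this, smul_zero]
    | cons c u =>
      simp only [List.cons_append, M1_cons, lc_smul, h.cons (O.mul a c) u v N hN, smul_zero]

end Regular

section Snoc

variable {V : Type*} [AddCommGroup V] [Module ℝ V] {gr : ℤ → Submodule ℝ V} {O : Ops V}
  {W : Type*} [AddCommGroup W] [Module ℝ W]

/-! ### Last letters -/

/-- The recursion is repeated here from the right end. The coboundary contains a product with the
last letter of a word, while all definitions split off first letters. -/
theorem SH_snoc (a b : Letter gr) : ∀ (x y : Word gr) (g : Word gr → W),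
    SH (x ++ [a]) (y ++ [b]) g =
      sg (letterDeg a * (lettersDeg y + letterDeg b)) • SH x (y ++ [b]) (fun w => g (w ++ [a]))
      + SH (x ++ [a]) y (fun w => g (w ++ [b]))
  | [], [], g => by
    simp [SH_cons, mul_comm (letterDeg b), add_comm]
  | [], b' :: y, g => by
    have h := SH_snoc a b [] y fun w => g (b' :: w)
    simp only [List.nil_append, List.cons_append, SH_cons, SH_nil_left, lettersDeg_nil,
      lettersDeg_cons] at h ⊢
    rw [h]
    simp only [smul_add, smul_sub, smul_smul, smul_zero, sign_rules]
    module
  | a' :: x, [], g => by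
    have h := SH_snoc a b x [] fun w => g (a' :: w)
    simp only [List.nil_append, List.cons_append, SH_cons, SH_nil_right, lettersDeg_nil,
      lettersDeg_cons, lettersDeg_append] at h ⊢
    rw [h]
    simp only [smul_add, smul_sub, smul_smul, smul_zero, sign_rules]
    module
  | a' :: x, b' :: y, g => by
    have h1 := SH_snoc a b x (b' :: y) fun w => g (a' :: w)
    have h2 := SH_snoc a b (a' :: x) y fun w => g (b' :: w)
    simp only [List.cons_append, SH_cons, lettersDeg_nil,
      lettersDeg_cons, lettersDeg_append] at h1 h2 ⊢
    rw [h1, h2]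
    simp only [smul_add, smul_sub, smul_smul, smul_zero, sign_rules]
    module
  termination_by x y => x.length + y.length

theorem BR_snoc (a b : Letter O.gr) : ∀ (x y : Word O.gr) (g : Word O.gr → W),
    BR O (x ++ [a]) (y ++ [b]) g =
      sg (letterDeg a * lettersDeg y) • SH x y (fun w => g (w ++ [O.bracket a b]))
      + sg (letterDeg a * (lettersDeg y + letterDeg b)) • BR O x (y ++ [b]) (fun w => g (w ++ [a]))
      + BR O (x ++ [a]) y (fun w => g (w ++ [b]))
  | [], [], g => by
    simp [BR_cons]
  | [], b' :: y, g => by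
    have h := BR_snoc a b [] y fun w => g (b' :: w)
    simp only [List.nil_append, List.cons_append, SH_cons, BR_cons, SH_nil_left, BR_nil_left,
      lettersDeg_nil, lettersDeg_cons] at h ⊢
    rw [h]
    simp only [smul_add, smul_sub, smul_smul, smul_zero, sign_rules]
    module
  | a' :: x, [], g => by
    have h := BR_snoc a b x [] fun w => g (a' :: w)
    simp only [List.nil_append, List.cons_append, SH_cons, BR_cons, SH_nil_right, BR_nil_right,
      lettersDeg_nil, lettersDeg_cons, lettersDeg_append] at h ⊢
    rw [h]
    simp only [smul_add, smul_sub, smul_smul, smul_zero, sign_rules]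
    module
  | a' :: x, b' :: y, g => by
    have h1 := BR_snoc a b x (b' :: y) fun w => g (a' :: w)
    have h2 := BR_snoc a b (a' :: x) y fun w => g (b' :: w)
    simp only [List.cons_append, SH_cons, BR_cons, SH_snoc, lettersDeg_nil,
      lettersDeg_cons, lettersDeg_append] at h1 h2 ⊢
    rw [h1, h2]
    generalize letterDeg a = da, letterDeg b = db, letterDeg a' = da', letterDeg b' = db',
      lettersDeg x = dx, lettersDeg y = dy
    simp only [smul_add, smul_sub, smul_smul, smul_zero, sign_rules]
    module
  termination_by x y => x.length + y.length

theorem MW_snoc (y z : Letter O.gr) : ∀ (x : Word O.gr) (g : Word O.gr → W),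
    MW O (x ++ [y, z]) g = MW O (x ++ [y]) (fun w => g (w ++ [z]))
      + sg (lettersDeg x + letterDeg y) • g (x ++ [O.mul y z])
  | [], g => by simp [MW_cons]
  | a :: x, g => by
    have h := MW_snoc y z x fun w => g (a :: w)
    simp only [List.cons_append, MW_cons, lettersDeg_cons] at h ⊢
    rw [h]
    have : M1 O a (x ++ [y, z]) g = M1 O a (x ++ [y]) (fun w => g (w ++ [z])) := by
      cases x <;> simp
    rw [this]
    simp only [smul_add, smul_sub, smul_smul, smul_zero, sign_rules]
    module

/-! ### Cuts -/

/-- The sum of `F(U, W)` over all factorizations `X = U ⊗ W` into two words, possibly empty. -/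
def FC : Word gr → (Word gr → Word gr → W) → W
  | [], F => F [] []
  | a :: x, F => F [] (a :: x) + FC x (fun u w => F (a :: u) w)

theorem FC_congr : ∀ {X : Word gr} {F F' : Word gr → Word gr → W}
    (_ : ∀ u w, u ++ w = X → F u w = F' u w), FC X F = FC X F'
  | [], F, F', h => h [] [] rfl
  | a :: x, F, F', h => by
    rw [FC, FC, h [] (a :: x) rfl, FC_congr fun u w huw => h (a :: u) w (by rw [← huw]; rfl)]

theorem FC_add : ∀ (X : Word gr) (F F' : Word gr → Word gr → W),
    FC X (fun u w => F u w + F' u w) = FC X F + FC X F'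
  | [], F, F' => rfl
  | a :: x, F, F' => by simp only [FC, FC_add x]; abel

theorem FC_smul : ∀ (X : Word gr) (r : ℝ) (F : Word gr → Word gr → W),
    FC X (fun u w => r • F u w) = r • FC X F
  | [], r, F => rfl
  | a :: x, r, F => by simp only [FC, FC_smul x, smul_add]

theorem FC_zero : ∀ X : Word gr, FC X (fun _ _ => (0 : W)) = 0
  | [] => rfl
  | a :: x => by simp only [FC, FC_zero x, add_zero]

theorem lc_FC {α : Type*} (N : List (ℝ × α)) : ∀ (X : Word gr) (F : α → Word gr → Word gr → W),
    lc N (fun p => FC X (F p)) = FC X (fun u w => lc N fun p => F p u w)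
  | [], F => rfl
  | a :: x, F => by simp only [FC, lc_add, lc_FC N x]

theorem map_FC {W' : Type*} [AddCommGroup W'] [Module ℝ W'] (φ : W →ₗ[ℝ] W') :
    ∀ (X : Word gr) (F : Word gr → Word gr → W), φ (FC X F) = FC X fun u w => φ (F u w)
  | [], F => rfl
  | a :: x, F => by simp only [FC, map_add, map_FC φ x]

/-- A cut of a shuffle of `X` and `Y` is a shuffle of the left parts tensored with a shuffle of the
right parts. As `F` vanishes on shuffles in its second argument, one of the two right parts must be
empty, which gives the two sums. The cut with both right parts empty occurs in both, harmlessly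
since `F u [] = 0`. -/
theorem FC_shuffle : ∀ (X Y : Word gr) (F : Word gr → Word gr → W),
    (∀ u x y, x ≠ [] → y ≠ [] → SH x y (F u) = 0) → (∀ u, F u [] = 0) →
    SH X Y (fun w => FC w F) =
      FC X (fun x₁ x₂ => sg (lettersDeg x₂ * lettersDeg Y) • SH x₁ Y fun u => F u x₂)
      + FC Y (fun y₁ y₂ => SH X y₁ fun u => F u y₂)
  | [], Y, F, h, h0 => by simp [FC, sg_zero, h0]
  | a :: x, [], F, h, h0 => by
    simp [FC, sg_zero, h0]
  | a :: x, b :: y, F, h, h0 => by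
    have h1 := FC_shuffle x (b :: y) (fun u w => F (a :: u) w) (fun u => h (a :: u))
      (fun u => h0 (a :: u))
    have h2 := FC_shuffle (a :: x) y (fun u w => F (b :: u) w) (fun u => h (b :: u))
      (fun u => h0 (b :: u))
    have h3 := h [] (a :: x) (b :: y) (by simp) (by simp)
    have h4 : FC x (fun u w => sg (lettersDeg w * (letterDeg b + lettersDeg y)) •
          sg (letterDeg b * (letterDeg a + lettersDeg u)) •
            SH (a :: u) y fun v => F (b :: v) w) =
        sg (letterDeg b * (letterDeg a + lettersDeg x)) • FC x (fun u w =>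
          sg (lettersDeg w * lettersDeg y) • SH (a :: u) y fun v => F (b :: v) w) := by
      rw [← FC_smul]
      refine FC_congr fun u w huw => ?_
      rw [← huw, lettersDeg_append]
      simp only [smul_smul, sign_rules]
    simp only [SH_cons, FC, SH_add, SH_nil_left, SH_nil_right, smul_add, FC_add, FC_smul, lettersDeg_cons]
      at h1 h2 h3 h4 ⊢
    rw [h1, h2, h4]
    simp only [smul_add, smul_sub, smul_smul, smul_zero, sign_rules] at h3 ⊢
    linear_combination (norm := module) h3
  termination_by X Y => X.length + Y.length

/-- `FC` includes the cuts with an empty factor and `cuts` does not. The cut after the last letter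
is removed by the hypothesis, and the cut before the first letter is left out by starting the
recursion at `x`. -/
theorem sum_cuts : ∀ (a : Letter gr) (x : Word gr) (h : Word gr → Word gr → W),
    (∀ u, h u [] = 0) →
    ((cuts (a :: x)).map fun t => h t.1 t.2).sum = FC x (fun u w => h (a :: u) w)
  | a, [], h, h0 => by simp [cuts, FC, h0]
  | a, b :: x, h, h0 => by
    rw [FC, ← sum_cuts b x (fun u w => h (a :: u) w) fun u => h0 (a :: u)]
    simp only [cuts, List.length_cons, Nat.add_sub_cancel, List.range_succ_eq_map, List.map_cons,
      List.map_map, List.sum_cons, Function.comp_def]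
    rfl

/-! ### Functions that respect the relations between words -/

/-- The function `g` is linear in every letter and vanishes on shuffles and on the empty word. -/
structure NGood (g : Word gr → W) : Prop where
  llin : LLin g
  shuffle : ∀ x y, x ≠ [] → y ≠ [] → SH x y g = 0
  nil : g [] = 0

theorem NGood.MW (hO : O.Regular) {g : Word O.gr → W} (hg : NGood g) :
    NGood fun X => MW O X g where
  llin u v N hN := LLin.MW_aux hO u v hg.llin N hN
  shuffle x y hx hy := by
    rw [SH_MW hO x y hg.llin, MW_congr hO (g' := fun _ => 0) fun w _ _ hw => hg.shuffle w y hw hy,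
      MW_congr hO (X := y) (g' := fun _ => 0) fun w _ _ hw => hg.shuffle x w hx hw]
    simp [MW_zero]
  nil := rfl

/-- By the derivation rule, the bracket of a shuffle is a sum of shuffles. Both factors of these are
nonempty, because the bracket of two nonempty words has at least one letter. -/
theorem NGood.BR_left (hO : O.Regular) {g : Word O.gr → W} (hg : NGood g) (Y : Word O.gr) :
    NGood fun X => BR O X Y g where
  llin := hg.llin.BR hO Y
  shuffle x y hx hy := by
    rw [BR_shuffle hO]
    rw [BR_congr hO (g' := fun _ => 0), BR_congr hO (X := x) (g' := fun _ => 0)]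
    · simp [BR_zero]
    · intro w _ hl hx' hY
      refine hg.shuffle w y ?_ hy
      rintro rfl
      have := List.length_pos_of_ne_nil hx'
      have := List.length_pos_of_ne_nil hY
      simp at hl; omega
    · intro w _ hl hx' hY
      refine hg.shuffle x w hx ?_
      rintro rfl
      have := List.length_pos_of_ne_nil hx'
      have := List.length_pos_of_ne_nil hY
      simp at hl; omega
  nil := by simp

theorem NGood.smul_sg {g : Word gr → W} (hg : NGood g) (e : ℤ → ℤ) :
    NGood fun X => sg (e (lettersDeg X)) • g X where
  llin u v N hN := by
    have := hN.lc_sg (fun n => e (lettersDeg u + (n + lettersDeg v))) (hg.llin u v N hN)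
    simpa using this
  shuffle x y hx hy := by
    have := hg.shuffle x y hx hy
    rw [SH_congr (g' := fun w => sg (e (lettersDeg x + lettersDeg y)) • g w)
      fun w hw _ => by rw [hw], SH_smul, this, smul_zero]
  nil := by rw [hg.nil, smul_zero]

theorem NGood.BR_right (hO : O.Regular) {g : Word O.gr → W} (hg : NGood g) (X : Word O.gr) :
    NGood fun Y => BR O X Y g := by
  have : (fun Y => BR O X Y g) = fun Y => sg (lettersDeg X * lettersDeg Y + 1) • BR O Y X g := by
    funext Y
    rw [BR_skew hO X Y hg.llin, sg_add, sg_one, mul_neg_one]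
  rw [this]
  exact (hg.BR_left hO X).smul_sg fun n => lettersDeg X * n + 1

end Snoc

/-! ### Goodness under functionals that are linear in a function argument -/

section LC

variable {W W' : Type*} [AddCommGroup W] [Module ℝ W] [AddCommGroup W'] [Module ℝ W']
  {α β γ : Type*}

theorem lc_map_sg (l : List (ℝ × β)) (e : β → ℤ) (h : β → α) (g : α → W) :
    lc (l.map fun t => (sg (e t.2) * t.1, h t.2)) g = lc l fun b => sg (e b) • g (h b) := by
  simp [lc, Function.comp_def, smul_smul, mul_comm]

theorem lc_apply (l : List (ℝ × β)) (F : β → α → W) (a : α) :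
    lc l F a = lc l fun b => F b a := by
  induction l with
  | nil => rfl
  | cons t l ih => simp only [lc_cons, Pi.add_apply, Pi.smul_apply, ih]

theorem IsLinearMap.map_lc {T : W → W'} (hT : IsLinearMap ℝ T) (l : List (ℝ × β)) (F : β → W) :
    T (lc l F) = lc l fun b => T (F b) :=
  ChevalleyHarrison.map_lc hT.mk' l F

theorem IsLinearMap.lc_eq_zero {T : (α → W) → W'} (hT : IsLinearMap ℝ T) (l : List (ℝ × β))
    (F : β → α → W) (h : ∀ a, lc l (fun b => F b a) = 0) : lc l (fun b => T (F b)) = 0 := by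
  rw [← IsLinearMap.map_lc hT, show lc l F = 0 from funext fun a => by rw [lc_apply, h]; rfl,
    hT.map_zero]

theorem IsLinearMap.lc_eq_zero₂ {T : (α → γ → W) → W'} (hT : IsLinearMap ℝ T) (l : List (ℝ × β))
    (F : β → α → γ → W) (h : ∀ a c, lc l (fun b => F b a c) = 0) :
    lc l (fun b => T (F b)) = 0 := by
  rw [← IsLinearMap.map_lc hT, show lc l F = 0 from funext fun a => funext fun c => by
    rw [lc_apply, lc_apply, h]; rfl, hT.map_zero]

end LC

section NGood

variable {V : Type*} [AddCommGroup V] [Module ℝ V] {gr : ℤ → Submodule ℝ V}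
  {W W' : Type*} [AddCommGroup W] [Module ℝ W] [AddCommGroup W'] [Module ℝ W'] {α γ : Type*}

theorem NGood.add {g g' : Word gr → W} (hg : NGood g) (hg' : NGood g') :
    NGood fun X => g X + g' X where
  llin u v N hN := by rw [lc_add, hg.llin u v N hN, hg'.llin u v N hN, add_zero]
  shuffle x y hx hy := by rw [SH_add, hg.shuffle x y hx hy, hg'.shuffle x y hx hy, add_zero]
  nil := by rw [hg.nil, hg'.nil, add_zero]

theorem NGood.smul {g : Word gr → W} (hg : NGood g) (r : ℝ) : NGood fun X => r • g X where
  llin u v N hN := by rw [lc_smul, hg.llin u v N hN, smul_zero]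
  shuffle x y hx hy := by rw [SH_smul, hg.shuffle x y hx hy, smul_zero]
  nil := by rw [hg.nil, smul_zero]

theorem NGood.zero : NGood fun _ : Word gr => (0 : W) where
  llin u v N hN := lc_zero _
  shuffle x y hx hy := lc_zero _
  nil := rfl

/-- This covers the terms of an operator in which the variable word is carried along unchanged while
the operator `T` acts on the other words. -/
theorem NGood.comp_linear {T : (α → W) → W'} (hT : IsLinearMap ℝ T) {F : Word gr → α → W}
    (hF : ∀ a, NGood fun X => F X a) : NGood fun X => T (F X) where
  llin u v N hN := IsLinearMap.lc_eq_zero hT N _ fun a => (hF a).llin u v N hN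
  shuffle x y hx hy := IsLinearMap.lc_eq_zero hT _ _ fun a => (hF a).shuffle x y hx hy
  nil := by rw [show F [] = 0 from funext fun a => (hF a).nil, hT.map_zero]

theorem NGood.comp_linear₂ {T : (α → γ → W) → W'} (hT : IsLinearMap ℝ T) {F : Word gr → α → γ → W}
    (hF : ∀ a c, NGood fun X => F X a c) : NGood fun X => T (F X) where
  llin u v N hN := IsLinearMap.lc_eq_zero₂ hT N _ fun a c => (hF a c).llin u v N hN
  shuffle x y hx hy := IsLinearMap.lc_eq_zero₂ hT _ _ fun a c => (hF a c).shuffle x y hx hy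
  nil := by rw [show F [] = 0 from funext fun a => funext fun c => (hF a c).nil, hT.map_zero]

theorem NGood.smul_sg_wordDeg {g : Word gr → W} (hg : NGood g) (e : ℤ → ℤ) :
    NGood fun X => sg (e (wordDeg X)) • g X :=
  hg.smul_sg fun n => e (n - 1)

end NGood

/-! ### Functions on sentences that respect the relations -/

section Good

variable {V : Type*} [AddCommGroup V] [Module ℝ V] {gr : ℤ → Submodule ℝ V}
  {W W' : Type*} [AddCommGroup W] [Module ℝ W] [AddCommGroup W'] [Module ℝ W']

@[simp] theorem sentenceDeg_nil : sentenceDeg ([] : Sentence gr) = 0 := rfl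

@[simp] theorem sentenceDeg_cons (X : Word gr) (L : Sentence gr) :
    sentenceDeg (X :: L) = wordDeg X + sentenceDeg L := by simp [sentenceDeg]

@[simp] theorem sentenceDeg_append (L L' : Sentence gr) :
    sentenceDeg (L ++ L') = sentenceDeg L + sentenceDeg L' := by simp [sentenceDeg]

/-- Exchanging two neighbouring words produces the Koszul sign. -/
def SwapGood (f : Sentence gr → W) : Prop :=
  ∀ A B X Y, f (A ++ X :: Y :: B) = sg (wordDeg X * wordDeg Y) • f (A ++ Y :: X :: B)

/-- The function `f` respects the relations between sentences, with the exception of the vanishing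
of the empty sentence. -/
structure Good (f : Sentence gr → W) : Prop where
  swap : SwapGood f
  word : ∀ A B, NGood fun X => f (A ++ X :: B)

theorem SwapGood.ins {f : Sentence gr → W} (hf : SwapGood f) (X : Word gr) :
    SwapGood fun L => f (X :: L) := fun A B Y Z => hf (X :: A) B Y Z

theorem SwapGood.head {f : Sentence gr → W} (hf : SwapGood f) (X Y : Word gr) (L : Sentence gr) :
    f (X :: Y :: L) = sg (wordDeg X * wordDeg Y) • f (Y :: X :: L) := hf [] L X Y

theorem Good.ins {f : Sentence gr → W} (hf : Good f) (X : Word gr) : Good fun L => f (X :: L) :=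
  ⟨hf.swap.ins X, fun A B => hf.word (X :: A) B⟩

theorem Good.head {f : Sentence gr → W} (hf : Good f) (L : Sentence gr) :
    NGood fun X => f (X :: L) := hf.word [] L

theorem Good.add {f f' : Sentence gr → W} (hf : Good f) (hf' : Good f') :
    Good fun L => f L + f' L :=
  ⟨fun A B X Y => by rw [hf.swap, hf'.swap, smul_add], fun A B => (hf.word A B).add (hf'.word A B)⟩

theorem Good.smul {f : Sentence gr → W} (hf : Good f) (r : ℝ) : Good fun L => r • f L :=
  ⟨fun A B X Y => by rw [hf.swap, smul_comm], fun A B => (hf.word A B).smul r⟩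

theorem Good.comp {f : Sentence gr → W} (hf : Good f) (φ : W →ₗ[ℝ] W') : Good fun L => φ (f L) where
  swap A B X Y := by
    dsimp only
    rw [hf.swap, map_smul]
  word A B :=
    { llin := fun u v N hN => by rw [← map_lc, (hf.word A B).llin u v N hN, map_zero]
      shuffle := fun x y hx hy => by
        have := (hf.word A B).shuffle x y hx hy
        unfold SH at this ⊢
        rw [← map_lc, this, map_zero]
      nil := by rw [(hf.word A B).nil, map_zero] }

theorem Good.smul_sg {f : Sentence gr → W} (hf : Good f) (n : ℤ) :
    Good fun L => sg (n * sentenceDeg L) • f L where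
  swap A B X Y := by
    dsimp only
    rw [hf.swap, smul_comm]
    simp only [sentenceDeg_append, sentenceDeg_cons, add_left_comm]
  word A B := by
    simpa using (hf.word A B).smul_sg_wordDeg fun x => n * (sentenceDeg A + (x + sentenceDeg B))

theorem NGood.relation_add {g : Word gr → W} (hg : NGood g) (u v : Word gr) (i : ℤ) (a b : V)
    (ha : a ∈ gr i) (hb : b ∈ gr i) :
    g (u ++ ⟨(i, a + b), add_mem ha hb⟩ :: v) =
      g (u ++ ⟨(i, a), ha⟩ :: v) + g (u ++ ⟨(i, b), hb⟩ :: v) := by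
  have := hg.llin u v [(1, ⟨(i, a + b), add_mem ha hb⟩), (-1, ⟨(i, a), ha⟩), (-1, ⟨(i, b), hb⟩)]
    ⟨i, by simp, by simp; abel⟩
  simp only [lc_cons, lc_nil] at this
  linear_combination (norm := module) this

theorem NGood.relation_smul {g : Word gr → W} (hg : NGood g) (u v : Word gr) (i : ℤ) (r : ℝ) (a : V)
    (ha : a ∈ gr i) :
    g (u ++ ⟨(i, r • a), (gr i).smul_mem r ha⟩ :: v) = r • g (u ++ ⟨(i, a), ha⟩ :: v) := by
  have := hg.llin u v [(1, ⟨(i, r • a), (gr i).smul_mem r ha⟩), (-r, ⟨(i, a), ha⟩)]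
    ⟨i, by simp, by simp⟩
  simp only [lc_cons, lc_nil] at this
  linear_combination (norm := module) this

theorem linearCombination_lc {α : Type*} (f : Sentence gr → W) (l : List (ℝ × α))
    (h : α → Sentence gr) :
    Finsupp.linearCombination ℝ f (lc l fun w => Finsupp.single (h w) (1 : ℝ)) =
      lc l fun w => f (h w) := by
  rw [map_lc]
  simp

/-- The clauses of `Good`, together with `h0`, correspond one by one to the generators of
`relations`. The combination thus kills all relations, and `descend` takes its first branch and not
the default zero. -/
theorem Good.descends {f : Sentence gr → W} (hf : Good f) (h0 : f [] = 0) : Descends f := by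
  have h : relations gr ≤ LinearMap.ker (Finsupp.linearCombination ℝ f) := by
    refine Submodule.span_le.2 ?_
    rintro x hx
    rw [SetLike.mem_coe, LinearMap.mem_ker]
    cases hx with
    | add A B u v i a b ha hb =>
      have := (hf.word A B).relation_add u v i a b ha hb
      simp [this]
    | smul A B u v i r a ha =>
      have := (hf.word A B).relation_smul u v i r a ha
      simp [this]
    | shuffle A B x y hx hy =>
      exact (linearCombination_lc f _ fun w => A ++ w :: B).trans ((hf.word A B).shuffle x y hx hy)
    | swap A B X Y =>
      have := hf.swap A B X Y
      rw [map_sub, map_smul, Finsupp.linearCombination_single, Finsupp.linearCombination_single,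
        one_smul, one_smul, this, neg_one_zpow_eq_sg, sub_self]
    | emptyWord A B =>
      have := (hf.word A B).nil
      simp [this]
    | emptySentence => simp [h0]
  intro L
  rw [descend, dif_pos h, ChevalleyHarrison.mk, Submodule.liftQ_apply]
  simp

theorem mk_eq_zero_of_isRelation {x : Sentence gr →₀ ℝ} (h : IsRelation gr x) :
    (Submodule.Quotient.mk x : Space gr) = 0 :=
  (Submodule.Quotient.mk_eq_zero _).2 (Submodule.subset_span h)

theorem mk_nil : mk ([] : Sentence gr) = 0 := mk_eq_zero_of_isRelation .emptySentence

theorem quotient_mk_single (L : Sentence gr) :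
    (Submodule.Quotient.mk (Finsupp.single L 1) : Space gr) = mk L := rfl

/-- The class of a sentence as a linear function of a letter of degree `i`. -/
def mkLetter (A B : Sentence gr) (u v : Word gr) (i : ℤ) : gr i →ₗ[ℝ] Space gr where
  toFun a := mk (A ++ (u ++ ⟨(i, a.1), a.2⟩ :: v) :: B)
  map_add' a b := by
    have := mk_eq_zero_of_isRelation (.add A B u v i a.1 b.1 a.2 b.2)
    simp only [Submodule.Quotient.mk_sub, quotient_mk_single] at this
    rw [sub_sub, sub_eq_zero] at this
    exact this
  map_smul' r a := by
    have := mk_eq_zero_of_isRelation (.smul A B u v i r a.1 a.2)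
    simp only [Submodule.Quotient.mk_sub, Submodule.Quotient.mk_smul, quotient_mk_single] at this
    rw [sub_eq_zero] at this
    exact this

/-- By the two linearity relations a combination of letters of one degree collapses to a single
letter, whose value is the combined vector. For a null combination this letter has value zero. -/
theorem lc_mk_letter (A B : Sentence gr) (u v : Word gr) (i : ℤ) (N : List (ℝ × Letter gr))
    (hN : ∀ t ∈ N, t.2.1.1 = i) : ∃ h : lc N (fun p => p.1.2) ∈ gr i,
      lc N (fun p => mk (A ++ (u ++ p :: v) :: B)) = mkLetter A B u v i ⟨_, h⟩ := by
  induction N with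
  | nil => exact ⟨zero_mem _, (map_zero _).symm⟩
  | cons t N ih =>
    obtain ⟨h, e⟩ := ih fun s hs => hN s (List.mem_cons_of_mem _ hs)
    obtain ⟨r, ⟨⟨j, a⟩, ha⟩⟩ := t
    obtain rfl : j = i := hN _ List.mem_cons_self
    refine ⟨?_, ?_⟩
    · rw [lc_cons]
      exact add_mem (Submodule.smul_mem _ _ ha) h
    · rw [lc_cons, e]
      exact ((mkLetter A B u v j).map_add (r • ⟨a, ha⟩) ⟨_, h⟩ ▸ by rw [map_smul]; rfl)

/-- The class map is the universal instance: every operator on the quotient arises by applying a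
goodness-preserving construction to it. -/
theorem mk_good : Good (mk : Sentence gr → Space gr) where
  swap A B X Y := by
    have := mk_eq_zero_of_isRelation (.swap A B X Y)
    simp only [Submodule.Quotient.mk_sub, Submodule.Quotient.mk_smul, quotient_mk_single] at this
    rwa [sub_eq_zero] at this
  word A B :=
    { llin := fun u v N hN => by
        obtain ⟨i, hi, h0⟩ := hN
        obtain ⟨h, e⟩ := lc_mk_letter A B u v i N hi
        rw [e]
        simp only [h0]
        exact map_zero _
      shuffle := fun x y hx hy => by
        have := mk_eq_zero_of_isRelation (.shuffle A B x y hx hy)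
        rw [← Submodule.mkQ_apply] at this
        have h2 := map_lc (relations gr).mkQ (shuffles letterDeg x y)
          (fun w => Finsupp.single (A ++ w :: B) (1 : ℝ))
        rw [lc, this] at h2
        exact h2.symm
      nil := mk_eq_zero_of_isRelation (.emptyWord A B) }

theorem mk_induction (φ ψ : Space gr →ₗ[ℝ] W) (h : ∀ L, φ (mk L) = ψ (mk L)) : φ = ψ := by
  refine Submodule.linearMap_qext _ (Finsupp.lhom_ext' fun L => LinearMap.ext_ring ?_)
  exact h L

end Good

section Derivations

variable {V : Type*} [AddCommGroup V] [Module ℝ V] {gr : ℤ → Submodule ℝ V} {O : Ops V}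
  {W W' : Type*} [AddCommGroup W] [Module ℝ W] [AddCommGroup W'] [Module ℝ W']

theorem isLinearMap_lc {α β : Type*} (l : List (ℝ × β)) (h : β → α) :
    IsLinearMap ℝ fun f : α → W => lc l fun b => f (h b) where
  map_add f g := lc_add _ _ _
  map_smul r f := lc_smul _ _ _

/-! ### Derivations of the algebra of sentences -/

/-- The value of `f` on `δ(X₁ ⋯ X_n)`, for the derivation `δ` of degree `n` given on words
by `φ`. -/
def der (n : ℤ) (φ : Word gr → List (ℝ × Word gr)) : Sentence gr → (Sentence gr → W) → W
  | [], _ => 0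
  | X :: L, f => lc (φ X) (fun w => f (w :: L)) +
      sg (n * wordDeg X) • der n φ L (fun K => f (X :: K))

theorem der_linear (n : ℤ) (φ : Word gr → List (ℝ × Word gr)) :
    ∀ L : Sentence gr, IsLinearMap ℝ (der (W := W) n φ L)
  | [] => ⟨fun _ _ => (add_zero _).symm, fun _ _ => (smul_zero _).symm⟩
  | X :: L => by
    have h := der_linear n φ L
    refine ⟨fun f g => ?_, fun r f => ?_⟩
    · have := h.map_add (fun K => f (X :: K)) (fun K => g (X :: K))
      simp only [der, Pi.add_apply, lc_add]
      erw [this]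
      module
    · have := h.map_smul r (fun K => f (X :: K))
      simp only [der, Pi.smul_apply, lc_smul]
      erw [this]
      module

theorem lc_swap {f : Sentence gr → W} (hf : SwapGood f) (l : List (ℝ × Word gr)) {d : ℤ}
    (hl : ∀ t ∈ l, wordDeg t.2 = d) (A B : Sentence gr) (Y : Word gr) :
    lc l (fun w => f (A ++ w :: Y :: B)) = sg (d * wordDeg Y) • lc l fun w => f (A ++ Y :: w :: B) := by
  rw [← lc_smul]
  exact lc_congr fun t ht => by rw [hf, hl t ht]

theorem lc_swap_head {f : Sentence gr → W} (hf : SwapGood f) (l : List (ℝ × Word gr)) {d : ℤ}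
    (hl : ∀ t ∈ l, wordDeg t.2 = d) (B : Sentence gr) (Y : Word gr) :
    lc l (fun w => f (w :: Y :: B)) = sg (d * wordDeg Y) • lc l fun w => f (Y :: w :: B) :=
  lc_swap hf l hl [] B Y

theorem SwapGood.eq_ins {f : Sentence gr → W} (hf : SwapGood f) (X Y : Word gr) :
    (fun L => f (X :: Y :: L)) = sg (wordDeg X * wordDeg Y) • fun L => f (Y :: X :: L) :=
  funext fun L => hf.head X Y L

theorem SwapGood.der {n : ℤ} {φ : Word gr → List (ℝ × Word gr)}
    (hφ : ∀ X, ∀ t ∈ φ X, wordDeg t.2 = wordDeg X + n) :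
    ∀ (A : Sentence gr) {f : Sentence gr → W}, SwapGood f → ∀ B X Y,
    der n φ (A ++ X :: Y :: B) f =
      sg (wordDeg X * wordDeg Y) • ChevalleyHarrison.der n φ (A ++ Y :: X :: B) f
  | [], f, hf, B, X, Y => by
    simp only [List.nil_append, ChevalleyHarrison.der]
    rw [lc_swap_head hf _ (hφ X), lc_swap_head hf _ (hφ Y), hf.eq_ins X Y,
      (der_linear n φ B).map_smul]
    simp only [smul_add, smul_smul, sign_rules]
    module
  | Z :: A, f, hf, B, X, Y => by
    have h := SwapGood.der hφ A (hf.ins Z) B X Y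
    have h2 : lc (φ Z) (fun w => f (w :: (A ++ X :: Y :: B))) =
        sg (wordDeg X * wordDeg Y) • lc (φ Z) (fun w => f (w :: (A ++ Y :: X :: B))) := by
      rw [← lc_smul]
      exact lc_congr fun t _ => hf (t.2 :: A) B X Y
    simp only [List.cons_append, ChevalleyHarrison.der]
    rw [h, h2]
    module

theorem NGood.der_word {n : ℤ} {φ : Word gr → List (ℝ × Word gr)}
    (hφ : ∀ {g : Word gr → W}, NGood g → NGood fun X => lc (φ X) g) :
    ∀ (A : Sentence gr) {f : Sentence gr → W}, Good f → ∀ B,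
    NGood fun X => der n φ (A ++ X :: B) f
  | [], f, hf, B => by
    simp only [List.nil_append, der]
    exact (hφ (hf.head B)).add ((NGood.comp_linear (der_linear n φ B) fun K =>
      hf.head K).smul_sg_wordDeg fun x => n * x)
  | Z :: A, f, hf, B => by
    simp only [List.cons_append, der]
    exact (NGood.comp_linear (isLinearMap_lc (φ Z) id) fun w => hf.word (w :: A) B).add
      ((NGood.der_word hφ A (hf.ins Z) B).smul _)

theorem Good.der {n : ℤ} {φ : Word gr → List (ℝ × Word gr)}
    (hd : ∀ X, ∀ t ∈ φ X, wordDeg t.2 = wordDeg X + n)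
    (hφ : ∀ {g : Word gr → W}, NGood g → NGood fun X => lc (φ X) g)
    {f : Sentence gr → W} (hf : Good f) : Good fun L => der n φ L f :=
  ⟨fun A B X Y => SwapGood.der hd A hf.swap B X Y, fun A B => NGood.der_word hφ A hf B⟩

theorem der_eq_sum (n : ℤ) (φ : Word gr → List (ℝ × Word gr)) :
    ∀ (L : Sentence gr) (f : Sentence gr → W),
    der n φ L f = ∑ k : Fin L.length, sg (n * sentenceDeg (L.take k)) •
      lc (φ (L.get k)) fun w => f (L.take k ++ w :: L.drop (k + 1))
  | [], f => by simp [der]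
  | X :: L, f => by
    rw [der, der_eq_sum n φ L]
    simp only [List.length_cons, Fin.sum_univ_succ, Finset.smul_sum]
    simp [sg_zero, mul_add, sg_add, smul_smul]

/-! ### The operator `m` -/

theorem mWord_deg (hO : O.Regular) (X : Word O.gr) : ∀ t ∈ mWord O X, wordDeg t.2 = wordDeg X + 1 :=
  fun t ht => by rw [wordDeg_eq, wordDeg_eq, (mWord_spec hO X t ht).1]; ring

theorem Good.m (hO : O.Regular) {f : Sentence O.gr → W} (hf : Good f) :
    Good fun L => ChevalleyHarrison.der 1 (mWord O) L f :=
  hf.der (mWord_deg hO) fun hg => hg.MW hO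

theorem mVal_eq (L : Sentence O.gr) : mVal O L = der 1 (mWord O) L ChevalleyHarrison.mk := by
  rw [der_eq_sum, mVal]
  refine Finset.sum_congr rfl fun k _ => ?_
  rw [lc, List.smul_sum, List.map_map]
  simp only [Function.comp_def, smul_smul, one_mul, neg_one_zpow_eq_sg]

/-! ### The operator `ℓ` -/

theorem lc_ellWord (X Y : Word O.gr) (g : Word O.gr → W) :
    lc (ellWord O X Y) g = sg (wordDeg X) • BR O X Y g := by
  rw [ellWord, neg_one_zpow_eq_sg, BR]
  exact lc_map_mul _ _ (fun t => t) g

theorem ellWord_deg (hO : O.Regular) (X Y : Word O.gr) :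
    ∀ t ∈ ellWord O X Y, wordDeg t.2 = wordDeg Y + (wordDeg X + 1) := by
  intro t ht
  rw [ellWord, List.mem_map] at ht
  obtain ⟨s, hs, rfl⟩ := ht
  rw [wordDeg_eq, wordDeg_eq, wordDeg_eq, (bracketWord_spec hO X Y s hs).1]
  ring

/-- The bracket is skew for the sums of the letter degrees. The factor `(-1)^(deg X)` and the shift
of the word degree by one turn this into graded symmetry, as the commutative product of words
requires. -/
theorem lc_ellWord_comm (hO : O.Regular) (X Y : Word O.gr) {g : Word O.gr → W} (hg : LLin g) :
    lc (ellWord O Y X) g = sg (wordDeg X * wordDeg Y) • lc (ellWord O X Y) g := by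
  rw [lc_ellWord, lc_ellWord, BR_skew hO Y X hg, wordDeg_eq, wordDeg_eq]
  simp only [smul_smul, sign_rules]

theorem NGood.ell_right (hO : O.Regular) (X : Word O.gr) {g : Word O.gr → W} (hg : NGood g) :
    NGood fun Y => lc (ellWord O X Y) g := by
  simp only [lc_ellWord]
  exact (hg.BR_right hO X).smul _

theorem NGood.ell_left (hO : O.Regular) (Y : Word O.gr) {g : Word O.gr → W} (hg : NGood g) :
    NGood fun X => lc (ellWord O X Y) g := by
  simp only [lc_ellWord]
  exact (hg.BR_left hO Y).smul_sg_wordDeg fun x => x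

/-- The value of `f` on `∑ ± X₁ ⋯ ℓ(X, X_i) ⋯ X_n`. -/
def ad (O : Ops V) (X : Word O.gr) (L : Sentence O.gr) (f : Sentence O.gr → W) : W :=
  der (wordDeg X + 1) (ellWord O X) L f

theorem ad_nil (X : Word O.gr) (f : Sentence O.gr → W) : ad O X [] f = 0 := rfl

theorem ad_cons (X Y : Word O.gr) (L : Sentence O.gr) (f : Sentence O.gr → W) :
    ad O X (Y :: L) f = lc (ellWord O X Y) (fun w => f (w :: L)) +
      sg ((wordDeg X + 1) * wordDeg Y) • ad O X L (fun K => f (Y :: K)) := rfl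

theorem ad_linear (X : Word O.gr) (L : Sentence O.gr) : IsLinearMap ℝ (ad (W := W) O X L) :=
  der_linear _ _ L

theorem Good.ad (hO : O.Regular) (X : Word O.gr) {f : Sentence O.gr → W} (hf : Good f) :
    Good fun L => ChevalleyHarrison.ad O X L f :=
  hf.der (ellWord_deg hO X) fun hg => hg.ell_right hO X

theorem NGood.ad (hO : O.Regular) : ∀ (B : Sentence O.gr) {f : Sentence O.gr → W}, Good f →
    NGood fun X => ChevalleyHarrison.ad O X B f
  | [], f, hf => NGood.zero
  | Z :: B, f, hf => by
    simp only [ad_cons]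
    exact ((hf.head B).ell_left hO Z).add ((NGood.ad hO B (hf.ins Z)).smul_sg_wordDeg
      fun x => (x + 1) * wordDeg Z)

/-- The value of `f` on `ℓ(X₁ ⋯ X_n)`. -/
def ells (O : Ops V) : Sentence O.gr → (Sentence O.gr → W) → W
  | [], _ => 0
  | X :: L, f => ad O X L f + sg (wordDeg X) • ells O L (fun K => f (X :: K))

theorem ells_linear : ∀ L : Sentence O.gr, IsLinearMap ℝ (ells (W := W) O L)
  | [] => ⟨fun _ _ => (add_zero _).symm, fun _ _ => (smul_zero _).symm⟩
  | X :: L => by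
    have h := ells_linear L
    refine ⟨fun f g => ?_, fun r f => ?_⟩
    · have := h.map_add (fun K => f (X :: K)) (fun K => g (X :: K))
      simp only [ells, Pi.add_apply, (ad_linear X L).map_add]
      erw [this]
      module
    · have := h.map_smul r (fun K => f (X :: K))
      simp only [ells, Pi.smul_apply, (ad_linear X L).map_smul]
      erw [this]
      module

theorem SwapGood.ells (hO : O.Regular) :
    ∀ (A : Sentence O.gr) {f : Sentence O.gr → W}, Good f → ∀ B X Y,
    ells O (A ++ X :: Y :: B) f =
      sg (wordDeg X * wordDeg Y) • ChevalleyHarrison.ells O (A ++ Y :: X :: B) f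
  | [], f, hf, B, X, Y => by
    simp only [List.nil_append, ChevalleyHarrison.ells, ad_cons]
    rw [hf.swap.eq_ins X Y, (ells_linear B).map_smul, lc_ellWord_comm hO X Y (hf.head B).llin]
    simp only [smul_add, smul_smul, sign_rules]
    module
  | Z :: A, f, hf, B, X, Y => by
    have h := SwapGood.ells hO A (hf.ins Z) B X Y
    have h2 := (hf.ad hO Z).swap A B X Y
    simp only [List.cons_append, ChevalleyHarrison.ells]
    rw [h, h2]
    module

theorem NGood.ells (hO : O.Regular) :
    ∀ (A : Sentence O.gr) {f : Sentence O.gr → W}, Good f → ∀ B,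
    NGood fun X => ells O (A ++ X :: B) f
  | [], f, hf, B => by
    simp only [List.nil_append, ChevalleyHarrison.ells]
    exact (NGood.ad hO B hf).add ((NGood.comp_linear (ells_linear B) fun K =>
      hf.head K).smul_sg_wordDeg fun x => x)
  | Z :: A, f, hf, B => by
    simp only [List.cons_append, ChevalleyHarrison.ells]
    exact ((hf.ad hO Z).word A B).add ((NGood.ells hO A (hf.ins Z) B).smul _)

theorem Good.ells (hO : O.Regular) {f : Sentence O.gr → W} (hf : Good f) :
    Good fun L => ells O L f :=
  ⟨fun A B X Y => SwapGood.ells hO A hf B X Y, fun A B => NGood.ells hO A hf B⟩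

theorem lc_picks_cons {α : Type*} (deg : α → ℤ) (x : α) (l : List α) (g : α × List α → W) :
    lc (picks deg (x :: l)) g = g (x, l) +
      lc (picks deg l) fun t => sg (deg t.1 * deg x) • g (t.1, x :: t.2) := by
  rw [picks, lc_cons, one_smul]
  congr 1
  exact lc_map_sg _ (fun t : α × List α => deg t.1 * deg x) (fun t => (t.1, x :: t.2)) g

theorem lc_pickPairs_cons {α : Type*} (deg : α → ℤ) (x : α) (l : List α)
    (g : α × α × List α → W) :
    lc (pickPairs deg (x :: l)) g = lc (picks deg l) (fun t => g (x, t.1, t.2)) +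
      lc (pickPairs deg l) fun t => sg ((deg t.1 + deg t.2.1) * deg x) •
        g (t.1, t.2.1, x :: t.2.2) := by
  rw [pickPairs, lc_append]
  congr 1
  · exact lc_map _ (fun t : α × List α => (x, t.1, t.2)) g
  · exact lc_map_sg _ (fun t : α × α × List α => (deg t.1 + deg t.2.1) * deg x)
      (fun t => (t.1, t.2.1, x :: t.2.2)) g

/-- The explicit formula puts the bracket in front of the sentence, whereas `ad` leaves it in the
place of the second word. The two differ by the Koszul sign of moving a word of degree `deg X + deg
Y + 1`. -/
theorem lc_picks_ad (hO : O.Regular) (X : Word O.gr) : ∀ (L : Sentence O.gr)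
    {f : Sentence O.gr → W}, SwapGood f →
    lc (picks wordDeg L) (fun t => lc (ellWord O X t.1) fun w => f (w :: t.2)) = ad O X L f
  | [], f, _ => rfl
  | Y :: L, f, hf => by
    rw [lc_picks_cons, ad_cons, ← lc_picks_ad hO X L (hf.ins Y), ← lc_smul]
    congr 1
    refine lc_congr fun t _ => ?_
    rw [lc_swap_head hf _ (ellWord_deg hO X t.2.1)]
    simp only [smul_smul, sign_rules]

theorem lc_pickPairs_ells (hO : O.Regular) : ∀ (L : Sentence O.gr)
    {f : Sentence O.gr → W}, SwapGood f →
    lc (pickPairs wordDeg L) (fun t => lc (ellWord O t.1 t.2.1) fun w => f (w :: t.2.2)) =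
      ells O L f
  | [], f, _ => rfl
  | X :: L, f, hf => by
    rw [lc_pickPairs_cons, ells, ← lc_pickPairs_ells hO L (hf.ins X), ← lc_smul,
      ← lc_picks_ad hO X L hf]
    congr 1
    refine lc_congr fun t _ => ?_
    rw [lc_swap_head hf _ (ellWord_deg hO t.2.1 t.2.2.1)]
    simp only [smul_smul, sign_rules]

theorem ellVal_eq (hO : O.Regular) (L : Sentence O.gr) :
    ellVal O L = ells O L ChevalleyHarrison.mk := by
  rw [← lc_pickPairs_ells hO L mk_good.swap, ellVal, lc]
  congr 1
  refine List.map_congr_left fun t _ => ?_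
  rw [lc, List.smul_sum, List.map_map]
  simp only [Function.comp_def, smul_smul]

theorem mVal_descends (hO : O.Regular) : Descends (mVal O) := by
  rw [show mVal O = _ from funext mVal_eq]
  exact (mk_good.m hO).descends rfl

theorem ellVal_descends (hO : O.Regular) : Descends (ellVal O) := by
  rw [show ellVal O = _ from funext (ellVal_eq hO)]
  exact (mk_good.ells hO).descends rfl

end Derivations

section Coproducts

variable {V : Type*} [AddCommGroup V] [Module ℝ V] {gr : ℤ → Submodule ℝ V}
  {W W' : Type*} [AddCommGroup W] [Module ℝ W] [AddCommGroup W'] [Module ℝ W']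

/-- The word `X` is put in front of the first argument. -/
def insL (X : Word gr) (F : Sentence gr → Sentence gr → W) : Sentence gr → Sentence gr → W :=
  fun I J => F (X :: I) J

/-- The word `X` is put in front of the second argument, with the Koszul sign. -/
def insR (X : Word gr) (F : Sentence gr → Sentence gr → W) : Sentence gr → Sentence gr → W :=
  fun I J => sg (wordDeg X * sentenceDeg I) • F I (X :: J)

theorem insL_linear (X : Word gr) : IsLinearMap ℝ (insL (W := W) X) :=
  ⟨fun _ _ => rfl, fun _ _ => rfl⟩

theorem insR_linear (X : Word gr) : IsLinearMap ℝ (insR (W := W) X) :=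
  ⟨fun _ _ => funext₂ fun _ _ => smul_add _ _ _, fun _ _ => funext₂ fun _ _ => smul_comm _ _ _⟩

/-- The function `F` respects the relations in both arguments. -/
structure BiGood (F : Sentence gr → Sentence gr → W) : Prop where
  left : ∀ J, Good fun I => F I J
  right : ∀ I, Good (F I)

theorem BiGood.insL {F : Sentence gr → Sentence gr → W} (hF : BiGood F) (X : Word gr) :
    BiGood (insL X F) :=
  ⟨fun J => (hF.left J).ins X, fun I => hF.right (X :: I)⟩

theorem BiGood.insR {F : Sentence gr → Sentence gr → W} (hF : BiGood F) (X : Word gr) :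
    BiGood (insR X F) :=
  ⟨fun J => (hF.left (X :: J)).smul_sg (wordDeg X), fun I => ((hF.right I).ins X).smul _⟩

/-- The value of `F` on the full coproduct of a sentence. -/
def cop : Sentence gr → (Sentence gr → Sentence gr → W) → W
  | [], F => F [] []
  | X :: L, F => cop L (insL X F) + cop L (insR X F)

theorem cop_linear : ∀ L : Sentence gr, IsLinearMap ℝ (cop (W := W) L)
  | [] => ⟨fun _ _ => rfl, fun _ _ => rfl⟩
  | X :: L => by
    have h := cop_linear L
    refine ⟨fun f g => ?_, fun r f => ?_⟩
    · simp only [cop, (insL_linear X).map_add, (insR_linear X).map_add, h.map_add]; abel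
    · simp only [cop, (insL_linear X).map_smul, (insR_linear X).map_smul, h.map_smul, smul_add]

theorem map_cop (φ : W →ₗ[ℝ] W') : ∀ (L : Sentence gr) (F : Sentence gr → Sentence gr → W),
    φ (cop L F) = cop L fun I J => φ (F I J)
  | [], F => rfl
  | X :: L, F => by
    rw [cop, cop, map_add, map_cop φ L, map_cop φ L]
    congr 1
    simp only [insR, map_smul]
    rfl

theorem cop_eq_lc : ∀ (L : Sentence gr) (F : Sentence gr → Sentence gr → W),
    lc (splits wordDeg L) (fun t => F t.1 t.2) = cop L F
  | [], F => by simp [splits, cop]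
  | X :: L, F => by
    rw [splits, lc_append, cop, ← cop_eq_lc L, ← cop_eq_lc L]
    congr 1
    · exact lc_map _ (fun t : Sentence gr × Sentence gr => (X :: t.1, t.2)) fun t => F t.1 t.2
    · exact lc_map_sg _ (fun t : Sentence gr × Sentence gr => wordDeg X * sentenceDeg t.1)
        (fun t => (t.1, X :: t.2)) fun t => F t.1 t.2

theorem SwapGood.insL_insL {F : Sentence gr → Sentence gr → W} (hF : BiGood F) (X Y : Word gr) :
    insL Y (insL X F) = sg (wordDeg X * wordDeg Y) • insL X (insL Y F) :=
  funext₂ fun I J => (hF.left J).swap.head X Y I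

theorem SwapGood.insR_insR {F : Sentence gr → Sentence gr → W} (hF : BiGood F) (X Y : Word gr) :
    insR Y (insR X F) = sg (wordDeg X * wordDeg Y) • insR X (insR Y F) := by
  funext I J
  simp only [insR, Pi.smul_apply, (hF.right I).swap.head X Y J, smul_smul]
  simp only [sign_rules]

theorem insR_insL (F : Sentence gr → Sentence gr → W) (X Y : Word gr) :
    insR Y (insL X F) = sg (wordDeg X * wordDeg Y) • insL X (insR Y F) := by
  funext I J
  simp only [insR, insL, Pi.smul_apply, smul_smul, sentenceDeg_cons, sign_rules]

theorem BiGood.cop_swap {F : Sentence gr → Sentence gr → W} (hF : BiGood F) (L : Sentence gr)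
    (X Y : Word gr) : cop (X :: Y :: L) F = sg (wordDeg X * wordDeg Y) • cop (Y :: X :: L) F := by
  simp only [cop]
  rw [SwapGood.insL_insL hF X Y, SwapGood.insR_insR hF X Y, insR_insL F X Y, insR_insL F Y X]
  simp only [(cop_linear L).map_smul, smul_add, smul_smul, sign_rules]
  module

theorem BiGood.cop_swap' : ∀ (A : Sentence gr) {F : Sentence gr → Sentence gr → W}, BiGood F →
    ∀ (B : Sentence gr) (X Y : Word gr),
    cop (A ++ X :: Y :: B) F = sg (wordDeg X * wordDeg Y) • cop (A ++ Y :: X :: B) F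
  | [], F, hF, B, X, Y => hF.cop_swap B X Y
  | Z :: A, F, hF, B, X, Y => by
    simp only [List.cons_append, cop]
    rw [BiGood.cop_swap' A (hF.insL Z), BiGood.cop_swap' A (hF.insR Z), smul_add]

theorem BiGood.cop_word : ∀ (A : Sentence gr) {F : Sentence gr → Sentence gr → W}, BiGood F →
    ∀ B : Sentence gr, NGood fun X => cop (A ++ X :: B) F
  | [], F, hF, B => by
    simp only [List.nil_append, cop]
    exact (NGood.comp_linear₂ (cop_linear B) fun I J => (hF.left J).head I).add
      (NGood.comp_linear₂ (cop_linear B) fun I J => ((hF.right I).head J).smul_sg_wordDeg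
        fun x => x * sentenceDeg I)
  | Z :: A, F, hF, B => by
    simp only [List.cons_append, cop]
    exact (BiGood.cop_word A (hF.insL Z) B).add (BiGood.cop_word A (hF.insR Z) B)

theorem BiGood.cop {F : Sentence gr → Sentence gr → W} (hF : BiGood F) : Good fun L => cop L F :=
  ⟨fun A B X Y => BiGood.cop_swap' A hF B X Y, fun A B => BiGood.cop_word A hF B⟩

/-! ### The cobracket -/

/-- The value of `F` on `∑ ± (U X_I) ⊗ (Z X_J)`. -/
def cop₂ (U Z : Word gr) (L : Sentence gr) (F : Sentence gr → Sentence gr → W) : W :=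
  cop L (insR Z (insL U F))

theorem cop₂_linear (U Z : Word gr) (L : Sentence gr) : IsLinearMap ℝ (cop₂ (W := W) U Z L) := by
  refine ⟨fun f g => ?_, fun r f => ?_⟩
  · simp only [cop₂, (insL_linear U).map_add, (insR_linear Z).map_add, (cop_linear L).map_add]
  · simp only [cop₂, (insL_linear U).map_smul, (insR_linear Z).map_smul, (cop_linear L).map_smul]

theorem map_cop₂ (φ : W →ₗ[ℝ] W') (U Z : Word gr) (L : Sentence gr)
    (F : Sentence gr → Sentence gr → W) :
    φ (cop₂ U Z L F) = cop₂ U Z L fun I J => φ (F I J) := by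
  rw [cop₂, cop₂, map_cop]
  simp only [insR, map_smul]
  rfl

/-- The value of `F` on the terms of `κ(X X₁ ⋯ X_n)` in which `X` is cut into `U ⊗ Z`. -/
def kapCut (L : Sentence gr) (F : Sentence gr → Sentence gr → W) (U Z : Word gr) : W :=
  sg (wordDeg U + 1) • (cop₂ U Z L F + sg (wordDeg U * wordDeg Z) • cop₂ Z U L F)

/-- The value of `F` on the cobracket of a sentence. -/
def kap : Sentence gr → (Sentence gr → Sentence gr → W) → W
  | [], _ => 0
  | X :: L, F => FC X (kapCut L F) + sg (wordDeg X) • (kap L (insL X F) + kap L (insR X F))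

theorem kapCut_add (L : Sentence gr) (F G : Sentence gr → Sentence gr → W) :
    kapCut L (F + G) = fun U Z => kapCut L F U Z + kapCut L G U Z := by
  funext U Z
  simp only [kapCut, (cop₂_linear _ _ L).map_add]
  module

theorem kapCut_smul (L : Sentence gr) (r : ℝ) (F : Sentence gr → Sentence gr → W) :
    kapCut L (r • F) = fun U Z => r • kapCut L F U Z := by
  funext U Z
  simp only [kapCut, (cop₂_linear _ _ L).map_smul]
  module

theorem kap_linear : ∀ L : Sentence gr, IsLinearMap ℝ (kap (W := W) L)
  | [] => ⟨fun _ _ => (add_zero _).symm, fun _ _ => (smul_zero _).symm⟩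
  | X :: L => by
    have h := kap_linear L
    refine ⟨fun f g => ?_, fun r f => ?_⟩
    · simp only [kap, (insL_linear X).map_add, (insR_linear X).map_add, h.map_add, kapCut_add,
        FC_add]
      module
    · simp only [kap, (insL_linear X).map_smul, (insR_linear X).map_smul, h.map_smul, kapCut_smul,
        FC_smul]
      module

theorem map_kap (φ : W →ₗ[ℝ] W') : ∀ (L : Sentence gr) (F : Sentence gr → Sentence gr → W),
    φ (kap L F) = kap L fun I J => φ (F I J)
  | [], F => map_zero φ
  | X :: L, F => by
    simp only [kap, map_add, map_smul, map_kap φ L, map_FC, kapCut, map_cop₂]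
    simp only [insR, map_smul]
    rfl

theorem LLin.FC_aux : ∀ (u v : Word gr) {K : Word gr → Word gr → W},
    (∀ w, LLin fun u => K u w) → (∀ u, LLin (K u)) →
    ∀ N : List (ℝ × Letter gr), IsLetterNull N → lc N (fun p => FC (u ++ p :: v) K) = 0
  | [], v, K, h1, h2, N, hN => by
    have e : ∀ u w, lc N (fun p => K (p :: u) w) = 0 := fun u w => h1 w [] u N hN
    have e' : lc N (fun p => K [] (p :: v)) = 0 := h2 [] [] v N hN
    simp only [List.nil_append, FC, lc_add, lc_FC, e, e', FC_zero, add_zero]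
  | a :: u, v, K, h1, h2, N, hN => by
    have e' : lc N (fun p => K [] (a :: (u ++ p :: v))) = 0 := h2 [] (a :: u) v N hN
    simp only [List.cons_append, FC, lc_add, e',
      LLin.FC_aux u v (fun w => (h1 w).cons a) (fun u => h2 (a :: u)) N hN, add_zero]

theorem FC_eq_of_left (X : Word gr) {F : Word gr → Word gr → W}
    (h : ∀ u w, u ≠ [] → u ++ w = X → F u w = 0) : FC X F = F [] X := by
  cases X with
  | nil => rfl
  | cons a x =>
    rw [FC, FC_congr (F' := fun _ _ => 0) fun u w huw => h (a :: u) w (by simp) (by simp [huw]),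
      FC_zero, add_zero]

/-- By `FC_shuffle` and vanishing on shuffles in the first argument, only the cuts `X ⊗ Y` and `Y ⊗
X` of a shuffle of `X` and `Y` contribute. The symmetrization with the sign `(-1)^(deg U + 1)` makes
these two opposite. -/
theorem NGood.FC_cobracket {h : Word gr → Word gr → W} (h1 : ∀ w, NGood fun u => h u w)
    (h2 : ∀ u, NGood (h u)) : NGood fun X => FC X fun u w =>
      sg (wordDeg u + 1) • (h u w + sg (wordDeg u * wordDeg w) • h w u) := by
  have k1 : ∀ w, NGood fun u =>
      sg (wordDeg u + 1) • (h u w + sg (wordDeg u * wordDeg w) • h w u) := fun w =>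
    ((h1 w).add ((h2 w).smul_sg_wordDeg fun x => x * wordDeg w)).smul_sg_wordDeg fun x => x + 1
  have k2 : ∀ u, NGood fun w =>
      sg (wordDeg u + 1) • (h u w + sg (wordDeg u * wordDeg w) • h w u) := fun u =>
    ((h2 u).add ((h1 u).smul_sg_wordDeg fun x => wordDeg u * x)).smul _
  refine ⟨fun u v N hN => LLin.FC_aux u v (fun w => (k1 w).llin) (fun u => (k2 u).llin) N hN,
    fun x y hx hy => ?_, (k1 []).nil⟩
  rw [FC_shuffle x y _ (fun u => (k2 u).shuffle) fun u => (k2 u).nil, FC_eq_of_left,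
    FC_eq_of_left]
  · simp only [SH_nil_left, SH_nil_right, wordDeg_eq, smul_add, smul_smul, sign_rules]
    module
  · exact fun u w hu _ => (k1 w).shuffle x u hx hu
  · intro u w hu _
    rw [(k1 w).shuffle u y hu hy, smul_zero]

theorem BiGood.cop₂_left {F : Sentence gr → Sentence gr → W} (hF : BiGood F) (Z : Word gr)
    (L : Sentence gr) : NGood fun U => cop₂ U Z L F :=
  NGood.comp_linear₂ (cop_linear L) fun I J => ((hF.left _).head I).smul _

theorem BiGood.cop₂_right {F : Sentence gr → Sentence gr → W} (hF : BiGood F) (U : Word gr)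
    (L : Sentence gr) : NGood fun Z => cop₂ U Z L F :=
  NGood.comp_linear₂ (cop_linear L) fun I J => ((hF.right _).head J).smul_sg_wordDeg
    fun x => x * sentenceDeg I

theorem BiGood.kapCut {F : Sentence gr → Sentence gr → W} (hF : BiGood F) (L : Sentence gr) :
    NGood fun X => FC X (kapCut L F) :=
  NGood.FC_cobracket (fun w => hF.cop₂_left w L) fun u => hF.cop₂_right u L

theorem BiGood.good_cop₂ {F : Sentence gr → Sentence gr → W} (hF : BiGood F) (U Z : Word gr) :
    Good fun L => cop₂ U Z L F := ((hF.insL U).insR Z).cop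

theorem Good.FC {F : Sentence gr → Word gr → Word gr → W} (hF : ∀ U Z, Good fun L => F L U Z) :
    ∀ X, Good fun L => ChevalleyHarrison.FC X (F L)
  | [] => hF [] []
  | a :: X => (hF [] (a :: X)).add
      (Good.FC (F := fun L u w => F L (a :: u) w) (fun U Z => hF (a :: U) Z) X)

theorem BiGood.good_kapCut {F : Sentence gr → Sentence gr → W} (hF : BiGood F) (X : Word gr) :
    Good fun L => FC X (ChevalleyHarrison.kapCut L F) :=
  Good.FC (fun U Z => ((hF.good_cop₂ U Z).add ((hF.good_cop₂ Z U).smul _)).smul _) X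

theorem BiGood.kap_word : ∀ (A : Sentence gr) {F : Sentence gr → Sentence gr → W}, BiGood F →
    ∀ B : Sentence gr, NGood fun X => kap (A ++ X :: B) F
  | [], F, hF, B => by
    simp only [List.nil_append, kap]
    exact (hF.kapCut B).add (((NGood.comp_linear₂ (kap_linear B) fun I J =>
      (hF.left J).head I).add (NGood.comp_linear₂ (kap_linear B) fun I J =>
        ((hF.right I).head J).smul_sg_wordDeg fun x => x * sentenceDeg I)).smul_sg_wordDeg
          fun x => x)
  | Z :: A, F, hF, B => by
    simp only [List.cons_append, kap]
    exact ((hF.good_kapCut Z).word A B).add (((BiGood.kap_word A (hF.insL Z) B).add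
      (BiGood.kap_word A (hF.insR Z) B)).smul _)

theorem cop₂_cons {F : Sentence gr → Sentence gr → W} (hF : BiGood F) (U Z Y : Word gr)
    (L : Sentence gr) : cop₂ U Z (Y :: L) F =
      sg (wordDeg Y * (wordDeg U + wordDeg Z)) • (cop₂ U Z L (insL Y F) + cop₂ U Z L (insR Y F)) := by
  simp only [cop₂, cop]
  rw [SwapGood.insR_insR (hF.insL U) Z Y, insR_insL F U Y,
    show insL Y (insR Z (insL U F)) =
      sg (wordDeg Y * (wordDeg U + wordDeg Z)) •
        insR Z (insL U (insL Y F)) from ?_]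
  · simp only [(insR_linear Z).map_smul, (cop_linear L).map_smul, smul_add, smul_smul, sign_rules]
  · funext I J
    simp only [insL, insR, Pi.smul_apply, sentenceDeg_cons,
      (hF.left (Z :: J)).swap.head U Y I, smul_smul, sign_rules]

/-- The word `Y` is moved out past both pieces of `X`. Their degrees add up to `deg X - 1`, which
has the parity of `deg X + 1`. -/
theorem FC_kapCut_cons {F : Sentence gr → Sentence gr → W} (hF : BiGood F) (X Y : Word gr)
    (L : Sentence gr) : FC X (kapCut (Y :: L) F) =
      sg (wordDeg Y * (wordDeg X + 1)) • (FC X (kapCut L (insL Y F))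
        + FC X (kapCut L (insR Y F))) := by
  rw [← FC_add, ← FC_smul]
  refine FC_congr fun u w huw => ?_
  simp only [kapCut, cop₂_cons hF, ← huw, wordDeg_eq, lettersDeg_append]
  simp only [smul_add, smul_smul, sign_rules]
  module

theorem BiGood.kap_swap {F : Sentence gr → Sentence gr → W} (hF : BiGood F) (L : Sentence gr)
    (X Y : Word gr) : kap (X :: Y :: L) F = sg (wordDeg X * wordDeg Y) • kap (Y :: X :: L) F := by
  simp only [kap]
  rw [SwapGood.insL_insL hF X Y, SwapGood.insR_insR hF X Y, insR_insL F X Y, insR_insL F Y X,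
    FC_kapCut_cons hF, FC_kapCut_cons hF]
  simp only [(kap_linear L).map_smul, smul_add, smul_smul, sign_rules]
  module

theorem BiGood.kap_swap' : ∀ (A : Sentence gr) {F : Sentence gr → Sentence gr → W}, BiGood F →
    ∀ (B : Sentence gr) (X Y : Word gr),
    kap (A ++ X :: Y :: B) F = sg (wordDeg X * wordDeg Y) • kap (A ++ Y :: X :: B) F
  | [], F, hF, B, X, Y => hF.kap_swap B X Y
  | Z :: A, F, hF, B, X, Y => by
    have h := (hF.good_kapCut Z).swap A B X Y
    simp only [List.cons_append, kap]
    rw [BiGood.kap_swap' A (hF.insL Z), BiGood.kap_swap' A (hF.insR Z), h]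
    module

theorem BiGood.kap {F : Sentence gr → Sentence gr → W} (hF : BiGood F) : Good fun L => kap L F :=
  ⟨fun A B X Y => BiGood.kap_swap' A hF B X Y, fun A B => BiGood.kap_word A hF B⟩

/-- The value of `F` on the terms of `κ` in which a word between the words of `A` and the words
of `B` is cut into `U ⊗ Z`. -/
def kapTerm (A B : Sentence gr) (U Z : Word gr) (F : Sentence gr → Sentence gr → W) : W :=
  lc (splits wordDeg A) fun s => lc (splits wordDeg B) fun t =>
    sg (sentenceDeg A + wordDeg U + 1) •
      (sg (sentenceDeg s.2 * wordDeg U + sentenceDeg t.1 * (sentenceDeg s.2 + wordDeg Z)) •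
        F (s.1 ++ U :: t.1) (s.2 ++ Z :: t.2)
      + sg (wordDeg U * wordDeg Z + sentenceDeg s.2 * wordDeg Z +
          sentenceDeg t.1 * (sentenceDeg s.2 + wordDeg U)) •
        F (s.1 ++ Z :: t.1) (s.2 ++ U :: t.2))

theorem lc_splits_cons (X : Word gr) (L : Sentence gr) (g : Sentence gr × Sentence gr → W) :
    lc (splits wordDeg (X :: L)) g = lc (splits wordDeg L) (fun t => g (X :: t.1, t.2)) +
      lc (splits wordDeg L) fun t => sg (wordDeg X * sentenceDeg t.1) • g (t.1, X :: t.2) := by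
  rw [splits, lc_append]
  congr 1
  · exact lc_map _ (fun t : Sentence gr × Sentence gr => (X :: t.1, t.2)) g
  · exact lc_map_sg _ (fun t : Sentence gr × Sentence gr => wordDeg X * sentenceDeg t.1)
      (fun t => (t.1, X :: t.2)) g

theorem kapTerm_cons (X : Word gr) (A B : Sentence gr) (U Z : Word gr)
    (F : Sentence gr → Sentence gr → W) : kapTerm (X :: A) B U Z F =
      sg (wordDeg X) • (kapTerm A B U Z (insL X F) + kapTerm A B U Z (insR X F)) := by
  simp only [kapTerm, lc_splits_cons, smul_add, ← lc_smul]
  congr 1 <;>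
  · refine lc_congr fun s _ => lc_congr fun t _ => ?_
    simp only [insL, insR, List.cons_append, sentenceDeg_cons, sentenceDeg_append]
    generalize wordDeg X = x, sentenceDeg A = a, wordDeg U = u, wordDeg Z = z,
      sentenceDeg s.2.1 = s₁, sentenceDeg s.2.2 = s₂, sentenceDeg t.2.1 = t₁
    simp only [smul_add, smul_smul, sign_rules]

theorem kapTerm_nil (B : Sentence gr) (U Z : Word gr) (F : Sentence gr → Sentence gr → W) :
    kapTerm [] B U Z F = kapCut B F U Z := by
  simp only [kapTerm, splits, lc_cons, lc_nil, one_smul, add_zero, kapCut, cop₂, ← cop_eq_lc,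
    lc_smul, lc_add, insL, insR, List.nil_append, sentenceDeg_nil, zero_mul, zero_add]
  congr 2
  · exact lc_congr fun t _ => by rw [mul_comm]
  · rw [← lc_smul]
    refine lc_congr fun t _ => ?_
    simp only [smul_smul, sign_rules]

theorem kap_eq_sum : ∀ (L : Sentence gr) (F : Sentence gr → Sentence gr → W),
    kap L F = ∑ k : Fin L.length, FC (L.get k) fun U Z => kapTerm (L.take k) (L.drop (k + 1)) U Z F
  | [], F => by simp [kap]
  | X :: L, F => by
    rw [kap, kap_eq_sum L, kap_eq_sum L]
    simp only [List.length_cons, Fin.sum_univ_succ, ← Finset.sum_add_distrib, Finset.smul_sum,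
      ← FC_add, ← FC_smul]
    simp [kapTerm_cons, kapTerm_nil]

theorem mk_biGood : BiGood fun I J : Sentence gr => mk I ⊗ₜ[ℝ] mk J :=
  ⟨fun J => mk_good.comp ((TensorProduct.mk ℝ (Space gr) (Space gr)).flip (mk J)),
    fun I => mk_good.comp (TensorProduct.mk ℝ (Space gr) (Space gr) (mk I))⟩

theorem coprodVal_eq (L : Sentence gr) : coprodVal L = cop L fun I J => mk I ⊗ₜ[ℝ] mk J :=
  cop_eq_lc L fun I J => mk I ⊗ₜ[ℝ] mk J

theorem coprodVal_descends : Descends (coprodVal (gr := gr)) := by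
  rw [show coprodVal (gr := gr) = _ from funext coprodVal_eq]
  exact mk_biGood.cop.descends (by simp [cop, mk_nil])

theorem cobracketTerm_eq (A B : Sentence gr) (U Z : Word gr) :
    cobracketTerm A B U Z = kapTerm A B U Z fun I J => mk I ⊗ₜ[ℝ] mk J := by
  rw [cobracketTerm, kapTerm, lc]
  congr 1
  refine List.map_congr_left fun s _ => ?_
  rw [lc, List.smul_sum, List.map_map]
  congr 1
  refine List.map_congr_left fun t _ => ?_
  simp only [neg_one_zpow_eq_sg, Function.comp_def, smul_smul]
  congr 1
  ring

theorem cobracketVal_eq (L : Sentence gr) :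
    cobracketVal L = kap L fun I J => mk I ⊗ₜ[ℝ] mk J := by
  rw [kap_eq_sum, cobracketVal]
  refine Finset.sum_congr rfl fun k _ => ?_
  have hl : ∀ (A I : Sentence gr), mk (A ++ [] :: I) = 0 := fun A I => (mk_good.word A I).nil
  -- The recursion `kap` also runs over cuts with an empty piece. They contribute zero because the
  -- class of a sentence with an empty word is zero.
  have h1 : ∀ U, kapTerm (L.take k) (L.drop (k + 1)) U []
      (fun I J => mk I ⊗ₜ[ℝ] mk J) = 0 := fun U => by
    simp only [kapTerm, hl, TensorProduct.tmul_zero, TensorProduct.zero_tmul, smul_zero, add_zero,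
      lc_zero]
  have h2 : ∀ U, kapTerm (L.take k) (L.drop (k + 1)) [] U
      (fun I J => mk I ⊗ₜ[ℝ] mk J) = 0 := fun U => by
    simp only [kapTerm, hl, TensorProduct.tmul_zero, TensorProduct.zero_tmul, smul_zero, add_zero,
      lc_zero]
  simp only [cobracketTerm_eq]
  cases hX : L.get k with
  | nil => simp [cuts, FC, h1]
  | cons a x =>
    rw [sum_cuts a x (fun U Z => kapTerm (L.take k) (L.drop (k + 1)) U Z
      fun I J => mk I ⊗ₜ[ℝ] mk J) h1, FC, h2, zero_add]

theorem cobracketVal_descends : Descends (cobracketVal (gr := gr)) := by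
  rw [show cobracketVal (gr := gr) = _ from funext cobracketVal_eq]
  exact mk_biGood.kap.descends rfl

end Coproducts

section Letters

variable {V : Type*} [AddCommGroup V] [Module ℝ V] {gr : ℤ → Submodule ℝ V}
  {V' : Type*} [AddCommGroup V'] [Module ℝ V'] {gr' : ℤ → Submodule ℝ V'}
  {W : Type*} [AddCommGroup W] [Module ℝ W]

/-! ### The projection to the cogenerators, signs and functoriality -/

theorem cogenVal_eq_zero {L : Sentence gr} (h : L.length ≠ 1) : cogenVal L = 0 := by
  unfold cogenVal
  split
  · simp at h
  · rfl

theorem cogenVal_eq_zero' {X : Word gr} (h : X.length ≠ 1) : cogenVal [X] = 0 := by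
  unfold cogenVal
  split
  · rename_i heq
    simp only [List.cons.injEq, and_true] at heq
    simp [heq] at h
  · rfl

theorem cogenVal_ngood : NGood fun X : Word gr => cogenVal [X] where
  llin u v N hN := by
    by_cases h : u = [] ∧ v = []
    · obtain ⟨rfl, rfl⟩ := h
      exact hN.choose_spec.2
    · rw [lc_congr (g' := fun _ => 0), lc_zero]
      intro t _
      refine cogenVal_eq_zero' ?_
      simp only [List.length_append, List.length_cons]
      intro h'
      exact h ⟨List.length_eq_zero_iff.1 (by omega), List.length_eq_zero_iff.1 (by omega)⟩
  shuffle x y hx hy := by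
    rw [SH_congr (g' := fun _ => 0)]
    · exact lc_zero _
    · intro w _ hw
      refine cogenVal_eq_zero' ?_
      have := List.length_pos_of_ne_nil hx
      have := List.length_pos_of_ne_nil hy
      omega
  nil := rfl

theorem cogenVal_good : Good (cogenVal (gr := gr)) where
  swap A B X Y := by
    rw [cogenVal_eq_zero, cogenVal_eq_zero, smul_zero] <;>
    · simp only [List.length_append, List.length_cons]; omega
  word A B := by
    by_cases h : A = [] ∧ B = []
    · obtain ⟨rfl, rfl⟩ := h
      exact cogenVal_ngood
    · rw [show (fun X => cogenVal (A ++ X :: B)) = fun _ => 0 from funext fun X => by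
        refine cogenVal_eq_zero ?_
        simp only [List.length_append, List.length_cons]
        intro h'
        exact h ⟨List.length_eq_zero_iff.1 (by omega), List.length_eq_zero_iff.1 (by omega)⟩]
      exact NGood.zero

theorem cogenVal_descends : Descends (cogenVal (gr := gr)) := cogenVal_good.descends rfl

theorem signVal_descends (d : ℤ) : Descends (signVal (gr := gr) d) :=
  (mk_good.smul_sg d).descends (by simp [mk_nil])

theorem wordDeg_map {ι : Letter gr → Letter gr'} (hι : ∀ a, letterDeg (ι a) = letterDeg a)
    (X : Word gr) : wordDeg (X.map ι) = wordDeg X := by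
  simp [wordDeg, Function.comp_def, hι]

theorem SH_map {ι : Letter gr → Letter gr'} (hι : ∀ a, letterDeg (ι a) = letterDeg a) :
    ∀ (x y : Word gr) (g : Word gr' → W),
      SH (x.map ι) (y.map ι) g = SH x y fun w => g (w.map ι)
  | [], y, g => by simp
  | a :: x, [], g => by simp
  | a :: x, b :: y, g => by
    have h1 := SH_map hι x (b :: y) fun w => g (ι a :: w)
    have h2 := SH_map hι (a :: x) y fun w => g (ι b :: w)
    simp only [List.map_cons] at h1 h2
    have h3 : lettersDeg (x.map ι) = lettersDeg x := by
      simp [lettersDeg, Function.comp_def, hι]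
    simp only [List.map_cons, SH_cons, h1, h2, h3, hι]
  termination_by x y => x.length + y.length

theorem Good.map {ι : Letter gr → Letter gr'} (hι : ∀ a, letterDeg (ι a) = letterDeg a)
    (hN : ∀ N, IsLetterNull N → IsLetterNull (N.map fun t => (t.1, ι t.2)))
    {f : Sentence gr' → W} (hf : Good f) : Good fun L : Sentence gr => f (L.map (List.map ι)) where
  swap A B X Y := by
    simp only [List.map_append, List.map_cons]
    rw [hf.swap, wordDeg_map hι, wordDeg_map hι]
  word A B :=
    { llin := fun u v N h => by
        have := (hf.word (A.map (List.map ι)) (B.map (List.map ι))).llin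
          (u.map ι) (v.map ι) _ (hN N h)
        rw [lc_map N fun p => ι p] at this
        simpa using this
      shuffle := fun x y hx hy => by
        have := (hf.word (A.map (List.map ι)) (B.map (List.map ι))).shuffle
          (x.map ι) (y.map ι) (by simpa using hx) (by simpa using hy)
        rw [SH_map hι] at this
        simpa using this
      nil := by
        have := (hf.word (A.map (List.map ι)) (B.map (List.map ι))).nil
        simpa using this }

/-! ### The parity operator -/

/-- The formulas put Koszul signs on homogeneous elements, while the corestriction needs bilinear
maps on all of `V`. The decomposition of `V` into its homogeneous parts yields a linear operator
that carries the sign. -/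
theorem exists_parity (h : DirectSum.IsInternal gr) :
    ∃ s : V →ₗ[ℝ] V, ∀ i, ∀ v ∈ gr i, s v = sg i • v := by
  let e := LinearEquiv.ofBijective (DirectSum.coeLinearMap gr) h
  refine ⟨DirectSum.toModule ℝ ℤ V (fun i => sg i • (gr i).subtype) ∘ₗ e.symm.toLinearMap, ?_⟩
  intro i v hv
  have : e.symm v = DirectSum.lof ℝ ℤ (fun i => gr i) i ⟨v, hv⟩ := by
    rw [LinearEquiv.symm_apply_eq]
    exact (DirectSum.coeLinearMap_of gr i ⟨v, hv⟩).symm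
  simp [this]

/-- The sign `(-1)^(ij)` is a polynomial in `(-1)^i` and `(-1)^j`, affine in each. Hence it can be
realized by the parity operators, which is how `twist` is built. -/
theorem sg_mul_eq (i j : ℤ) : (1 / 2 : ℝ) * (1 + sg j + sg i - sg i * sg j) = sg (i * j) := by
  rcases Int.even_or_odd i with hi | hi <;> rcases Int.even_or_odd j with hj | hj
  · simp only [sg, hi.neg_one_zpow, hj.neg_one_zpow, (hi.mul_right j).neg_one_zpow]; norm_num
  · simp only [sg, hi.neg_one_zpow, hj.neg_one_zpow, (hi.mul_right j).neg_one_zpow]; norm_num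
  · simp only [sg, hi.neg_one_zpow, hj.neg_one_zpow, (hj.mul_left i).neg_one_zpow]; norm_num
  · simp only [sg, hi.neg_one_zpow, hj.neg_one_zpow, (hi.mul hj).neg_one_zpow]; norm_num

/-- The bilinear map with values `(-1)^{ij} β(a, v)` for `a` of degree `i` and `v` of degree `j`,
when `s` and `s'` are the parity operators. -/
def twist (s : V →ₗ[ℝ] V) (s' : V' →ₗ[ℝ] V') (β : V →ₗ[ℝ] V' →ₗ[ℝ] W) : V →ₗ[ℝ] V' →ₗ[ℝ] W :=
  (1 / 2 : ℝ) • (β + β.compl₂ s' + β ∘ₗ s - (β ∘ₗ s).compl₂ s')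

theorem twist_apply {s : V →ₗ[ℝ] V} {s' : V' →ₗ[ℝ] V'} (β : V →ₗ[ℝ] V' →ₗ[ℝ] W) {i j : ℤ}
    {a : V} {v : V'} (ha : s a = sg i • a) (hv : s' v = sg j • v) :
    twist s s' β a v = sg (i * j) • β a v := by
  rw [← sg_mul_eq]
  simp only [twist, LinearMap.smul_apply, LinearMap.add_apply, LinearMap.sub_apply,
    LinearMap.compl₂_apply, LinearMap.comp_apply, ha, hv, map_smul]
  module

/-- The operations are restrictions of bilinear maps. -/
structure Ops.Lift (O : Ops V) where
  s : V →ₗ[ℝ] V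
  mul : V →ₗ[ℝ] V →ₗ[ℝ] V
  bracket : V →ₗ[ℝ] V →ₗ[ℝ] V
  s_eq : ∀ i, ∀ v ∈ O.gr i, s v = sg i • v
  mul_eq : ∀ a b, (O.mul a b).1.2 = mul a.1.2 b.1.2
  bracket_eq : ∀ a b, (O.bracket a b).1.2 = bracket a.1.2 b.1.2
  mul_fst : ∀ a b, (O.mul a b).1.1 = a.1.1 + b.1.1
  bracket_fst : ∀ a b, (O.bracket a b).1.1 = a.1.1 + b.1.1 - 1
  mul_comm : ∀ a b : Letter O.gr, mul a.1.2 b.1.2 = sg (a.1.1 * b.1.1) • mul b.1.2 a.1.2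
  bracket_skew : ∀ a b : Letter O.gr, bracket a.1.2 b.1.2 =
    -(sg ((a.1.1 - 1) * (b.1.1 - 1)) • bracket b.1.2 a.1.2)

theorem lc_val_map (φ : V →ₗ[ℝ] V) (N : List (ℝ × Letter gr)) (h : Letter gr → Letter gr)
    (hφ : ∀ a, (h a).1.2 = φ a.1.2) (h0 : lc N (fun p => p.1.2) = 0) :
    lc (N.map fun t => (t.1, h t.2)) (fun p => p.1.2) = 0 := by
  rw [lc_map N h]
  simp only [hφ]
  rw [← map_lc, h0, map_zero]

theorem Ops.Lift.regular {O : Ops V} (P : O.Lift) : O.Regular where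
  mul_deg a b := by simp only [letterDeg, P.mul_fst]; ring
  bracket_deg a b := by simp only [letterDeg, P.bracket_fst]; ring
  mul_null_left N b hN := by
    obtain ⟨i, hi, h0⟩ := hN
    refine ⟨i + b.1.1, ?_, lc_val_map (P.mul.flip b.1.2) N _ (fun a => P.mul_eq a b) h0⟩
    simp only [List.mem_map, forall_exists_index, and_imp]
    rintro _ t ht rfl
    rw [P.mul_fst, hi t ht]
  mul_null_right N a hN := by
    obtain ⟨i, hi, h0⟩ := hN
    refine ⟨a.1.1 + i, ?_, lc_val_map (P.mul a.1.2) N _ (fun b => P.mul_eq a b) h0⟩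
    simp only [List.mem_map, forall_exists_index, and_imp]
    rintro _ t ht rfl
    rw [P.mul_fst, hi t ht]
  bracket_null_left N b hN := by
    obtain ⟨i, hi, h0⟩ := hN
    refine ⟨i + b.1.1 - 1, ?_, lc_val_map (P.bracket.flip b.1.2) N _ (fun a => P.bracket_eq a b) h0⟩
    simp only [List.mem_map, forall_exists_index, and_imp]
    rintro _ t ht rfl
    rw [P.bracket_fst, hi t ht]
  mul_comm a b := by
    refine ⟨a.1.1 + b.1.1, ?_, ?_⟩
    · simp [P.mul_fst, add_comm]
    · simp only [lc_cons, lc_nil, P.mul_eq, P.mul_comm a b, letterDeg, sub_add_cancel]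
      module
  bracket_skew a b := by
    refine ⟨a.1.1 + b.1.1 - 1, ?_, ?_⟩
    · simp [P.bracket_fst, add_comm]
    · simp only [lc_cons, lc_nil, P.bracket_eq, P.bracket_skew a b, letterDeg]
      module

theorem structureMapsDescend {O : Ops V} (hO : O.Regular) : StructureMapsDescend O :=
  ⟨coprodVal_descends, cobracketVal_descends, cogenVal_descends, signVal_descends,
    mVal_descends hO, ellVal_descends hO⟩

end Letters

/-! ### Gerstenhaber algebras and semidirect products as instances of the general operations -/

section Gerstenhaber

variable {G : Type*} [AddCommGroup G] [Module ℝ G] (A : GerstenhaberAlgebra G)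

/-- The parity operator of a Gerstenhaber algebra. -/
def GerstenhaberAlgebra.s : G →ₗ[ℝ] G := (exists_parity A.isInternal).choose

theorem GerstenhaberAlgebra.s_apply (i : ℤ) (v : G) (hv : v ∈ A.gr i) : A.s v = sg i • v :=
  (exists_parity A.isInternal).choose_spec i v hv

def GerstenhaberAlgebra.lift : A.ops.Lift where
  s := A.s
  mul := A.mul
  bracket := A.bracket
  s_eq := A.s_apply
  mul_eq _ _ := rfl
  bracket_eq _ _ := rfl
  mul_fst _ _ := rfl
  bracket_fst _ _ := rfl
  mul_comm a b := A.mul_comm a.2 b.2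
  bracket_skew a b := A.bracket_skew a.2 b.2

theorem GerstenhaberAlgebra.ops_gerstenhaber : A.ops.Gerstenhaber where
  toRegular := A.lift.regular
  jacobi a b c := by
    refine ⟨a.1.1 + b.1.1 + c.1.1 - 2, ?_, ?_⟩
    · intro t ht
      simp only [List.mem_cons, List.not_mem_nil, or_false] at ht
      rcases ht with rfl | rfl | rfl <;> simp only [GerstenhaberAlgebra.ops] <;> ring
    · simp only [lc_cons, lc_nil, add_zero, ← add_assoc]
      exact A.jacobi a.2 b.2 c.2
  mul_assoc a b c := by
    refine ⟨a.1.1 + b.1.1 + c.1.1, ?_, ?_⟩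
    · intro t ht
      simp only [List.mem_cons, List.not_mem_nil, or_false] at ht
      rcases ht with rfl | rfl <;> simp only [GerstenhaberAlgebra.ops] <;> ring
    · simp [GerstenhaberAlgebra.ops, A.mul_assoc]
  leibniz a b c := by
    refine ⟨a.1.1 + b.1.1 + c.1.1 - 1, ?_, ?_⟩
    · intro t ht
      simp only [List.mem_cons, List.not_mem_nil, or_false] at ht
      rcases ht with rfl | rfl | rfl <;> simp only [GerstenhaberAlgebra.ops] <;> ring
    · simp only [lc_cons, lc_nil, GerstenhaberAlgebra.ops, letterDeg, sub_add_cancel,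
        A.leibniz a.2 b.2 c.2, neg_one_zpow_eq_sg]
      module
  leibniz' a b c := by
    refine ⟨a.1.1 + b.1.1 + c.1.1 - 1, ?_, ?_⟩
    · intro t ht
      simp only [List.mem_cons, List.not_mem_nil, or_false] at ht
      rcases ht with rfl | rfl | rfl <;> simp only [GerstenhaberAlgebra.ops] <;> ring
    · simp only [lc_cons, lc_nil, GerstenhaberAlgebra.ops, letterDeg, sub_add_cancel]
      -- The Leibniz rule in the first argument follows from the one in the second by three
      -- applications of skew symmetry.
      rw [A.bracket_skew (A.mul_mem a.2 b.2) c.2, A.leibniz c.2 a.2 b.2,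
        A.bracket_skew c.2 a.2, A.bracket_skew c.2 b.2]
      simp only [neg_one_zpow_eq_sg, map_neg, map_smul, LinearMap.neg_apply, LinearMap.smul_apply,
        smul_add, smul_neg, smul_smul]
      generalize a.1.1 = i, b.1.1 = j, c.1.1 = k
      simp only [sign_rules]
      module

variable {A} {M : Type*} [AddCommGroup M] [Module ℝ M] (R : GerstenhaberModule A M)

/-- The parity operator of a module. -/
def GerstenhaberModule.s : M →ₗ[ℝ] M := (exists_parity R.isInternal).choose

theorem GerstenhaberModule.s_apply (i : ℤ) (v : M) (hv : v ∈ R.gr i) : R.s v = sg i • v :=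
  (exists_parity R.isInternal).choose_spec i v hv

/-- The right multiplication by elements of the algebra. -/
def GerstenhaberModule.rmul : G →ₗ[ℝ] M →ₗ[ℝ] M := twist A.s R.s R.smul

/-- The right bracket with elements of the algebra. -/
def GerstenhaberModule.ract : G →ₗ[ℝ] M →ₗ[ℝ] M := (twist A.s R.s R.act ∘ₗ A.s).compl₂ R.s

theorem GerstenhaberModule.rmul_apply {i j : ℤ} {a : G} {v : M} (ha : a ∈ A.gr i)
    (hv : v ∈ R.gr j) : R.rmul a v = sg (i * j) • R.smul a v :=
  twist_apply _ (A.s_apply i a ha) (R.s_apply j v hv)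

/-- Since `(-1)^((i-1)(j-1)) = -(-1)^(ij) (-1)^i (-1)^j`, composing the twisted action with both
parity operators gives the required sign, including the minus. -/
theorem GerstenhaberModule.ract_apply {i j : ℤ} {a : G} {v : M} (ha : a ∈ A.gr i)
    (hv : v ∈ R.gr j) : R.ract a v = -(sg ((i - 1) * (j - 1)) • R.act a v) := by
  rw [ract, LinearMap.compl₂_apply, LinearMap.comp_apply, A.s_apply i a ha, R.s_apply j v hv,
    map_smul, map_smul, LinearMap.smul_apply,
    twist_apply _ (A.s_apply i a ha) (R.s_apply j v hv)]
  simp only [smul_smul, sign_rules]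
  module

/-- The bilinear map on `G ⊕ M` with components given by `α` on `G` and `β`, `β'` on `M`. -/
def semidirectMap (α : G →ₗ[ℝ] G →ₗ[ℝ] G) (β β' : G →ₗ[ℝ] M →ₗ[ℝ] M) :
    G × M →ₗ[ℝ] G × M →ₗ[ℝ] G × M :=
  LinearMap.mk₂ ℝ (fun x y => (α x.1 y.1, β x.1 y.2 + β' y.1 x.2))
    (fun x x' y => by ext <;> simp; abel) (fun r x y => by ext <;> simp)
    (fun x y y' => by ext <;> simp; abel) (fun r x y => by ext <;> simp)

theorem semidirectMap_apply (α : G →ₗ[ℝ] G →ₗ[ℝ] G) (β β' : G →ₗ[ℝ] M →ₗ[ℝ] M) (x y : G × M) :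
    semidirectMap α β β' x y = (α x.1 y.1, β x.1 y.2 + β' y.1 x.2) := rfl

/-- Degrees, bilinearity and symmetries of `G ⋉ M` suffice: the identities of the semidirect product
enter neither the definition of the structure maps nor the equation of morphisms. -/
def GerstenhaberModule.lift : R.semidirect.Lift where
  s := LinearMap.prodMap A.s R.s
  mul := semidirectMap A.mul R.smul R.rmul
  bracket := semidirectMap A.bracket R.act R.ract
  s_eq i v hv := Prod.ext (A.s_apply i v.1 hv.1) (R.s_apply i v.2 hv.2)
  mul_eq a b := by
    rw [semidirectMap_apply, R.rmul_apply b.2.1 a.2.2, mul_comm]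
    rfl
  bracket_eq a b := by
    rw [semidirectMap_apply, R.ract_apply b.2.1 a.2.2, ← sub_eq_add_neg]
    rfl
  mul_fst _ _ := rfl
  bracket_fst _ _ := rfl
  mul_comm a b := by
    rw [semidirectMap_apply, semidirectMap_apply, R.rmul_apply b.2.1 a.2.2,
      R.rmul_apply a.2.1 b.2.2, A.mul_comm a.2.1 b.2.1]
    ext
    · rfl
    · simp only [Prod.smul_mk, smul_add, smul_smul, sign_rules]
      module
  bracket_skew a b := by
    rw [semidirectMap_apply, semidirectMap_apply, R.ract_apply b.2.1 a.2.2,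
      R.ract_apply a.2.1 b.2.2, A.bracket_skew a.2.1 b.2.1]
    ext
    · rfl
    · simp only [Prod.smul_mk, Prod.neg_mk, smul_add, smul_neg, smul_smul]
      generalize a.1.1 = i, b.1.1 = j
      simp only [sign_rules]
      module

theorem inclVal_descends : Descends (inclVal R) := by
  refine (mk_good.map (ι := inclLetter R) (fun a => rfl) fun N hN => ?_).descends mk_nil
  obtain ⟨i, hi, h0⟩ := hN
  refine ⟨i, ?_, ?_⟩
  · simp only [List.mem_map, forall_exists_index, and_imp]
    rintro _ t ht rfl
    exact hi t ht
  · rw [lc_map N (inclLetter R)]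
    have := map_lc (LinearMap.inl ℝ G M) N fun p => p.1.2
    rw [h0, map_zero] at this
    exact this.symm

end Gerstenhaber

/-! ### Cocommutativity of `Δ` and `κ`, and the projections of `m` and `ℓ` to the cogenerators -/

section Cocommutativity

variable {V : Type*} [AddCommGroup V] [Module ℝ V] {gr : ℤ → Submodule ℝ V}
  {W W' : Type*} [AddCommGroup W] [Module ℝ W] [AddCommGroup W'] [Module ℝ W']

/-- The function `F` with exchanged arguments, with the Koszul sign. -/
def tr (F : Sentence gr → Sentence gr → W) : Sentence gr → Sentence gr → W :=
  fun I J => sg (sentenceDeg I * sentenceDeg J) • F J I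

theorem insL_tr (X : Word gr) (F : Sentence gr → Sentence gr → W) :
    insL X (tr F) = tr (insR X F) := by
  funext I J
  simp only [insL, insR, tr, sentenceDeg_cons, smul_smul, sign_rules]

theorem insR_tr (X : Word gr) (F : Sentence gr → Sentence gr → W) :
    insR X (tr F) = tr (insL X F) := by
  funext I J
  simp only [insL, insR, tr, sentenceDeg_cons, smul_smul, sign_rules]

/-- Exchanging the factors interchanges the two ways of placing the first word. Together with
`kap_tr` this allows a pairing to be replaced by its transpose, so that symmetrized pairings carry a
factor `1/2`. -/
theorem cop_tr : ∀ (L : Sentence gr) (F : Sentence gr → Sentence gr → W), cop L (tr F) = cop L F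
  | [], F => by simp [cop, tr, sg_zero]
  | X :: L, F => by
    rw [cop, cop, insL_tr, insR_tr, cop_tr L, cop_tr L, add_comm]

theorem cop₂_tr (U Z : Word gr) (L : Sentence gr) (F : Sentence gr → Sentence gr → W) :
    cop₂ U Z L (tr F) = sg (wordDeg U * wordDeg Z) • cop₂ Z U L F := by
  rw [cop₂, cop₂, insL_tr, insR_tr, cop_tr, insR_insL, (cop_linear L).map_smul, smul_smul]
  simp only [sign_rules, one_smul]

theorem kapCut_tr (L : Sentence gr) (F : Sentence gr → Sentence gr → W) :
    kapCut L (tr F) = kapCut L F := by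
  funext U Z
  simp only [kapCut, cop₂_tr, smul_smul, smul_add, sign_rules]
  module

theorem kap_tr : ∀ (L : Sentence gr) (F : Sentence gr → Sentence gr → W), kap L (tr F) = kap L F
  | [], F => rfl
  | X :: L, F => by
    rw [kap, kap, insL_tr, insR_tr, kap_tr L, kap_tr L, kapCut_tr, add_comm (kap L _)]

/-- The coproduct preserves the total number of words, and the cobracket raises it by one. Vanishing
can therefore be read off from these numbers. -/
theorem cop_eq_zero : ∀ (L : Sentence gr) {F : Sentence gr → Sentence gr → W},
    (∀ I J, I.length + J.length = L.length → F I J = 0) → cop L F = 0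
  | [], F, h => h [] [] rfl
  | X :: L, F, h => by
    rw [cop, cop_eq_zero L, cop_eq_zero L, add_zero]
    · intro I J hIJ
      rw [insR, h, smul_zero]
      simp only [List.length_cons]; omega
    · intro I J hIJ
      exact h _ _ (by simp only [List.length_cons]; omega)

theorem kapCut_eq_zero (L : Sentence gr) {F : Sentence gr → Sentence gr → W}
    (h : ∀ I J, I.length + J.length = L.length + 2 → F I J = 0) (U Z : Word gr) :
    kapCut L F U Z = 0 := by
  have : ∀ U Z, cop₂ U Z L F = 0 := fun U Z => cop_eq_zero L fun I J hIJ => by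
    rw [insR, insL, h, smul_zero]
    simp only [List.length_cons]; omega
  rw [kapCut, this, this, smul_zero, add_zero, smul_zero]

theorem kap_eq_zero : ∀ (L : Sentence gr) {F : Sentence gr → Sentence gr → W},
    (∀ I J, I.length + J.length = L.length + 1 → F I J = 0) → kap L F = 0
  | [], F, h => rfl
  | X :: L, F, h => by
    rw [kap, FC_congr (F' := fun _ _ => 0), FC_zero, kap_eq_zero L, kap_eq_zero L]
    · simp
    · intro I J hIJ
      rw [insR, h, smul_zero]
      simp only [List.length_cons]; omega
    · intro I J hIJ
      exact h _ _ (by simp only [List.length_cons]; omega)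
    · exact fun u w _ => kapCut_eq_zero L h u w

theorem cop_of_right : ∀ (L : Sentence gr) {F : Sentence gr → Sentence gr → W},
    (∀ I J, J ≠ [] → F I J = 0) → cop L F = F L []
  | [], F, h => rfl
  | X :: L, F, h => by
    have h1 : ∀ I J, insR X F I J = 0 := fun I J => by rw [insR, h _ _ (by simp), smul_zero]
    rw [cop, cop_of_right L (F := insL X F) fun I J hJ => h _ J hJ,
      cop_of_right L fun I J _ => h1 I J, h1, add_zero, insL]

/-- Every term of the cobracket has a word in its second factor, namely one of the two pieces of the
cut word. -/
theorem kap_of_right : ∀ (L : Sentence gr) {F : Sentence gr → Sentence gr → W},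
    (∀ I J, J ≠ [] → F I J = 0) → kap L F = 0
  | [], F, h => rfl
  | X :: L, F, h => by
    have h2 : ∀ U Z, cop₂ U Z L F = 0 := fun U Z => by
      rw [cop₂, cop_of_right L fun I J _ => by rw [insR, insL, h _ _ (by simp), smul_zero], insR,
        insL, h _ _ (by simp), smul_zero]
    rw [kap, FC_congr (F' := fun _ _ => 0) fun u w _ => by
      rw [kapCut, h2, h2, smul_zero, add_zero, smul_zero], FC_zero,
      kap_of_right L (F := insL X F) fun I J hJ => h _ J hJ,
      kap_of_right L (F := insR X F) fun I J _ => by rw [insR, h _ _ (by simp), smul_zero]]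
    simp

theorem map_der (φ : W →ₗ[ℝ] W') (n : ℤ) (δ : Word gr → List (ℝ × Word gr)) :
    ∀ (L : Sentence gr) (f : Sentence gr → W), φ (der n δ L f) = der n δ L fun K => φ (f K)
  | [], f => map_zero φ
  | X :: L, f => by rw [der, der, map_add, map_smul, map_lc, map_der φ n δ L]

theorem map_ells {O : Ops V} (φ : W →ₗ[ℝ] W') :
    ∀ (L : Sentence O.gr) (f : Sentence O.gr → W), φ (ells O L f) = ells O L fun K => φ (f K)
  | [], f => map_zero φ
  | X :: L, f => by rw [ells, ells, map_add, map_smul, ad, ad, map_der, map_ells φ L]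

theorem der_eq_zero (n : ℤ) (δ : Word gr → List (ℝ × Word gr)) : ∀ (L : Sentence gr)
    {f : Sentence gr → W}, (∀ K, K.length = L.length → f K = 0) → der n δ L f = 0
  | [], f, h => rfl
  | X :: L, f, h => by
    rw [der, lc_congr (g := fun w => f (w :: L)) (g' := fun _ => 0) fun t _ => h _ (by simp),
      lc_zero, der_eq_zero n δ L fun K hK => h _ (by simp [hK]), smul_zero, add_zero]

theorem ad_eq_zero {O : Ops V} (X : Word O.gr) (L : Sentence O.gr) {f : Sentence O.gr → W}
    (h : ∀ K, K.length = L.length → f K = 0) : ad O X L f = 0 := der_eq_zero _ _ L h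

theorem ells_eq_zero {O : Ops V} : ∀ (L : Sentence O.gr)
    {f : Sentence O.gr → W}, (∀ K, K.length + 1 = L.length → f K = 0) → ells O L f = 0
  | [], f, h => rfl
  | X :: L, f, h => by
    rw [ells, ad_eq_zero X L fun K hK => h K (by simp [hK]),
      ells_eq_zero L fun K hK => h _ (by simp [hK]), smul_zero, add_zero]

/-- Only a word `a ⊗ b` of length two is mapped by `m` to a single letter, and only such a word is
cut into two letters. The two terms of the symmetrized cut agree by graded commutativity, hence the
factor `1/2`. -/
theorem lc_mul_cogenVal {O : Ops V} (P : O.Lift) : ∀ X : Word O.gr,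
    lc (mWord O X) (fun w => cogenVal [w]) =
      FC X (kapCut [] fun I J => (1 / 2 : ℝ) • P.mul (cogenVal I) (cogenVal J))
  | [] => by simp [mWord, FC, kapCut, cop₂, cop, insR, insL, cogenVal]
  | [a] => by simp [mWord, FC, kapCut, cop₂, cop, insR, insL, cogenVal]
  | [a, b] => by
    have h := P.mul_comm b a
    simp only [mWord, FC, kapCut, cop₂, cop, insR, insL, cogenVal, lc_cons, lc_nil, P.mul_eq,
      h, neg_one_zpow_eq_sg, List.map_nil, wordDeg_eq, lettersDeg_cons, lettersDeg_nil, map_zero,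
      LinearMap.zero_apply, smul_zero, sentenceDeg_nil, letterDeg, smul_smul]
    generalize a.1.1 = i, b.1.1 = j
    simp only [smul_add, smul_smul, smul_zero, sign_rules]
    module
  -- On longer words both sides vanish: `m` leaves at least two letters, and every cut has a piece
  -- whose length is not one.
  | a :: b :: c :: x => by
    rw [lc_congr (g' := fun _ => 0), lc_zero, FC_congr (F' := fun _ _ => 0), FC_zero]
    · intro u w huw
      have h2 : ∀ U Z : Word O.gr, (U.length ≠ 1 ∨ Z.length ≠ 1) →
          cop₂ U Z [] (fun I J => (1 / 2 : ℝ) • P.mul (cogenVal I) (cogenVal J)) = 0 := by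
        intro U Z h
        rcases h with h | h <;> simp [cop₂, cop, insR, insL, cogenVal_eq_zero' h]
      have hl := congrArg List.length huw
      simp only [List.length_append, List.length_cons] at hl
      rw [kapCut, h2 _ _ (by omega), h2 _ _ (by omega), smul_zero, add_zero, smul_zero]
    · intro t ht
      refine cogenVal_eq_zero' ?_
      have := (mWord_spec P.regular (a :: b :: c :: x) t ht).2
      simp only [List.length_cons] at this
      omega

/-- The projection of `m(L)` to the cogenerators. -/
theorem der_cogenVal {O : Ops V} (P : O.Lift) (L : Sentence O.gr) :
    der 1 (mWord O) L cogenVal =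
      kap L fun I J => (1 / 2 : ℝ) • P.mul (cogenVal I) (cogenVal J) := by
  by_cases hL : L.length = 1
  · obtain ⟨X, rfl⟩ := List.length_eq_one_iff.1 hL
    simp only [der, kap, smul_zero, add_zero]
    exact lc_mul_cogenVal P X
  · rw [der_eq_zero, kap_eq_zero]
    · intro I J hIJ
      by_cases hI : I.length = 1
      · rw [cogenVal_eq_zero (L := J) (by omega), map_zero, smul_zero]
      · rw [cogenVal_eq_zero hI, map_zero, LinearMap.zero_apply, smul_zero]
    · exact fun K hK => cogenVal_eq_zero (by omega)

/-- Both sides vanish unless `X` and `Y` are single letters, and then the two terms on the right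
agree by skew symmetry. The parity operator supplies the sign `(-1)^(deg X)` of `ℓ`, since the
degree of a one-letter word differs from that of its letter in `V` by two. -/
theorem lc_ell_cogenVal {O : Ops V} (P : O.Lift) (X Y : Word O.gr) :
    lc (ellWord O X Y) (fun w => cogenVal [w]) =
      (1 / 2 : ℝ) • (P.bracket (P.s (cogenVal [X])) (cogenVal [Y]) + sg (wordDeg X * wordDeg Y) •
        P.bracket (P.s (cogenVal [Y])) (cogenVal [X])) := by
  by_cases h : X.length = 1 ∧ Y.length = 1
  · obtain ⟨hX, hY⟩ := h
    obtain ⟨a, rfl⟩ := List.length_eq_one_iff.1 hX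
    obtain ⟨b, rfl⟩ := List.length_eq_one_iff.1 hY
    have h := P.bracket_skew b a
    simp only [lc_ellWord, BR_cons, SH_nil_left, SH_nil_right, BR_nil_left, BR_nil_right,
      cogenVal, P.bracket_eq,  P.s_eq _ _ a.2, P.s_eq _ _ b.2, map_smul, LinearMap.smul_apply,
      h, wordDeg_eq, lettersDeg_cons, lettersDeg_nil, letterDeg]
    generalize a.1.1 = i, b.1.1 = j
    simp only [smul_add, smul_smul, smul_neg, smul_zero, sign_rules]
    module
  · have h2 : X.length ≠ 1 ∨ Y.length ≠ 1 := by tauto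
    have e : lc (ellWord O X Y) (fun w => cogenVal [w]) = 0 := by
      rw [lc_ellWord, BR, lc_congr (g' := fun _ => 0), lc_zero, smul_zero]
      intro t ht
      refine cogenVal_eq_zero' ?_
      have h3 := (bracketWord_spec P.regular X Y t ht).2
      have : X ≠ [] := by rintro rfl; simp [bracketWord] at ht
      have := List.length_pos_of_ne_nil this
      have : Y ≠ [] := by rintro rfl; cases X <;> simp [bracketWord] at ht
      have := List.length_pos_of_ne_nil this
      omega
    rw [e]
    rcases h2 with h2 | h2 <;> simp [cogenVal_eq_zero' h2]

/-- The projection of `ℓ(L)` to the cogenerators. -/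
theorem ells_cogenVal {O : Ops V} (P : O.Lift) (L : Sentence O.gr) :
    ells O L cogenVal =
      cop L fun I J => (1 / 2 : ℝ) • P.bracket (P.s (cogenVal I)) (cogenVal J) := by
  have h0 : cogenVal ([] : Sentence O.gr) = 0 := rfl
  by_cases hL : L.length = 2
  · obtain ⟨X, Y, rfl⟩ := List.length_eq_two.1 hL
    simp only [ells, ad_cons, ad_nil, cop, insL, insR, lc_ell_cogenVal P, smul_zero, add_zero, h0,
      map_zero, LinearMap.zero_apply, zero_add, sentenceDeg_nil, sentenceDeg_cons, mul_zero,
      sg_zero, one_smul]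
    module
  · rw [ells_eq_zero, cop_eq_zero]
    · intro I J hIJ
      by_cases hI : I.length = 1
      · rw [cogenVal_eq_zero (L := J) (by omega), map_zero, smul_zero]
      · rw [cogenVal_eq_zero hI, map_zero, map_zero, LinearMap.zero_apply, smul_zero]
    · exact fun K hK => cogenVal_eq_zero (by omega)

end Cocommutativity

theorem sg_mul_two (n : ℤ) : sg (n * 2) = 1 := by rw [mul_two, sg_add, sg_mul_self]

theorem ad_cons_BR {V W : Type*} [AddCommGroup V] [Module ℝ V] [AddCommGroup W] [Module ℝ W]
    {O : Ops V} (X Y : Word O.gr) (L : Sentence O.gr) (f : Sentence O.gr → W) :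
    ad O X (Y :: L) f = sg (wordDeg X) • BR O X Y (fun w => f (w :: L)) +
      sg ((wordDeg X + 1) * wordDeg Y) • ad O X L (fun K => f (Y :: K)) := by
  rw [ad_cons, lc_ellWord]

section Coboundary

variable {G : Type*} [AddCommGroup G] [Module ℝ G] {A : GerstenhaberAlgebra G}
  {M : Type*} [AddCommGroup M] [Module ℝ M] (R : GerstenhaberModule A M)

/-! ### The operators `m` and `ℓ` of a Gerstenhaber algebra -/

variable {W W' : Type*} [AddCommGroup W] [Module ℝ W] [AddCommGroup W'] [Module ℝ W']

variable (A) in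
/-- The value of `g` on `m(X)`. -/
def mW (X : Word A.gr) (g : Word A.gr → W) : W := MW A.ops X g

variable (A) in
/-- The value of `f` on `m(L)`. -/
def mS (L : Sentence A.gr) (f : Sentence A.gr → W) : W := der 1 (mWord A.ops) L f

variable (A) in
/-- The value of `g` on `[X, Y]`. -/
def br (X Y : Word A.gr) (g : Word A.gr → W) : W := BR A.ops X Y g

variable (A) in
/-- The value of `f` on `∑ ± X₁ ⋯ ℓ(X, X_i) ⋯ X_n`. -/
def adS (X : Word A.gr) (L : Sentence A.gr) (f : Sentence A.gr → W) : W := ad A.ops X L f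

variable (A) in
/-- The value of `f` on `ℓ(L)`. -/
def ellS (L : Sentence A.gr) (f : Sentence A.gr → W) : W := ells A.ops L f

theorem mW_nil (g : Word A.gr → W) : mW A [] g = 0 := rfl

theorem mW_singleton (a : Letter A.gr) (g : Word A.gr → W) : mW A [a] g = 0 := rfl

theorem mS_nil (f : Sentence A.gr → W) : mS A [] f = 0 := rfl

theorem mS_cons (X : Word A.gr) (L : Sentence A.gr) (f : Sentence A.gr → W) :
    mS A (X :: L) f = mW A X (fun w => f (w :: L)) +
      sg (1 * wordDeg X) • mS A L fun K => f (X :: K) := rfl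

theorem adS_nil (X : Word A.gr) (f : Sentence A.gr → W) : adS A X [] f = 0 := rfl

theorem adS_cons (X Y : Word A.gr) (L : Sentence A.gr) (f : Sentence A.gr → W) :
    adS A X (Y :: L) f = sg (wordDeg X) • br A X Y (fun w => f (w :: L)) +
      sg ((wordDeg X + 1) * wordDeg Y) • adS A X L (fun K => f (Y :: K)) :=
  ad_cons_BR (O := A.ops) X Y L f

theorem ellS_nil (f : Sentence A.gr → W) : ellS A [] f = 0 := rfl

theorem ellS_cons (X : Word A.gr) (L : Sentence A.gr) (f : Sentence A.gr → W) :
    ellS A (X :: L) f = adS A X L f + sg (wordDeg X) • ellS A L fun K => f (X :: K) := rfl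

/-! ### The coboundary operators on functions of sentences -/

/-- The function paired with the cobracket in `d_m`. -/
def mulPair (d : ℤ) (f : Sentence A.gr → M) (I J : Sentence A.gr) : M :=
  sg (sentenceDeg J * (sentenceDeg I + d)) • R.smul (cogenVal J) (f I)

/-- The function paired with the coproduct in `d_ℓ`. -/
def actPair (d : ℤ) (f : Sentence A.gr → M) (I J : Sentence A.gr) : M :=
  sg (sentenceDeg J * (sentenceDeg I + d) + sentenceDeg J) • R.act (cogenVal J) (f I)

/-- The operator `d_m`. -/
def dM (d : ℤ) (f : Sentence A.gr → M) (L : Sentence A.gr) : M :=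
  sg d • (kap L (mulPair R d f) - mS A L f)

/-- The operator `d_ℓ`. -/
def dL (d : ℤ) (f : Sentence A.gr → M) (L : Sentence A.gr) : M :=
  cop L (actPair R d f) - sg d • ellS A L f

/-- The term with the first letter in the Hochschild coboundary. -/
def leftTerm (d : ℤ) : Word A.gr → (Word A.gr → M) → M
  | [], _ => 0
  | a :: x, g => sg (letterDeg a * d + letterDeg a) • R.smul a.1.2 (g x)

/-- The term with the last letter in the Hochschild coboundary. -/
def rightTerm (d : ℤ) : Word A.gr → (Word A.gr → M) → M
  | [], _ => 0
  | a :: x, g =>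
    -(sg (letterDeg ((a :: x).getLast (List.cons_ne_nil _ _)) * (wordDeg (a :: x).dropLast + d)) •
      R.smul ((a :: x).getLast (List.cons_ne_nil _ _)).1.2 (g (a :: x).dropLast))

/-- The Hochschild coboundary of a function of words. -/
def hoch (d : ℤ) (X : Word A.gr) (g : Word A.gr → M) : M :=
  leftTerm R d X g + rightTerm R d X g - sg d • mW A X g

theorem rightTerm_snoc (d : ℤ) (x : Word A.gr) (z : Letter A.gr) (g : Word A.gr → M) :
    rightTerm R d (x ++ [z]) g =
      -(sg (letterDeg z * (wordDeg x + d)) • R.smul z.1.2 (g x)) := by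
  have h : ∀ (X : Word A.gr) (hX : X ≠ []), rightTerm R d X g =
      -(sg (letterDeg (X.getLast hX) * (wordDeg X.dropLast + d)) •
        R.smul (X.getLast hX).1.2 (g X.dropLast)) := by
    intro X hX
    cases X with
    | nil => exact absurd rfl hX
    | cons a x => rfl
  rw [h _ (by simp)]
  simp

theorem mulPair_eq_zero (d : ℤ) (f : Sentence A.gr → M) (I : Sentence A.gr) {J : Sentence A.gr}
    (hJ : J.length ≠ 1) : mulPair R d f I J = 0 := by
  rw [mulPair, cogenVal_eq_zero hJ, map_zero, LinearMap.zero_apply, smul_zero]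

theorem actPair_eq_zero (d : ℤ) (f : Sentence A.gr → M) (I : Sentence A.gr) {J : Sentence A.gr}
    (hJ : J.length ≠ 1) : actPair R d f I J = 0 := by
  rw [actPair, cogenVal_eq_zero hJ, map_zero, LinearMap.zero_apply, smul_zero]

/-- Fixing the first word `X` turns a cochain of degree `d` into one of degree `d + deg X`. This
shift is what makes the coboundary computable by recursion on words. -/
theorem insL_mulPair (X : Word A.gr) (d : ℤ) (f : Sentence A.gr → M) :
    insL X (mulPair R d f) = mulPair R (d + wordDeg X) fun L => f (X :: L) := by
  funext I J
  simp only [insL, mulPair, sentenceDeg_cons]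
  congr 3
  ring

theorem insL_actPair (X : Word A.gr) (d : ℤ) (f : Sentence A.gr → M) :
    insL X (actPair R d f) = actPair R (d + wordDeg X) fun L => f (X :: L) := by
  funext I J
  simp only [insL, actPair, sentenceDeg_cons]
  congr 3
  ring

theorem cop₂_mulPair (U Z : Word A.gr) (L : Sentence A.gr) (d : ℤ) (f : Sentence A.gr → M) :
    cop₂ U Z L (mulPair R d f) =
      sg (wordDeg Z * (wordDeg U + d)) • R.smul (cogenVal [Z]) (f (U :: L)) := by
  rw [cop₂, cop_of_right]
  · simp only [insR, insL, mulPair, sentenceDeg_cons, sentenceDeg_nil, smul_smul, sign_rules]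
  · intro I J hJ
    rw [insR, insL, mulPair_eq_zero, smul_zero]
    simpa using hJ

theorem FC_of_left_letter (a : Letter A.gr)
    (x : Word A.gr) {F : Word A.gr → Word A.gr → W} (h : ∀ U Z, U.length ≠ 1 → F U Z = 0) :
    FC (a :: x) F = F [a] x := by
  rw [FC, h [] _ (by simp), zero_add]
  exact FC_eq_of_left x fun u w hu _ => h _ _ (by simpa using hu)

theorem FC_of_right_letter (z : Letter A.gr) :
    ∀ (x : Word A.gr) {F : Word A.gr → Word A.gr → W}, (∀ U Z, Z.length ≠ 1 → F U Z = 0) →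
    FC (x ++ [z]) F = F x [z]
  | [], F, h => by simp [FC, h [z] [] (by simp)]
  | a :: x, F, h => by
    rw [List.cons_append, FC, h [] _ (by simp), zero_add,
      FC_of_right_letter z x fun U Z hZ => h _ Z hZ]

/-- The pairing requires one piece of the cut to be a single letter. So only the cut after the first
letter, through the exchanged term, and the cut before the last letter survive: these are the two
outer terms of the Hochschild coboundary. -/
theorem FC_kapCut_mulPair (X : Word A.gr) (L : Sentence A.gr) (d : ℤ) (f : Sentence A.gr → M) :
    sg d • FC X (kapCut L (mulPair R d f)) =
      leftTerm R d X (fun W => f (W :: L)) + rightTerm R d X (fun W => f (W :: L)) := by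
  have e : kapCut L (mulPair R d f) =
      fun U Z => sg (wordDeg U + 1 + wordDeg U * d) • R.smul (cogenVal [U]) (f (Z :: L)) +
        sg (wordDeg U + 1 + wordDeg Z * (wordDeg U + d)) •
          R.smul (cogenVal [Z]) (f (U :: L)) := by
    funext U Z
    simp only [kapCut, cop₂_mulPair, smul_add, smul_smul, sign_rules]
    module
  rw [e, FC_add, smul_add]
  congr 1
  · cases X with
    | nil => simp [FC, leftTerm, cogenVal]
    | cons a x =>
      rw [FC_of_left_letter a x fun U Z hU => by
        rw [cogenVal_eq_zero' hU, map_zero, LinearMap.zero_apply, smul_zero]]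
      simp only [leftTerm, cogenVal, wordDeg_eq, lettersDeg_cons, lettersDeg_nil, smul_smul,
        sign_rules]
  · rcases List.eq_nil_or_concat' X with rfl | ⟨x, z, rfl⟩
    · simp [FC, rightTerm, cogenVal]
    · rw [FC_of_right_letter z x fun U Z hZ => by
        rw [cogenVal_eq_zero' hZ, map_zero, LinearMap.zero_apply, smul_zero], rightTerm_snoc]
      simp only [cogenVal, wordDeg_eq, lettersDeg_cons, lettersDeg_nil, smul_smul, sign_rules]
      module

/-- If `X` goes uncut into the second factor, that factor contains a piece of a cut word besides
`X`, so it is not a single letter and the term vanishes. The terms left are those that change `X`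
and those that change `L` with `X` fixed. -/
theorem dM_cons (d : ℤ) (f : Sentence A.gr → M) (X : Word A.gr) (L : Sentence A.gr) :
    dM R d f (X :: L) = hoch R d X (fun W => f (W :: L)) +
      dM R (d + wordDeg X) (fun K => f (X :: K)) L := by
  have h : kap L (insR X (mulPair R d f)) = 0 := kap_of_right L fun I J hJ => by
    rw [insR, mulPair_eq_zero, smul_zero]
    simpa using hJ
  have h2 := FC_kapCut_mulPair R X L d f
  rw [dM, dM, kap, mS_cons, h, hoch, ← h2, insL_mulPair]
  simp only [smul_add, smul_sub, smul_smul, add_zero, sign_rules]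
  module

theorem ellAct_eq (X : Word A.gr) (v : M) :
    ellAct R X v = sg (wordDeg X) • R.act (cogenVal [X]) v := by
  unfold ellAct
  split
  · rfl
  · rename_i h
    rw [cogenVal_eq_zero', map_zero, LinearMap.zero_apply, smul_zero]
    intro hl
    obtain ⟨a, rfl⟩ := List.length_eq_one_iff.1 hl
    exact h a rfl

/-- The function `ellAct R X` as a linear map. -/
def actLin (X : Word A.gr) : M →ₗ[ℝ] M := sg (wordDeg X) • R.act (cogenVal [X])

theorem actLin_apply (X : Word A.gr) (v : M) : actLin R X v = ellAct R X v := (ellAct_eq R X v).symm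

/-- If `X` goes to the second factor, all other words must stay in the first. This single term is
the action of `X`. -/
theorem dL_cons (d : ℤ) (f : Sentence A.gr → M) (X : Word A.gr) (L : Sentence A.gr) :
    dL R d f (X :: L) = sg (d * wordDeg X) • actLin R X (f L) - sg d • adS A X L f +
      dL R (d + wordDeg X) (fun K => f (X :: K)) L := by
  have h : cop L (insR X (actPair R d f)) = insR X (actPair R d f) L [] :=
    cop_of_right L fun I J hJ => by
      rw [insR, actPair_eq_zero, smul_zero]
      simpa using hJ
  rw [dL, dL, cop, ellS_cons, h, insL_actPair, insR, actPair, actLin]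
  simp only [sentenceDeg_cons, sentenceDeg_nil, LinearMap.smul_apply]
  simp only [smul_add, smul_sub, smul_smul, add_zero, sign_rules]
  module

theorem cop_actPair : ∀ (L : Sentence A.gr) (d : ℤ) (f : Sentence A.gr → M),
    cop L (actPair R d f) = lc (picks wordDeg L) fun t =>
      sg (d * wordDeg t.1) • ellAct R t.1 (f t.2)
  | [], d, f => actPair_eq_zero R d f [] (by simp)
  | X :: L, d, f => by
    have h : cop L (insR X (actPair R d f)) = insR X (actPair R d f) L [] :=
      cop_of_right L fun I J hJ => by
        rw [insR, actPair_eq_zero, smul_zero]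
        simpa using hJ
    rw [cop, h, insL_actPair, cop_actPair L, lc_picks_cons, add_comm]
    congr 1
    · rw [insR, actPair, ellAct_eq]
      simp only [sentenceDeg_cons, sentenceDeg_nil, smul_smul, sign_rules]
    · refine lc_congr fun t _ => ?_
      simp only [smul_smul, sign_rules]

theorem Good.mulPair (d : ℤ) {f : Sentence A.gr → M} (hf : Good f) :
    BiGood (ChevalleyHarrison.mulPair R d f) where
  left J := by
    have := ((hf.comp (R.smul (cogenVal J))).smul_sg (sentenceDeg J)).smul
      (sg (sentenceDeg J * d))
    convert this using 2 with I
    simp only [ChevalleyHarrison.mulPair, smul_smul, sign_rules]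
  right I := by
    have := ((cogenVal_good (gr := A.gr)).comp (R.smul.flip (f I))).smul_sg (sentenceDeg I + d)
    convert this using 2 with J
    rw [ChevalleyHarrison.mulPair, mul_comm]
    rfl

theorem Good.actPair (d : ℤ) {f : Sentence A.gr → M} (hf : Good f) :
    BiGood (ChevalleyHarrison.actPair R d f) where
  left J := by
    have := ((hf.comp (R.act (cogenVal J))).smul_sg (sentenceDeg J)).smul
      (sg (sentenceDeg J * d + sentenceDeg J))
    convert this using 2 with I
    simp only [ChevalleyHarrison.actPair, smul_smul, sign_rules]
  right I := by
    have := ((cogenVal_good (gr := A.gr)).comp (R.act.flip (f I))).smul_sg (sentenceDeg I + d + 1)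
    convert this using 2 with J
    rw [ChevalleyHarrison.actPair, mul_comm (_ + _ + _), mul_add _ _ (1 : ℤ), mul_one]
    rfl

theorem Good.dM (d : ℤ) {f : Sentence A.gr → M} (hf : Good f) :
    Good fun L => ChevalleyHarrison.dM R d f L := by
  have := ((hf.mulPair R d).kap.add ((hf.m A.lift.regular).smul (-1))).smul (sg d)
  convert this using 2 with L
  rw [ChevalleyHarrison.dM, neg_one_smul, ← sub_eq_add_neg]
  rfl

theorem Good.dL (d : ℤ) {f : Sentence A.gr → M} (hf : Good f) :
    Good fun L => ChevalleyHarrison.dL R d f L := by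
  have := (hf.actPair R d).cop.add ((hf.ells A.lift.regular).smul (-sg d))
  convert this using 2 with L
  rw [ChevalleyHarrison.dL, neg_smul, ← sub_eq_add_neg]
  rfl

/-! ### Comparison with the explicit formulas -/

theorem dM_eq_sum : ∀ (L : Sentence A.gr) (d : ℤ) (f : Sentence A.gr → M),
    dM R d f L = ∑ k : Fin L.length, hoch R (d + sentenceDeg (L.take k)) (L.get k)
      fun W => f (L.take k ++ W :: L.drop (k + 1))
  | [], d, f => by simp [dM, kap, mS_nil]
  | X :: L, d, f => by
    rw [dM_cons, dM_eq_sum L]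
    simp only [List.length_cons, Fin.sum_univ_succ]
    simp [add_assoc]

theorem dmTerm_eq (d : ℤ) (c : Space A.gr →ₗ[ℝ] M) (L₁ L₂ : Sentence A.gr) :
    ∀ X : Word A.gr, dmTerm R d c L₁ L₂ X =
      hoch R (d + sentenceDeg L₁) X fun W => c (mk (L₁ ++ W :: L₂))
  | [] => by
    simp [dmTerm, hoch, leftTerm, rightTerm, mW_nil]
  | [a] => by
    -- For a one-letter word, removing the first or last letter leaves an empty word, so the outer
    -- terms of `hoch` vanish as `dmTerm` prescribes.
    have h : mk (L₁ ++ [] :: L₂) = 0 := (mk_good.word L₁ L₂).nil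
    simp [dmTerm, hoch, leftTerm, rightTerm, h, mW_singleton]
  | a :: b :: w => by
    rw [dmTerm, hoch, leftTerm, rightTerm, neg_one_zpow_eq_sg]
    refine congrArg₂ (· - ·) (congrArg₂ (· + ·) ?_ ?_) rfl
    · simp only [mLeft, neg_one_zpow_eq_sg, smul_smul, sign_rules]
    · simp only [mRight, neg_one_zpow_eq_sg]
      generalize (a :: b :: w).getLast _ = z
      have : z.1.1 = letterDeg z + 1 := by rw [letterDeg, sub_add_cancel]
      rw [this]
      simp only [sentenceDeg_append, sentenceDeg_cons]
      generalize letterDeg z = z', wordDeg (a :: b :: w).dropLast = w',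
        sentenceDeg L₁ = l₁, sentenceDeg L₂ = l₂
      simp only [smul_smul, sign_rules, sg_mul_two]
      module

theorem dmFormula_eq (d : ℤ) (c : Space A.gr →ₗ[ℝ] M) (L : Sentence A.gr) :
    dmFormula R d c L = dM R d (fun K => c (mk K)) L := by
  rw [dmFormula, dM_eq_sum]
  exact Finset.sum_congr rfl fun k _ => dmTerm_eq R d c _ _ _

theorem dellFormula_eq (d : ℤ) (c : Space A.gr →ₗ[ℝ] M) (L : Sentence A.gr) :
    dellFormula R d c L = dL R d (fun K => c (mk K)) L := by
  rw [dL, ellS, cop_actPair, ← lc_pickPairs_ells A.lift.regular L (mk_good.comp c).swap, dellFormula]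
  congr 1
  rw [lc]
  congr 1
  exact List.map_congr_left fun t _ => by rw [smul_smul, neg_one_zpow_eq_sg]

end Coboundary

section Ops

variable {V W : Type*} [AddCommGroup V] [Module ℝ V] [AddCommGroup W] [Module ℝ W] {O : Ops V}

/-- All words of `m(X)` have degree `deg X + 1`, so the degree may be frozen wherever it enters a
sign or the degree of an operator. -/
theorem MW_deg (hO : O.Regular) (X : Word O.gr) (F : ℤ → Word O.gr → W) :
    MW O X (fun w => F (wordDeg w) w) = MW O X (F (wordDeg X + 1)) :=
  lc_congr fun t ht => by rw [mWord_deg hO X t ht]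

theorem BR_deg (hO : O.Regular) (X Y : Word O.gr) (F : ℤ → Word O.gr → W) :
    BR O X Y (fun w => F (wordDeg w) w) = BR O X Y (F (wordDeg X + wordDeg Y + 1)) :=
  lc_congr fun t ht => by
    rw [wordDeg_eq t.2, (bracketWord_spec hO X Y t ht).1, wordDeg_eq, wordDeg_eq]
    congr 1
    ring

theorem MW_comm (X Y : Word O.gr) (F : Word O.gr → Word O.gr → W) :
    MW O Y (fun w => MW O X fun v => F v w) = MW O X fun v => MW O Y (F v) :=
  lc_comm _ _ _

theorem MW_eq_zero (hO : O.Regular) (X : Word O.gr) {g : Word O.gr → W}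
    (h : ∀ w : Word O.gr, w.length + 1 = X.length → g w = 0) : MW O X g = 0 := by
  rw [MW, lc_congr (g' := fun _ => 0), lc_zero]
  exact fun t ht => h _ (mWord_spec hO X t ht).2.1

theorem BR_eq_zero (hO : O.Regular) (X Y : Word O.gr) {g : Word O.gr → W}
    (h : ∀ w : Word O.gr, w.length + 1 = X.length + Y.length → g w = 0) : BR O X Y g = 0 := by
  rw [BR, lc_congr (g' := fun _ => 0), lc_zero]
  exact fun t ht => h _ (bracketWord_spec hO X Y t ht).2.1

end Ops

/-! ### The word operators of a Gerstenhaber algebra -/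

section WordOperators

variable {G : Type*} [AddCommGroup G] [Module ℝ G] {A : GerstenhaberAlgebra G}
  {W W' : Type*} [AddCommGroup W] [Module ℝ W] [AddCommGroup W'] [Module ℝ W']

variable (A) in
/-- The product of two letters. -/
def mulL (a b : Letter A.gr) : Letter A.gr := A.ops.mul a b

variable (A) in
/-- The bracket of two letters. -/
def brL (a b : Letter A.gr) : Letter A.gr := A.ops.bracket a b

theorem mulL_val (a b : Letter A.gr) : (mulL A a b).1.2 = A.mul a.1.2 b.1.2 := rfl

theorem brL_val (a b : Letter A.gr) : (brL A a b).1.2 = A.bracket a.1.2 b.1.2 := rfl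

theorem letterDeg_mulL (a b : Letter A.gr) :
    letterDeg (mulL A a b) = letterDeg a + letterDeg b + 1 := A.lift.regular.mul_deg a b

theorem letterDeg_brL (a b : Letter A.gr) :
    letterDeg (brL A a b) = letterDeg a + letterDeg b := A.lift.regular.bracket_deg a b

theorem mW_cons_cons (a b : Letter A.gr) (x : Word A.gr) (g : Word A.gr → W) :
    mW A (a :: b :: x) g = sg (letterDeg a) • g (mulL A a b :: x) +
      sg (letterDeg a) • mW A (b :: x) fun w => g (a :: w) := MW_cons (O := A.ops) a (b :: x) g

theorem mW_snoc (y z : Letter A.gr) (x : Word A.gr) (g : Word A.gr → W) :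
    mW A (x ++ [y, z]) g = mW A (x ++ [y]) (fun w => g (w ++ [z]))
      + sg (lettersDeg x + letterDeg y) • g (x ++ [mulL A y z]) := MW_snoc (O := A.ops) y z x g

theorem br_nil_left (Y : Word A.gr) (g : Word A.gr → W) : br A [] Y g = 0 :=
  BR_nil_left (O := A.ops) Y g

theorem br_nil_right (X : Word A.gr) (g : Word A.gr → W) : br A X [] g = 0 :=
  BR_nil_right (O := A.ops) X g

theorem br_cons (a b : Letter A.gr) (x y : Word A.gr) (g : Word A.gr → W) :
    br A (a :: x) (b :: y) g =
      sg (letterDeg b * lettersDeg x) • SH x y (fun w => g (brL A a b :: w))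
      + br A x (b :: y) (fun w => g (a :: w))
      + sg (letterDeg b * (letterDeg a + lettersDeg x)) •
        br A (a :: x) y (fun w => g (b :: w)) := BR_cons (O := A.ops) a b x y g

theorem br_snoc (a b : Letter A.gr) (x y : Word A.gr) (g : Word A.gr → W) :
    br A (x ++ [a]) (y ++ [b]) g =
      sg (letterDeg a * lettersDeg y) • SH x y (fun w => g (w ++ [brL A a b]))
      + sg (letterDeg a * (lettersDeg y + letterDeg b)) • br A x (y ++ [b]) (fun w => g (w ++ [a]))
      + br A (x ++ [a]) y (fun w => g (w ++ [b])) := BR_snoc (O := A.ops) a b x y g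

theorem mW_linear (X : Word A.gr) : IsLinearMap ℝ (mW (W := W) A X) :=
  ⟨fun _ _ => lc_add _ _ _, fun _ _ => lc_smul _ _ _⟩

theorem mW_sub (X : Word A.gr) (g h : Word A.gr → W) :
    mW A X (fun w => g w - h w) = mW A X g - mW A X h := lc_sub _ _ _

theorem mW_smul (X : Word A.gr) (r : ℝ) (g : Word A.gr → W) :
    mW A X (fun w => r • g w) = r • mW A X g := lc_smul _ _ _

theorem map_mW (φ : W →ₗ[ℝ] W') (X : Word A.gr) (g : Word A.gr → W) :
    mW A X (fun w => φ (g w)) = φ (mW A X g) := (map_lc φ _ g).symm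

theorem br_add (X Y : Word A.gr) (g h : Word A.gr → W) :
    br A X Y (fun w => g w + h w) = br A X Y g + br A X Y h := lc_add _ _ _

theorem br_sub (X Y : Word A.gr) (g h : Word A.gr → W) :
    br A X Y (fun w => g w - h w) = br A X Y g - br A X Y h := lc_sub _ _ _

theorem br_smul (X Y : Word A.gr) (r : ℝ) (g : Word A.gr → W) :
    br A X Y (fun w => r • g w) = r • br A X Y g := lc_smul _ _ _

theorem map_br (φ : W →ₗ[ℝ] W') (X Y : Word A.gr) (g : Word A.gr → W) :
    br A X Y (fun w => φ (g w)) = φ (br A X Y g) := (map_lc φ _ g).symm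

theorem mW_deg (X : Word A.gr) (F : ℤ → Word A.gr → W) :
    mW A X (fun w => F (wordDeg w) w) = mW A X (F (wordDeg X + 1)) :=
  MW_deg (O := A.ops) A.lift.regular X F

theorem br_deg (X Y : Word A.gr) (F : ℤ → Word A.gr → W) :
    br A X Y (fun w => F (wordDeg w) w) = br A X Y (F (wordDeg X + wordDeg Y + 1)) :=
  BR_deg (O := A.ops) A.lift.regular X Y F

theorem mW_eq_zero (X : Word A.gr) {g : Word A.gr → W}
    (h : ∀ w : Word A.gr, w.length + 1 = X.length → g w = 0) : mW A X g = 0 :=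
  MW_eq_zero (O := A.ops) A.lift.regular X h

theorem br_eq_zero (X Y : Word A.gr) {g : Word A.gr → W}
    (h : ∀ w : Word A.gr, w.length + 1 = X.length + Y.length → g w = 0) : br A X Y g = 0 :=
  BR_eq_zero (O := A.ops) A.lift.regular X Y h

theorem br_skew (X Y : Word A.gr) {g : Word A.gr → W} (hg : LLin g) :
    br A X Y g = -sg ((wordDeg X + 1) * (wordDeg Y + 1)) • br A Y X g := by
  rw [wordDeg_eq, wordDeg_eq, sub_add_cancel, sub_add_cancel]
  exact BR_skew (O := A.ops) A.lift.regular X Y hg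

theorem br_jacobi (X Y Z : Word A.gr) {g : Word A.gr → W} (hg : LLin g) :
    sg (lettersDeg X * lettersDeg Z) • br A X Y (fun w => br A w Z g)
      + sg (lettersDeg Y * lettersDeg X) • br A Y Z (fun w => br A w X g)
      + sg (lettersDeg Z * lettersDeg Y) • br A Z X (fun w => br A w Y g) = 0 :=
  BR_jacobi (O := A.ops) A.ops_gerstenhaber X Y Z hg

theorem br_mW (X Y : Word A.gr) {g : Word A.gr → W} (hg : LLin g) :
    br A X Y (fun w => mW A w g) = mW A X (fun w => br A w Y g)
      + sg (lettersDeg X) • mW A Y (fun w => br A X w g) :=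
  BR_MW (O := A.ops) A.ops_gerstenhaber X Y hg

theorem mW_mW (X : Word A.gr) {g : Word A.gr → W} (hg : LLin g) :
    mW A X (fun w => mW A w g) = 0 := MW_MW (O := A.ops) A.ops_gerstenhaber X hg

theorem mW_comm (X Y : Word A.gr) (F : Word A.gr → Word A.gr → W) :
    mW A Y (fun w => mW A X fun v => F v w) = mW A X fun v => mW A Y (F v) :=
  MW_comm (O := A.ops) X Y F

end WordOperators

/-! ### The Hochschild coboundary of one word -/

section Hochschild

variable {G : Type*} [AddCommGroup G] [Module ℝ G] {A : GerstenhaberAlgebra G}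
  {M : Type*} [AddCommGroup M] [Module ℝ M] (R : GerstenhaberModule A M)

theorem smul_smul_comm (a b : Letter A.gr) (v : M) : R.smul a.1.2 (R.smul b.1.2 v) =
    sg ((letterDeg a + 1) * (letterDeg b + 1)) • R.smul b.1.2 (R.smul a.1.2 v) := by
  rw [← R.mul_smul, ← R.mul_smul, A.mul_comm a.2 b.2, map_smul, LinearMap.smul_apply, letterDeg,
    letterDeg, sub_add_cancel, sub_add_cancel]
  rfl

theorem smul_brL (a b : Letter A.gr) (v : M) : R.smul (brL A a b).1.2 v =
    R.act a.1.2 (R.smul b.1.2 v) -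
      sg ((letterDeg b + 1) * letterDeg a) • R.smul b.1.2 (R.act a.1.2 v) := by
  rw [brL_val, R.bracket_smul v a.2 b.2, letterDeg, letterDeg, sub_add_cancel]
  rfl

/-- The compatibility of the two actions is read here for `[b, a]`. Which of the two versions
applies depends on which of two words is a single letter and therefore acts. -/
theorem smul_brL' (a b : Letter A.gr) (v : M) : R.smul (brL A a b).1.2 v =
    -sg (letterDeg a * letterDeg b) • (R.act b.1.2 (R.smul a.1.2 v) -
      sg ((letterDeg a + 1) * letterDeg b) • R.smul a.1.2 (R.act b.1.2 v)) := by
  rw [← smul_brL R b a v, brL_val, brL_val, A.bracket_skew a.2 b.2, map_neg, map_smul, neg_smul]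
  rfl

theorem act_brL (a b : Letter A.gr) (v : M) : R.act (brL A a b).1.2 v =
    R.act a.1.2 (R.act b.1.2 v) - sg (letterDeg a * letterDeg b) • R.act b.1.2 (R.act a.1.2 v) :=
  R.bracket_act v a.2 b.2

theorem act_mulL (a b : Letter A.gr) (v : M) : R.act (mulL A a b).1.2 v =
    R.smul a.1.2 (R.act b.1.2 v) +
      sg ((letterDeg a + 1) * (letterDeg b + 1)) • R.smul b.1.2 (R.act a.1.2 v) := by
  rw [mulL_val, R.mul_act v a.2 b.2, letterDeg, letterDeg, sub_add_cancel, sub_add_cancel]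
  rfl

theorem smul_mulL (a b : Letter A.gr) (v : M) :
    R.smul (mulL A a b).1.2 v = R.smul a.1.2 (R.smul b.1.2 v) := R.mul_smul _ _ v

theorem actLin_eq_zero {X : Word A.gr} (h : X.length ≠ 1) : actLin R X = 0 := by
  rw [actLin, cogenVal_eq_zero' h, map_zero, smul_zero]

theorem actLin_singleton (a : Letter A.gr) (v : M) :
    actLin R [a] v = sg (letterDeg a - 1) • R.act a.1.2 v := by
  rw [actLin, wordDeg_eq, lettersDeg_cons, lettersDeg_nil, add_zero]
  rfl

theorem leftTerm_linear (d : ℤ) (X : Word A.gr) : IsLinearMap ℝ (leftTerm R d X) := by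
  cases X with
  | nil => exact ⟨fun _ _ => (add_zero _).symm, fun _ _ => (smul_zero _).symm⟩
  | cons a x =>
    refine ⟨fun g h => ?_, fun r g => ?_⟩
    · simp only [leftTerm, Pi.add_apply, map_add, smul_add]
    · simp only [leftTerm, Pi.smul_apply, map_smul, smul_comm r]

theorem rightTerm_linear (d : ℤ) (X : Word A.gr) : IsLinearMap ℝ (rightTerm R d X) := by
  rcases List.eq_nil_or_concat' X with rfl | ⟨x, z, rfl⟩
  · exact ⟨fun _ _ => (add_zero _).symm, fun _ _ => (smul_zero _).symm⟩
  · refine ⟨fun g h => ?_, fun r g => ?_⟩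
    · simp only [rightTerm_snoc, Pi.add_apply, map_add, smul_add, neg_add]
    · simp only [rightTerm_snoc, Pi.smul_apply, map_smul, smul_comm r, smul_neg]

theorem hoch_linear (d : ℤ) (X : Word A.gr) : IsLinearMap ℝ (hoch R d X) := by
  refine ⟨fun g h => ?_, fun r g => ?_⟩
  · simp only [hoch, (leftTerm_linear R d X).map_add, (rightTerm_linear R d X).map_add,
      (mW_linear X).map_add]
    module
  · simp only [hoch, (leftTerm_linear R d X).map_smul, (rightTerm_linear R d X).map_smul,
      (mW_linear X).map_smul]
    module

theorem hoch_nil (d : ℤ) (g : Word A.gr → M) : hoch R d [] g = 0 := by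
  simp [hoch, leftTerm, rightTerm, mW_nil]

/-- Writing the word with its first and with its last letter at once treats words of length one and
longer words uniformly. -/
theorem hoch_eq (d : ℤ) {X x x' : Word A.gr} {a z : Letter A.gr} (h : X = a :: x)
    (h' : X = x' ++ [z]) (g : Word A.gr → M) : hoch R d X g =
      sg (letterDeg a * d + letterDeg a) • R.smul a.1.2 (g x) -
      sg (letterDeg z * (wordDeg x' + d)) • R.smul z.1.2 (g x') - sg d • mW A X g := by
  rw [hoch, h', rightTerm_snoc, ← h', h, leftTerm, ← sub_eq_add_neg]

theorem exists_decomposition {X : Word A.gr} (hX : X ≠ []) :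
    ∃ a x x' z, X = a :: x ∧ X = x' ++ [z] := by
  obtain ⟨a, x, h⟩ := List.exists_cons_of_ne_nil hX
  rcases List.eq_nil_or_concat' X with h' | ⟨x', z, h'⟩
  · exact absurd h' hX
  · exact ⟨a, x, x', z, h, h'⟩

/-- Removing a letter `a` lowers the word degree by `deg a`, and `m` raises it by one. The signs so
produced are those that change the degree of the cochain from `d` to `d + p`. -/
theorem hoch_sg (d p : ℤ) (X : Word A.gr) (g : Word A.gr → M) :
    hoch R d X (fun w => sg (wordDeg w * p) • g w) =
      sg (wordDeg X * p) • hoch R (d + p) X g := by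
  by_cases hX : X = []
  · rw [hX, hoch_nil, hoch_nil, smul_zero]
  obtain ⟨a, x, x', z, h, h'⟩ := exists_decomposition hX
  have e : wordDeg x = wordDeg X - letterDeg a := by
    rw [h, wordDeg_eq, wordDeg_eq, lettersDeg_cons]; ring
  have e' : wordDeg x' = wordDeg X - letterDeg z := by
    rw [h', wordDeg_eq, wordDeg_eq, lettersDeg_append, lettersDeg_cons, lettersDeg_nil]; ring
  rw [hoch_eq R d h h', hoch_eq R _ h h', mW_deg X fun n w => sg (n * p) • g w, mW_smul, e, e']
  simp only [map_smul, smul_sub, smul_smul, sign_rules]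

/-! ### The square of the Hochschild coboundary -/

/-- Two successive left multiplications amount to one by the product of the first two letters. All
other terms pair off because left multiplication commutes with products further inside the word. -/
theorem leftTerm_leftTerm (d : ℤ) (X : Word A.gr) (g : Word A.gr → M) :
    leftTerm R (d + 1) X (fun w => leftTerm R d w g)
      - sg (d + 1) • mW A X (fun w => leftTerm R d w g)
      - sg d • leftTerm R (d + 1) X (fun w => mW A w g) = 0 := by
  rcases X with _ | ⟨a, _ | ⟨b, x⟩⟩
  · simp [leftTerm, mW_nil]
  · simp [leftTerm, mW_nil, mW_singleton]
  · simp only [leftTerm, mW_cons_cons, letterDeg_mulL, smul_mulL, mW_smul, map_mW, map_smul]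
    simp only [smul_add, smul_sub, smul_smul, smul_zero, sign_rules]
    module

/-- This mirrors `leftTerm_leftTerm`. The module action is a left one, so the commutation of two
letters is needed to recognize the product of the last two. -/
theorem rightTerm_rightTerm (d : ℤ) (X : Word A.gr) (g : Word A.gr → M) :
    rightTerm R (d + 1) X (fun w => rightTerm R d w g)
      - sg (d + 1) • mW A X (fun w => rightTerm R d w g)
      - sg d • rightTerm R (d + 1) X (fun w => mW A w g) = 0 := by
  rcases List.eq_nil_or_concat' X with rfl | ⟨X, z, rfl⟩
  · simp [rightTerm, mW_nil]
  rcases List.eq_nil_or_concat' X with rfl | ⟨x, y, rfl⟩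
  · simp [rightTerm, mW_nil, mW_singleton]
  · have h := smul_smul_comm R z y
    simp only [rightTerm_snoc]
    rw [List.append_assoc, List.singleton_append, mW_snoc]
    simp only [rightTerm_snoc]
    rw [mW_deg (x ++ [y]) fun n w => -(sg (letterDeg z * (n + d)) • R.smul z.1.2 (g w))]
    simp only [rightTerm_snoc, letterDeg_mulL, smul_mulL, ← neg_smul, mW_smul, map_mW, map_smul,
      wordDeg_eq, lettersDeg_append, lettersDeg_cons, lettersDeg_nil, h]
    simp only [neg_smul, smul_add, smul_sub, smul_neg, smul_smul, smul_zero, sign_rules]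
    module

theorem leftTerm_rightTerm (d : ℤ) (X : Word A.gr) (g : Word A.gr → M) :
    leftTerm R (d + 1) X (fun w => rightTerm R d w g)
      + rightTerm R (d + 1) X (fun w => leftTerm R d w g) = 0 := by
  rcases X with _ | ⟨a, X⟩
  · simp [leftTerm, rightTerm]
  rcases List.eq_nil_or_concat' X with rfl | ⟨x, z, rfl⟩
  · simp [leftTerm, rightTerm]
  · have h := smul_smul_comm R z a
    rw [← List.cons_append, rightTerm_snoc]
    simp only [List.cons_append, leftTerm, rightTerm_snoc, wordDeg_eq, lettersDeg_cons, map_smul, h,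
      map_neg]
    simp only [smul_add, smul_sub, smul_neg, smul_smul, smul_zero, sign_rules]
    module

theorem hoch_hoch (d : ℤ) (X : Word A.gr) {g : Word A.gr → M} (hg : LLin g) :
    hoch R (d + 1) X (fun w => hoch R d w g) = 0 := by
  have h1 := leftTerm_leftTerm R d X g
  have h2 := rightTerm_rightTerm R d X g
  have h3 := leftTerm_rightTerm R d X g
  have h4 := mW_mW X hg
  have e : (fun w => hoch R d w g) = (fun w => leftTerm R d w g) + (fun w => rightTerm R d w g) +
      (-sg d) • fun w => mW A w g := by
    funext w
    simp only [hoch, Pi.add_apply, Pi.smul_apply]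
    module
  rw [e, hoch]
  simp only [(leftTerm_linear R _ X).map_add, (rightTerm_linear R _ X).map_add,
    (mW_linear X).map_add, (leftTerm_linear R _ X).map_smul, (rightTerm_linear R _ X).map_smul,
    (mW_linear X).map_smul, h4]
  linear_combination (norm := module) h1 + h2 + h3

/-- Only words of length two contribute, since the action is zero on words that are not single
letters. On these it is the rule for `(a b) • v`. -/
theorem hoch_actLin (d : ℤ) (X : Word A.gr) (v : M) :
    hoch R (d + 1) X (fun w => sg (d * wordDeg w) • actLin R w v) = 0 := by
  rcases X with _ | ⟨a, _ | ⟨b, _ | ⟨c, x⟩⟩⟩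
  · exact hoch_nil R _ _
  · have h : actLin R ([] : Word A.gr) = 0 := actLin_eq_zero R (by simp)
    simp [hoch, leftTerm, rightTerm, h, mW_singleton]
  · have h := act_mulL R a b v
    rw [hoch_eq R _ rfl (List.singleton_append (x := a) (l := [b])).symm, mW_cons_cons,
      mW_singleton]
    simp only [actLin_singleton, wordDeg_eq, lettersDeg_cons, lettersDeg_nil, letterDeg_mulL, h,
      map_smul]
    generalize letterDeg a = a', letterDeg b = b'
    simp only [smul_add, smul_sub, smul_neg, smul_smul, smul_zero, sign_rules]
    module
  · have h : ∀ w : Word A.gr, 2 ≤ w.length → sg (d * wordDeg w) • actLin R w v = 0 := fun w hw => by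
      rw [actLin_eq_zero R (by omega), LinearMap.zero_apply, smul_zero]
    obtain ⟨a', y, y', z, e, e'⟩ := exists_decomposition (X := a :: b :: c :: x) (by simp)
    have l := congrArg List.length e
    have l' := congrArg List.length e'
    simp only [List.length_append, List.length_cons, List.length_nil] at l l'
    rw [hoch_eq R _ e e', h y (by omega), h y' (by omega), mW_eq_zero]
    · simp
    · intro w hw
      simp only [List.length_cons] at hw
      exact h w (by omega)

end Hochschild

/-! ### Commutation of the operators attached to two words -/

section Commutators

variable {G : Type*} [AddCommGroup G] [Module ℝ G] {A : GerstenhaberAlgebra G}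
  {M : Type*} [AddCommGroup M] [Module ℝ M] (R : GerstenhaberModule A M)

/-- Operations on different words commute up to the Koszul sign. The only nontrivial terms have a
letter of each word multiplying the value, and these need the commutativity of the module action for
the four pairs of outer letters. -/
theorem hoch_comm (d : ℤ) (X Y : Word A.gr) (F : Word A.gr → Word A.gr → M) :
    hoch R (d + 1 + wordDeg X) Y (fun w => hoch R d X fun v => F v w)
      + sg (wordDeg X * wordDeg Y) • hoch R (d + 1 + wordDeg Y) X (fun w => hoch R d Y fun v =>
        sg (wordDeg v * wordDeg w) • F w v) = 0 := by
  by_cases hX : X = []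
  · simp only [hX, hoch_nil, smul_zero, add_zero]
    exact (hoch_linear R _ Y).map_zero
  by_cases hY : Y = []
  · simp only [hY, hoch_nil, smul_zero, zero_add]
    exact (congrArg _ (hoch_linear R _ X).map_zero).trans (smul_zero _)
  obtain ⟨a, x, x', z, h, h'⟩ := exists_decomposition hX
  obtain ⟨b, y, y', t, k, k'⟩ := exists_decomposition hY
  have e : wordDeg x = wordDeg X - letterDeg a := by
    rw [h, wordDeg_eq, wordDeg_eq, lettersDeg_cons]; ring
  have e' : wordDeg x' = wordDeg X - letterDeg z := by
    rw [h', wordDeg_eq, wordDeg_eq, lettersDeg_append, lettersDeg_cons, lettersDeg_nil]; ring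
  have f : wordDeg y = wordDeg Y - letterDeg b := by
    rw [k, wordDeg_eq, wordDeg_eq, lettersDeg_cons]; ring
  have f' : wordDeg y' = wordDeg Y - letterDeg t := by
    rw [k', wordDeg_eq, wordDeg_eq, lettersDeg_append, lettersDeg_cons, lettersDeg_nil]; ring
  simp only [hoch_sg]
  simp only [hoch_eq R _ h h', hoch_eq R _ k k']
  rw [mW_deg X fun n w => sg (wordDeg Y * n) • (sg (letterDeg b * (d + n) + letterDeg b) •
    R.smul b.1.2 (F w y) - sg (letterDeg t * (wordDeg y' + (d + n))) • R.smul t.1.2 (F w y')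
      - sg (d + n) • mW A Y (F w))]
  simp only [mW_smul, mW_sub, map_mW, mW_comm X Y F, map_sub, map_smul, e, e', f, f']
  have s1 := smul_smul_comm R a b
  have s2 := smul_smul_comm R a t
  have s3 := smul_smul_comm R z b
  have s4 := smul_smul_comm R z t
  simp only [s1, s2, s3, s4]
  generalize letterDeg a = a', letterDeg b = b', letterDeg z = z', letterDeg t = t',
    wordDeg X = X', wordDeg Y = Y'
  simp only [smul_add, smul_sub, smul_neg, smul_smul, smul_zero, sign_rules]
  module

/-- For two single letters this is the Lie module axiom. Otherwise a word that is not a single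
letter does not act, and the bracket is zero or again not a single letter. -/
theorem actLin_actLin (d : ℤ) (X Y : Word A.gr) (v : M) :
    sg ((d + 1 + wordDeg X) * wordDeg Y + d * wordDeg X) • actLin R Y (actLin R X v)
      + sg (wordDeg X * wordDeg Y + ((d + 1 + wordDeg Y) * wordDeg X + d * wordDeg Y)) •
        actLin R X (actLin R Y v)
      + sg (d + wordDeg X) • br A X Y (fun w => sg (d * wordDeg w) • actLin R w v) = 0 := by
  by_cases h : X.length = 1 ∧ Y.length = 1
  · obtain ⟨hX, hY⟩ := h
    obtain ⟨a, rfl⟩ := List.length_eq_one_iff.1 hX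
    obtain ⟨b, rfl⟩ := List.length_eq_one_iff.1 hY
    simp only [br_cons, br_nil_left, br_nil_right, SH_nil_left, actLin_singleton, act_brL,
      wordDeg_eq, lettersDeg_cons, lettersDeg_nil, letterDeg_brL, map_smul]
    generalize letterDeg a = a', letterDeg b = b'
    simp only [smul_add, smul_sub, smul_neg, smul_smul, smul_zero, sign_rules]
    module
  · have h0 : br A X Y (fun w => sg (d * wordDeg w) • actLin R w v) = 0 := by
      by_cases hX : X.length = 0
      · rw [List.length_eq_zero_iff.1 hX, br_nil_left]
      by_cases hY : Y.length = 0
      · rw [List.length_eq_zero_iff.1 hY, br_nil_right]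
      exact br_eq_zero X Y fun w hw => by
        rw [actLin_eq_zero R (by omega), LinearMap.zero_apply, smul_zero]
    rw [h0]
    by_cases hX : X.length = 1
    · rw [actLin_eq_zero R (X := Y) (by tauto)]; simp
    · rw [actLin_eq_zero R hX]; simp

/-- The terms of type `T` in the identity for two operators with a function of one word. -/
def mixed (T : ℤ → Word A.gr → (Word A.gr → M) → M) (d : ℤ) (X Y : Word A.gr)
    (g : Word A.gr → M) : M :=
  sg (d * wordDeg X) • T (d + 1 + wordDeg X) Y (fun w => actLin R X (g w))
    + sg ((d + 1 + wordDeg X) * wordDeg Y) • actLin R Y (T d X g)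
    - sg (d + wordDeg X) • T (d + 1 + wordDeg X) Y (fun w => br A X w g)

theorem map_SH {W W' : Type*} [AddCommGroup W] [Module ℝ W] [AddCommGroup W'] [Module ℝ W']
    (φ : W →ₗ[ℝ] W') (x y : Word A.gr) (g : Word A.gr → W) :
    SH x y (fun w => φ (g w)) = φ (SH x y g) := (map_lc φ _ g).symm

theorem leftTerm_nil (d : ℤ) (g : Word A.gr → M) : leftTerm R d [] g = 0 := rfl

theorem rightTerm_nil (d : ℤ) (g : Word A.gr → M) : rightTerm R d [] g = 0 := rfl

theorem leftTerm_zero (d : ℤ) (X : Word A.gr) : leftTerm R d X (fun _ => 0) = 0 :=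
  (leftTerm_linear R d X).map_zero

theorem rightTerm_zero (d : ℤ) (X : Word A.gr) : rightTerm R d X (fun _ => 0) = 0 :=
  (rightTerm_linear R d X).map_zero

/-- The critical term multiplies by `[a, b]` and evaluates `g` on the shuffle of the tails. If both
tails are nonempty it vanishes because `g` kills shuffles. If exactly one is empty, the
corresponding word is a letter that acts, and the compatibility of action and product applies. If
both are empty, `g` is evaluated on the empty word. -/
theorem mixed_leftTerm (d : ℤ) (X Y : Word A.gr) {g : Word A.gr → M} (hg : NGood g) :
    mixed R (leftTerm R) d X Y g + sg (wordDeg X * wordDeg Y) • mixed R (leftTerm R) d Y X g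
      + sg (d + wordDeg X) • br A X Y (fun w => leftTerm R d w g) = 0 := by
  have h0 : actLin R ([] : Word A.gr) = 0 := actLin_eq_zero R (by simp)
  rcases X with _ | ⟨a, x⟩
  · simp [mixed, leftTerm_nil, h0, br_nil_left, br_nil_right, leftTerm_zero]
  rcases Y with _ | ⟨b, y⟩
  · simp [mixed, leftTerm_nil, h0, br_nil_left, br_nil_right, leftTerm_zero]
  have k := br_skew (A := A) (b :: y) x hg.llin
  have g0 := hg.nil
  have e : SH x y (fun w => sg (letterDeg (brL A a b) * d + letterDeg (brL A a b)) •
      R.smul (brL A a b).1.2 (g w)) = sg (letterDeg (brL A a b) * d + letterDeg (brL A a b)) •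
      R.smul (brL A a b).1.2 (SH x y g) := by
    rw [← map_SH, ← SH_smul]
  simp only [mixed, leftTerm, br_cons, k]
  rw [br_smul, br_smul, map_br, map_br, e, letterDeg_brL]
  simp only [wordDeg_eq, lettersDeg_cons]
  rcases x with _ | ⟨a', x⟩
  · have s := smul_brL R a b
    rcases y with _ | ⟨b', y⟩
    · simp only [SH_nil_left, g0, br_nil_left, br_nil_right, map_zero, smul_zero]
      simp
    · have h1 : actLin R (b :: b' :: y) = 0 := actLin_eq_zero R (by simp)
      simp only [SH_nil_left, g0, br_nil_left, br_nil_right, h1, actLin_singleton, s,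
        LinearMap.zero_apply, map_zero, map_smul, lettersDeg_nil]
      generalize letterDeg a = a', letterDeg b = b', lettersDeg (b' :: y) = y'
      simp only [smul_add, smul_sub, smul_neg, smul_smul, smul_zero, sign_rules]
      module
  · have s := smul_brL' R a b
    have h1 : actLin R (a :: a' :: x) = 0 := actLin_eq_zero R (by simp)
    rcases y with _ | ⟨b', y⟩
    · simp only [SH_nil_right, g0, br_nil_left, br_nil_right, h1, actLin_singleton, s,
        LinearMap.zero_apply, map_zero, map_smul, lettersDeg_nil]
      generalize letterDeg a = a', letterDeg b = b', lettersDeg (a' :: x) = x'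
      simp only [smul_add, smul_sub, smul_neg, smul_smul, smul_zero, sign_rules]
      module
    · have h2 : actLin R (b :: b' :: y) = 0 := actLin_eq_zero R (by simp)
      have h3 := hg.shuffle (a' :: x) (b' :: y) (by simp) (by simp)
      simp only [h1, h2, h3, LinearMap.zero_apply, map_zero, map_smul, smul_zero, add_zero,
        zero_add, zero_sub]
      generalize letterDeg a = a', letterDeg b = b', lettersDeg (a' :: x) = x',
        lettersDeg (b' :: y) = y'
      simp only [smul_add, smul_sub, smul_neg, smul_smul, smul_zero, sign_rules]
      module

-- The reasoning of `mixed_leftTerm` applies at the other end of the words, with the bracket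
-- expanded at the last letters.
set_option maxHeartbeats 1000000 in
theorem mixed_rightTerm (d : ℤ) (X Y : Word A.gr) {g : Word A.gr → M} (hg : NGood g) :
    mixed R (rightTerm R) d X Y g + sg (wordDeg X * wordDeg Y) • mixed R (rightTerm R) d Y X g
      + sg (d + wordDeg X) • br A X Y (fun w => rightTerm R d w g) = 0 := by
  have h0 : actLin R ([] : Word A.gr) = 0 := actLin_eq_zero R (by simp)
  rcases List.eq_nil_or_concat' X with rfl | ⟨x, z, rfl⟩
  · simp [mixed, rightTerm_nil, h0, br_nil_left, br_nil_right, rightTerm_zero]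
  rcases List.eq_nil_or_concat' Y with rfl | ⟨y, t, rfl⟩
  · simp [mixed, rightTerm_nil, h0, br_nil_left, br_nil_right, rightTerm_zero]
  have k := br_skew (A := A) (y ++ [t]) x hg.llin
  have g0 := hg.nil
  simp only [mixed, br_snoc, rightTerm_snoc, k]
  rw [br_deg x (y ++ [t]) fun n w => -(sg (letterDeg z * (n + d)) • R.smul z.1.2 (g w)),
    br_deg (x ++ [z]) y fun n w => -(sg (letterDeg t * (n + d)) • R.smul t.1.2 (g w))]
  have e : SH x y (fun w => -(sg (letterDeg (brL A z t) * (wordDeg w + d)) •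
      R.smul (brL A z t).1.2 (g w))) =
      -(sg (letterDeg (brL A z t) * (lettersDeg x + lettersDeg y - 1 + d)) •
      R.smul (brL A z t).1.2 (SH x y g)) := by
    rw [← map_SH, ← neg_smul, ← SH_smul]
    exact SH_congr fun w hw _ => by rw [wordDeg_eq, hw, neg_smul]
  simp only [← neg_smul] at e ⊢
  rw [br_smul, br_smul, map_br, map_br, e, letterDeg_brL]
  simp only [wordDeg_eq, lettersDeg_append, lettersDeg_cons, lettersDeg_nil]
  by_cases hx : x = []
  · subst hx
    have s := smul_brL R z t
    by_cases hy : y = []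
    · subst hy
      simp only [SH_nil_left, g0, br_nil_left, br_nil_right, map_zero, smul_zero]
      simp
    · have h1 : actLin R (y ++ [t]) = 0 := actLin_eq_zero R (by simpa using hy)
      simp only [SH_nil_left, g0, br_nil_left, br_nil_right, h1, List.nil_append, actLin_singleton,
        s, LinearMap.zero_apply, map_zero, map_smul, lettersDeg_nil]
      generalize letterDeg z = a', letterDeg t = b', lettersDeg y = y'
      simp only [smul_add, smul_sub, smul_neg, smul_smul, smul_zero, sign_rules]
      module
  · have s := smul_brL' R z t
    have h1 : actLin R (x ++ [z]) = 0 := actLin_eq_zero R (by simpa using hx)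
    by_cases hy : y = []
    · subst hy
      simp only [SH_nil_right, g0, br_nil_left, br_nil_right, h1, List.nil_append,
        actLin_singleton, s, LinearMap.zero_apply, map_zero, map_smul, lettersDeg_nil]
      generalize letterDeg z = a', letterDeg t = b', lettersDeg x = x'
      simp only [smul_add, smul_sub, smul_neg, smul_smul, smul_zero, sign_rules]
      module
    · have h2 : actLin R (y ++ [t]) = 0 := actLin_eq_zero R (by simpa using hy)
      have h3 := hg.shuffle x y hx hy
      simp only [h1, h2, h3, LinearMap.zero_apply, map_zero, map_smul, smul_zero, add_zero,
        zero_add, zero_sub]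
      generalize letterDeg z = a', letterDeg t = b', lettersDeg x = x', lettersDeg y = y'
      simp only [smul_add, smul_sub, smul_neg, smul_smul, smul_zero, sign_rules]
      module

/-- The action is linear and hence commutes with `m`, so those terms cancel. What remains is that
`m` is a derivation of the bracket. -/
theorem mixed_mW (d : ℤ) (X Y : Word A.gr) {g : Word A.gr → M} (hg : LLin g) :
    mixed R (fun d X g => sg d • mW A X g) d X Y g +
      sg (wordDeg X * wordDeg Y) • mixed R (fun d X g => sg d • mW A X g) d Y X g
      + sg (d + wordDeg X) • br A X Y (fun w => sg d • mW A w g) = 0 := by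
  have h := br_mW X Y hg
  have k : ∀ w, br A Y w g = -sg ((wordDeg Y + 1) * (wordDeg w + 1)) • br A w Y g :=
    fun w => br_skew Y w hg
  have k2 : mW A X (fun w => br A Y w g) =
      -sg ((wordDeg Y + 1) * (wordDeg X + 1 + 1)) • mW A X fun w => br A w Y g := by
    simp only [k]
    rw [mW_deg X fun n w => -sg ((wordDeg Y + 1) * (n + 1)) • br A w Y g, mW_smul]
  simp only [mixed, br_smul, map_mW, map_smul, h, k2]
  simp only [wordDeg_eq]
  simp only [smul_add, smul_sub, smul_neg, smul_smul, smul_zero, sign_rules]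
  module

theorem mixed_hoch (d : ℤ) (X Y : Word A.gr) {g : Word A.gr → M} (hg : NGood g) :
    mixed R (hoch R) d X Y g + sg (wordDeg X * wordDeg Y) • mixed R (hoch R) d Y X g
      + sg (d + wordDeg X) • br A X Y (fun w => hoch R d w g) = 0 := by
  have h1 := mixed_leftTerm R d X Y hg
  have h2 := mixed_rightTerm R d X Y hg
  have h3 := mixed_mW R d X Y hg.llin
  simp only [mixed, hoch, map_add, map_sub, br_add, br_sub] at h1 h2 h3 ⊢
  linear_combination (norm := module) h1 + h2 - h3

end Commutators

section Square

variable {G : Type*} [AddCommGroup G] [Module ℝ G] {A : GerstenhaberAlgebra G}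
  {M : Type*} [AddCommGroup M] [Module ℝ M] (R : GerstenhaberModule A M)

/-! ### The square of the coboundary -/

/-- The coboundary `d_m + d_ℓ`. -/
def dT (d : ℤ) (f : Sentence A.gr → M) (L : Sentence A.gr) : M := dM R d f L + dL R d f L

/-- The terms of the coboundary in which the first word `X` of `X L` takes part. -/
def theta (d : ℤ) (X : Word A.gr) (f : Sentence A.gr → M) (L : Sentence A.gr) : M :=
  hoch R d X (fun w => f (w :: L)) + sg (d * wordDeg X) • actLin R X (f L) - sg d • adS A X L f

theorem dT_cons (d : ℤ) (f : Sentence A.gr → M) (X : Word A.gr) (L : Sentence A.gr) :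
    dT R d f (X :: L) = theta R d X f L + dT R (d + wordDeg X) (fun K => f (X :: K)) L := by
  simp only [dT, theta, dM_cons, dL_cons]
  abel

theorem dT_nil (d : ℤ) (f : Sentence A.gr → M) : dT R d f [] = 0 := by
  simp [dT, dM, dL, kap, mS_nil, ellS_nil, cop, actPair_eq_zero]

theorem adS_linear (X : Word A.gr) (L : Sentence A.gr) : IsLinearMap ℝ (adS (W := M) A X L) :=
  ad_linear (O := A.ops) X L

theorem theta_linear (d : ℤ) (X : Word A.gr) (L : Sentence A.gr) :
    IsLinearMap ℝ (fun f => theta R d X f L) := by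
  refine ⟨fun f g => ?_, fun r f => ?_⟩
  · have h := (hoch_linear R d X).map_add (fun w => f (w :: L)) (fun w => g (w :: L))
    have h' : (hoch R d X fun w => (f + g) (w :: L)) =
      hoch R d X (fun w => f (w :: L)) + hoch R d X (fun w => g (w :: L)) := h
    simp only [theta]
    rw [h', (adS_linear X L).map_add, Pi.add_apply, map_add]
    module
  · have h := (hoch_linear R d X).map_smul r (fun w => f (w :: L))
    have h' : (hoch R d X fun w => (r • f) (w :: L)) =
      r • hoch R d X (fun w => f (w :: L)) := h
    simp only [theta]
    rw [h', (adS_linear X L).map_smul, Pi.smul_apply, map_smul]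
    module

theorem dT_linear (L : Sentence A.gr) (d : ℤ) : IsLinearMap ℝ (fun f => dT R d f L) := by
  induction L generalizing d with
  | nil => exact ⟨fun _ _ => by simp [dT_nil], fun _ _ => by simp [dT_nil]⟩
  | cons X L ih =>
    refine ⟨fun f g => ?_, fun r f => ?_⟩
    · have h1 := (theta_linear R d X L).map_add f g
      have h2 := (ih (d + wordDeg X)).map_add (fun K => f (X :: K)) (fun K => g (X :: K))
      simp only [dT_cons]
      rw [h1, add_add_add_comm]
      exact congrArg _ h2
    · have h1 := (theta_linear R d X L).map_smul r f
      have h2 := (ih (d + wordDeg X)).map_smul r (fun K => f (X :: K))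
      simp only [dT_cons]
      rw [h1, smul_add]
      exact congrArg _ h2

theorem theta_add (d : ℤ) (X : Word A.gr) (f g : Sentence A.gr → M) (L : Sentence A.gr) :
    theta R d X (fun K => f K + g K) L = theta R d X f L + theta R d X g L :=
  (theta_linear R d X L).map_add f g

theorem theta_smul (d : ℤ) (X : Word A.gr) (r : ℝ) (f : Sentence A.gr → M) (L : Sentence A.gr) :
    theta R d X (fun K => r • f K) L = r • theta R d X f L :=
  (theta_linear R d X L).map_smul r f

theorem theta_sub (d : ℤ) (X : Word A.gr) (f g : Sentence A.gr → M) (L : Sentence A.gr) :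
    theta R d X (fun K => f K - g K) L = theta R d X f L - theta R d X g L :=
  (theta_linear R d X L).mk'.map_sub f g

theorem dT_smul (d : ℤ) (r : ℝ) (f : Sentence A.gr → M) (L : Sentence A.gr) :
    dT R d (fun K => r • f K) L = r • dT R d f L := (dT_linear R L d).map_smul r f

theorem dT_sub (d : ℤ) (f g : Sentence A.gr → M) (L : Sentence A.gr) :
    dT R d (fun K => f K - g K) L = dT R d f L - dT R d g L := (dT_linear R L d).mk'.map_sub f g

theorem br_theta (d : ℤ) (X Y Z : Word A.gr) (f : Sentence A.gr → M) (L : Sentence A.gr) :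
    br A Y Z (fun w => theta R d X (fun K => f (w :: K)) L) =
      theta R d X (fun K => br A Y Z fun w => f (w :: K)) L :=
  ((IsLinearMap.map_lc (theta_linear R d X L) _ fun w K => f (w :: K)).symm.trans
    (congrArg (fun F => theta R d X F L) (funext fun K => lc_apply _ _ K)))

theorem br_dT (d : ℤ) (Y Z : Word A.gr) (f : Sentence A.gr → M) (L : Sentence A.gr) :
    br A Y Z (fun w => dT R d (fun K => f (w :: K)) L) =
      dT R d (fun K => br A Y Z fun w => f (w :: K)) L :=
  ((IsLinearMap.map_lc (dT_linear R L d) _ fun w K => f (w :: K)).symm.trans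
    (congrArg (fun F => dT R d F L) (funext fun K => lc_apply _ _ K)))

theorem Good.dT (d : ℤ) {f : Sentence A.gr → M} (hf : Good f) :
    Good (ChevalleyHarrison.dT R d f) := (hf.dM R d).add (hf.dL R d)

/-- By `dT_cons`, `theta` is a difference of two coboundaries, so it inherits goodness without a
separate proof. -/
theorem Good.theta (d : ℤ) (X : Word A.gr) {f : Sentence A.gr → M} (hf : Good f) :
    Good (ChevalleyHarrison.theta R d X f) := by
  have h := ((hf.dT R d).ins X).add (((hf.ins X).dT R (d + wordDeg X)).smul (-1))
  convert h using 2 with L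
  rw [dT_cons]
  module

/-- A further word `Y` only shifts the degree of the cochain and yields a Koszul sign, except for
the one new term in which `X` is bracketed with `Y`. -/
theorem theta_cons (d : ℤ) (X Y : Word A.gr) {f : Sentence A.gr → M} (hf : SwapGood f)
    (L : Sentence A.gr) : theta R d X f (Y :: L) =
      sg (wordDeg X * wordDeg Y) • theta R (d + wordDeg Y) X (fun K => f (Y :: K)) L
        - sg (d + wordDeg X) • br A X Y fun w => f (w :: L) := by
  have h : (fun w => f (w :: Y :: L)) = fun w => sg (wordDeg w * wordDeg Y) • f (Y :: w :: L) :=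
    funext fun w => hf.head w Y L
  simp only [theta, h, hoch_sg, adS_cons]
  simp only [smul_add, smul_sub, smul_smul, sign_rules]
  module

theorem theta_nil (d : ℤ) (X : Word A.gr) (f : Sentence A.gr → M) :
    theta R d X f [] = hoch R d X (fun w => f [w]) + sg (d * wordDeg X) • actLin R X (f []) := by
  rw [theta, adS_nil, smul_zero, sub_zero]

theorem hoch_add (d : ℤ) (X : Word A.gr) (f g : Word A.gr → M) :
    hoch R d X (fun w => f w + g w) = hoch R d X f + hoch R d X g := (hoch_linear R d X).map_add f g

theorem hoch_sub (d : ℤ) (X : Word A.gr) (f g : Word A.gr → M) :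
    hoch R d X (fun w => f w - g w) = hoch R d X f - hoch R d X g :=
  (hoch_linear R d X).mk'.map_sub f g

theorem hoch_smul (d : ℤ) (X : Word A.gr) (r : ℝ) (f : Word A.gr → M) :
    hoch R d X (fun w => r • f w) = r • hoch R d X f := (hoch_linear R d X).map_smul r f

/-- The terms separate by how often `f` is applied to the pair of words: both kept (`hoch_comm`),
neither kept (`actLin_actLin`), or one kept or one bracket taken (`mixed_hoch`). -/
theorem theta_theta_nil (d : ℤ) (X Y : Word A.gr) {f : Sentence A.gr → M} (hf : Good f) :
    theta R (d + 1 + wordDeg X) Y (theta R d X f) []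
      + sg (wordDeg X * wordDeg Y) • theta R (d + 1 + wordDeg Y) X (theta R d Y f) []
      + sg (d + wordDeg X) • br A X Y (fun w => theta R d w f []) = 0 := by
  have h1 := hoch_comm R d X Y fun v w => f [v, w]
  have e : ∀ v w, sg (wordDeg v * wordDeg w) • f [w, v] = f [v, w] := fun v w =>
    (hf.swap.head v w []).symm
  simp only [e] at h1
  have h2 := actLin_actLin R d X Y (f [])
  have h3 := mixed_hoch R d X Y (hf.head [])
  simp only [mixed] at h3
  simp only [theta_nil, theta, adS_cons, adS_nil, smul_zero, add_zero, sub_zero, hoch_add, hoch_sub, hoch_smul,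
    map_add, map_smul, br_add, smul_smul]
  simp only [smul_add, smul_sub, smul_smul, ← sg_add] at h1 h2 h3 ⊢
  linear_combination (norm := module) h1 + h2 + h3

theorem br_br (X Y Z : Word A.gr) {g : Word A.gr → M} (hg : LLin g) :
    br A Y Z (fun w => br A X w g) =
      -sg ((wordDeg X + 1) * (wordDeg Y + wordDeg Z)) • br A Y Z (fun w => br A w X g) := by
  have k : ∀ w, br A X w g = -sg ((wordDeg X + 1) * (wordDeg w + 1)) • br A w X g :=
    fun w => br_skew X w hg
  simp only [k]
  rw [br_deg Y Z fun n w => -sg ((wordDeg X + 1) * (n + 1)) • br A w X g, br_smul]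
  simp only [sign_rules]

/-- In this form the Jacobi identity says that the bracket with `[X, Y]` is the graded commutator of
the brackets with `X` and `Y`, which is the shape met in `theta_theta`. -/
theorem br_jacobi' (X Y Z : Word A.gr) {g : Word A.gr → M} (hg : LLin g) :
    br A X Y (fun w => br A w Z g) = br A Y Z (fun w => br A X w g)
      - sg ((wordDeg X + 1) * (wordDeg Y + 1)) • br A X Z (fun w => br A Y w g) := by
  have j := smul_of_eq (sg (lettersDeg X * lettersDeg Z)) (br_jacobi X Y Z hg)
  have k : br A Z X (fun w => br A w Y g) =
      -sg ((wordDeg Z + 1) * (wordDeg X + 1)) • br A X Z (fun w => br A w Y g) :=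
    br_skew Z X (hg.BR (O := A.ops) A.lift.regular Y)
  rw [br_br X Y Z hg, br_br Y X Z hg]
  rw [k] at j
  simp only [wordDeg_eq] at j ⊢
  generalize lettersDeg X = x, lettersDeg Y = y, lettersDeg Z = z at j ⊢
  simp only [smul_add, smul_sub, smul_smul, smul_zero, sign_rules] at j ⊢
  linear_combination (norm := module) j

theorem br_theta_cons (d : ℤ) (X Y Z : Word A.gr) {f : Sentence A.gr → M} (hf : SwapGood f)
    (L : Sentence A.gr) : br A Y Z (fun w => theta R d X f (w :: L)) =
      sg (wordDeg X * (wordDeg Y + wordDeg Z + 1)) •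
        theta R (d + 1 + wordDeg Y + wordDeg Z) X (fun K => br A Y Z fun w => f (w :: K)) L
      - sg (d + wordDeg X) • br A Y Z (fun w => br A X w fun v => f (v :: L)) := by
  simp only [theta_cons R d X _ hf, br_sub, br_smul]
  rw [br_deg Y Z fun n w => sg (wordDeg X * n) • theta R (d + n) X (fun K => f (w :: K)) L, br_smul,
    br_theta, show d + (wordDeg Y + wordDeg Z + 1) = d + 1 + wordDeg Y + wordDeg Z by ring]

/-- Moving the next word `Z` out of all three terms by `theta_cons` gives the identity for the
cochain `f(Z ·)` and some bracket terms. The terms with one bracket cancel in pairs, and the double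
brackets cancel by the Jacobi identity. -/
theorem theta_theta (L : Sentence A.gr) : ∀ (d : ℤ) (X Y : Word A.gr) {f : Sentence A.gr → M},
    Good f →
    theta R (d + 1 + wordDeg X) Y (theta R d X f) L
      + sg (wordDeg X * wordDeg Y) • theta R (d + 1 + wordDeg Y) X (theta R d Y f) L
      + sg (d + wordDeg X) • br A X Y (fun w => theta R d w f L) = 0 := by
  induction L with
  | nil => exact fun d X Y f hf => theta_theta_nil R d X Y hf
  | cons Z L ih =>
    intro d X Y f hf
    have h := ih (d + wordDeg Z) X Y (hf.ins Z)
    have j := br_jacobi' X Y Z (hf.head L).llin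
    rw [theta_cons R _ Y Z (hf.theta R d X).swap, theta_cons R _ X Z (hf.theta R d Y).swap,
      br_theta_cons R d X Y Z hf.swap, br_theta_cons R d Y X Z hf.swap]
    simp only [theta_cons R d _ Z hf.swap, theta_sub, theta_smul, br_sub]
    rw [br_deg X Y fun n w => sg (n * wordDeg Z) • theta R (d + wordDeg Z) w (fun K => f (Z :: K)) L,
      br_deg X Y fun n w => sg (d + n) • br A w Z fun v => f (v :: L), br_smul, br_smul, j]
    rw [show d + wordDeg Z + 1 + wordDeg X = d + 1 + wordDeg X + wordDeg Z by ring,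
      show d + wordDeg Z + 1 + wordDeg Y = d + 1 + wordDeg Y + wordDeg Z by ring] at h
    have h' := smul_of_eq (sg (wordDeg Z * (wordDeg X + wordDeg Y))) h
    generalize theta R (d + 1 + wordDeg X + wordDeg Z) Y _ L = t₁,
      theta R (d + 1 + wordDeg Y + wordDeg Z) X _ L = t₂ at h' ⊢
    generalize wordDeg X = x, wordDeg Y = y, wordDeg Z = z at h' ⊢
    simp only [smul_add, smul_sub, smul_smul, smul_zero, sign_rules] at h' ⊢
    linear_combination (norm := module) h'

/-- With no further word this says that the coboundary of a single word squares to zero. A further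
word `Y` contributes the identity for `f(Y ·)`, and the new terms, in which both `X` and `Y` take
part, are those of `theta_theta`. -/
theorem theta_dT (L : Sentence A.gr) : ∀ (d : ℤ) (X : Word A.gr) {f : Sentence A.gr → M}, Good f →
    theta R (d + 1) X (dT R d f) L + dT R (d + 1 + wordDeg X) (theta R d X f) L = 0 := by
  induction L with
  | nil =>
    intro d X f hf
    simp only [theta_nil, dT_nil, dT_cons, map_zero, smul_zero, add_zero, hoch_add]
    rw [hoch_hoch R d X (hf.head []).llin, hoch_actLin, add_zero]
  | cons Y L ih =>
    intro d X f hf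
    have h1 := smul_of_eq (sg (wordDeg X * wordDeg Y)) (ih (d + wordDeg Y) X (hf.ins Y))
    have h2 := theta_theta R L d X Y hf
    rw [theta_cons R _ X Y (hf.dT R d).swap, dT_cons]
    simp only [dT_cons, theta_cons R d X Y hf.swap, theta_add, br_add, dT_sub, dT_smul]
    rw [br_deg X Y fun n w => dT R (d + n) (fun K => f (w :: K)) L, br_dT]
    rw [show d + (wordDeg X + wordDeg Y + 1) = d + 1 + wordDeg X + wordDeg Y by ring]
    rw [show d + wordDeg Y + 1 = d + 1 + wordDeg Y by ring,
      show d + 1 + wordDeg Y + wordDeg X = d + 1 + wordDeg X + wordDeg Y by ring] at h1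
    simp only [smul_add, smul_sub, smul_smul, smul_zero, sign_rules] at h1 h2 ⊢
    linear_combination (norm := module) h1 + h2

/-- The square of the coboundary is zero. -/
theorem dT_dT (L : Sentence A.gr) : ∀ (d : ℤ) {f : Sentence A.gr → M}, Good f →
    dT R (d + 1) (dT R d f) L = 0 := by
  induction L with
  | nil => exact fun d f _ => dT_nil R _ _
  | cons X L ih =>
    intro d f hf
    -- In the square on `X :: L` the terms with one `θ_X` vanish by `theta_dT`. The others form the
    -- square for the shorter sentence and the cochain `f(X ·)`.
    have h1 := theta_dT R L d X hf
    have h2 := ih (d + wordDeg X) (hf.ins X)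
    have e : (fun K => dT R d f (X :: K)) =
        fun K => theta R d X f K - (-1 : ℝ) • dT R (d + wordDeg X) (fun K => f (X :: K)) K := by
      funext K
      rw [dT_cons, neg_one_smul, sub_neg_eq_add]
    rw [dT_cons, e, dT_sub, dT_smul]
    rw [show d + wordDeg X + 1 = d + 1 + wordDeg X by ring] at h2
    linear_combination (norm := module) h1 + h2

end Square

/-! ### The corestriction of the codifferential -/

section CodifferentialOfCogenerators

variable {V : Type*} [AddCommGroup V] [Module ℝ V] {gr : ℤ → Submodule ℝ V} {O : Ops V}
  {W : Type*} [AddCommGroup W] [Module ℝ W]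

theorem cogen_mk (L : Sentence gr) : cogen gr (mk L) = cogenVal L := cogenVal_descends L

theorem signOp_mk (d : ℤ) (L : Sentence gr) :
    signOp gr d (mk L) = sg (d * sentenceDeg L) • mk L := signVal_descends d L

theorem coprod_mk (T : Space gr ⊗[ℝ] Space gr →ₗ[ℝ] W) (L : Sentence gr) :
    T (coprod gr (mk L)) = cop L fun I J => T (mk I ⊗ₜ[ℝ] mk J) := by
  rw [← map_cop, ← coprodVal_eq]
  exact congrArg T (coprodVal_descends L)

theorem cobracket_mk (T : Space gr ⊗[ℝ] Space gr →ₗ[ℝ] W) (L : Sentence gr) :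
    T (cobracket gr (mk L)) = kap L fun I J => T (mk I ⊗ₜ[ℝ] mk J) := by
  rw [← map_kap, ← cobracketVal_eq]
  exact congrArg T (cobracketVal_descends L)

theorem descend_mVal_mk (hO : O.Regular) (φ : Space O.gr →ₗ[ℝ] W) (L : Sentence O.gr) :
    φ (descend (mVal O) (mk L)) = der 1 (mWord O) L fun K => φ (mk K) := by
  rw [mVal_descends hO, mVal_eq, map_der]

theorem descend_ellVal_mk (hO : O.Regular) (φ : Space O.gr →ₗ[ℝ] W) (L : Sentence O.gr) :
    φ (descend (ellVal O) (mk L)) = ells O L fun K => φ (mk K) := by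
  rw [ellVal_descends hO, ellVal_eq hO, map_ells]

/-- The map `μ` on `V ⊗ V` that corestricts `m` to the cogenerators. -/
def Ops.Lift.mulT (P : O.Lift) : V ⊗[ℝ] V →ₗ[ℝ] V := TensorProduct.lift ((1 / 2 : ℝ) • P.mul)

/-- The map on `V ⊗ V` that corestricts `ℓ` to the cogenerators. -/
def Ops.Lift.bracketT (P : O.Lift) : V ⊗[ℝ] V →ₗ[ℝ] V :=
  TensorProduct.lift ((1 / 2 : ℝ) • (P.bracket ∘ₗ P.s))

/-- This is what makes the coboundary computable: the projection of `m + ℓ` factors through `κ` and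
`Δ`. For a map compatible with these, only its own projection to the cogenerators matters. -/
theorem cogen_codiff (P : O.Lift) (x : Space O.gr) : cogen O.gr (codiff O x) =
    P.mulT (TensorProduct.map (cogen O.gr) (cogen O.gr) (cobracket O.gr x)) +
      P.bracketT (TensorProduct.map (cogen O.gr) (cogen O.gr) (coprod O.gr x)) := by
  refine LinearMap.congr_fun (f := cogen O.gr ∘ₗ codiff O)
    (g := P.mulT ∘ₗ TensorProduct.map (cogen O.gr) (cogen O.gr) ∘ₗ cobracket O.gr +
      P.bracketT ∘ₗ TensorProduct.map (cogen O.gr) (cogen O.gr) ∘ₗ coprod O.gr)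
    (mk_induction _ _ fun L => ?_) x
  have h1 := cobracket_mk (P.mulT ∘ₗ TensorProduct.map (cogen O.gr) (cogen O.gr)) L
  have h2 := coprod_mk (P.bracketT ∘ₗ TensorProduct.map (cogen O.gr) (cogen O.gr)) L
  simp only [LinearMap.comp_apply, LinearMap.add_apply] at h1 h2 ⊢
  rw [h1, h2, codiff, LinearMap.add_apply, map_add, descend_mVal_mk P.regular,
    descend_ellVal_mk P.regular]
  simp only [cogen_mk, TensorProduct.map_tmul]
  exact congrArg₂ (· + ·) (der_cogenVal P L) (ells_cogenVal P L)

theorem cogenVal_mem (L : Sentence gr) : cogenVal L ∈ gr (sentenceDeg L + 2) := by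
  unfold cogenVal
  split
  · rename_i a
    rw [sentenceDeg_cons, sentenceDeg_nil, wordDeg_eq, lettersDeg_cons, lettersDeg_nil, letterDeg,
      show a.1.1 - 1 + 0 - 1 + 0 + 2 = a.1.1 by ring]
    exact a.2
  · exact zero_mem _

end CodifferentialOfCogenerators

section Cochains

variable {G : Type*} [AddCommGroup G] [Module ℝ G] {A : GerstenhaberAlgebra G}
  {M : Type*} [AddCommGroup M] [Module ℝ M] (R : GerstenhaberModule A M)

/-! ### The coboundary on cochains -/

/-- The pairing of `c` with the projection to the cogenerators, for the products. -/
def mulB (d : ℤ) (c : Space A.gr →ₗ[ℝ] M) : Space A.gr ⊗[ℝ] Space A.gr →ₗ[ℝ] M :=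
  TensorProduct.lift ((1 / 2 : ℝ) • (R.smul.compl₁₂ (cogen A.gr ∘ₗ signOp A.gr d) c +
    R.rmul.flip.compl₁₂ c (cogen A.gr)))

/-- The pairing of `c` with the projection to the cogenerators, for the brackets. -/
def actB (d : ℤ) (c : Space A.gr →ₗ[ℝ] M) : Space A.gr ⊗[ℝ] Space A.gr →ₗ[ℝ] M :=
  TensorProduct.lift ((1 / 2 : ℝ) • (R.act.compl₁₂ (A.s ∘ₗ cogen A.gr ∘ₗ signOp A.gr d) c +
    R.ract.flip.compl₁₂ (R.s ∘ₗ c) (cogen A.gr)))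

theorem mulB_tmul (d : ℤ) (c : Space A.gr →ₗ[ℝ] M) (x y : Space A.gr) :
    mulB R d c (x ⊗ₜ y) = (1 / 2 : ℝ) • (R.smul (cogen A.gr (signOp A.gr d x)) (c y) +
      R.rmul (cogen A.gr y) (c x)) := rfl

theorem actB_tmul (d : ℤ) (c : Space A.gr →ₗ[ℝ] M) (x y : Space A.gr) :
    actB R d c (x ⊗ₜ y) = (1 / 2 : ℝ) • (R.act (A.s (cogen A.gr (signOp A.gr d x))) (c y) +
      R.ract (cogen A.gr y) (R.s (c x))) := rfl

/-- The corestriction yields a pairing with `c` on either side and a factor `1/2`. Transposing one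
half by `kap_tr` makes it equal to the other, and the two add up to `mulPair`. -/
theorem mulB_cobracket {d : ℤ} {c : Space A.gr →ₗ[ℝ] M} (hc : c ∈ cochains R d)
    (L : Sentence A.gr) :
    mulB R d c (cobracket A.gr (mk L)) = kap L (mulPair R d fun K => c (mk K)) := by
  rw [cobracket_mk]
  have e : (fun I J => mulB R d c (mk I ⊗ₜ mk J)) =
      (fun I J : Sentence A.gr => ((1 / 2 : ℝ) * sg (d * sentenceDeg I)) •
        R.smul (cogenVal I) (c (mk J))) +
      fun I J : Sentence A.gr => (1 / 2 : ℝ) • R.rmul (cogenVal J) (c (mk I)) := by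
    funext I J
    rw [mulB_tmul, signOp_mk, map_smul, cogen_mk, cogen_mk, map_smul, LinearMap.smul_apply,
      smul_add, smul_smul]
    rfl
  rw [e, (kap_linear L).map_add, ← kap_tr L, ← (kap_linear L).map_add]
  congr 1
  funext I J
  simp only [Pi.add_apply, tr, mulPair, R.rmul_apply (cogenVal_mem J) (hc I)]
  generalize sentenceDeg I = i, sentenceDeg J = j
  simp only [smul_smul, sign_rules, sg_mul_two]
  module

theorem actB_coprod {d : ℤ} {c : Space A.gr →ₗ[ℝ] M} (hc : c ∈ cochains R d)
    (L : Sentence A.gr) :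
    actB R d c (coprod A.gr (mk L)) = cop L (actPair R d fun K => c (mk K)) := by
  rw [coprod_mk]
  have e : (fun I J => actB R d c (mk I ⊗ₜ mk J)) =
      (fun I J : Sentence A.gr => ((1 / 2 : ℝ) * sg (d * sentenceDeg I + sentenceDeg I)) •
        R.act (cogenVal I) (c (mk J))) +
      fun I J : Sentence A.gr => ((1 / 2 : ℝ) * sg (sentenceDeg I + d)) •
        R.ract (cogenVal J) (c (mk I)) := by
    funext I J
    rw [actB_tmul, signOp_mk, map_smul, cogen_mk, cogen_mk, map_smul, map_smul,
      A.s_apply _ _ (cogenVal_mem I), R.s_apply _ _ (hc I)]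
    simp only [map_smul, LinearMap.smul_apply, Pi.add_apply, smul_add, smul_smul, sign_rules]
  rw [e, (cop_linear L).map_add, ← cop_tr L, ← (cop_linear L).map_add]
  congr 1
  funext I J
  simp only [Pi.add_apply, tr, actPair, R.ract_apply (cogenVal_mem J) (hc I)]
  generalize sentenceDeg I = i, sentenceDeg J = j
  simp only [smul_neg, smul_smul, sign_rules, sg_mul_two]
  module

variable (A) in
/-- The operator `m` of the algebra. -/
def mLin : Space A.gr →ₗ[ℝ] Space A.gr := descend (mVal A.ops)

variable (A) in
/-- The operator `ℓ` of the algebra. -/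
def ellLin : Space A.gr →ₗ[ℝ] Space A.gr := descend (ellVal A.ops)

/-- The operator `d_m` on linear maps. -/
def dmLin (d : ℤ) (c : Space A.gr →ₗ[ℝ] M) : Space A.gr →ₗ[ℝ] M :=
  sg d • (mulB R d c ∘ₗ cobracket A.gr - c ∘ₗ mLin A)

/-- The operator `d_ℓ` on linear maps. -/
def dlLin (d : ℤ) (c : Space A.gr →ₗ[ℝ] M) : Space A.gr →ₗ[ℝ] M :=
  actB R d c ∘ₗ coprod A.gr - sg d • c ∘ₗ ellLin A

theorem dmLin_mk {d : ℤ} {c : Space A.gr →ₗ[ℝ] M} (hc : c ∈ cochains R d) (L : Sentence A.gr) :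
    dmLin R d c (mk L) = dM R d (fun K => c (mk K)) L := by
  have h : c (mLin A (mk L)) = mS A L (fun K => c (mk K)) :=
    descend_mVal_mk (O := A.ops) A.lift.regular c L
  rw [dM, ← mulB_cobracket R hc, ← h]
  rfl

theorem dlLin_mk {d : ℤ} {c : Space A.gr →ₗ[ℝ] M} (hc : c ∈ cochains R d) (L : Sentence A.gr) :
    dlLin R d c (mk L) = dL R d (fun K => c (mk K)) L := by
  have h : c (ellLin A (mk L)) = ellS A L (fun K => c (mk K)) :=
    descend_ellVal_mk (O := A.ops) A.lift.regular c L
  rw [dL, ← actB_coprod R hc, ← h]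
  rfl

theorem dmLin_linear (d : ℤ) : IsLinearMap ℝ (dmLin R d) := by
  have h1 : ∀ c c', mulB R d (c + c') = mulB R d c + mulB R d c' := fun c c' =>
    TensorProduct.ext' fun x y => by
      simp only [mulB_tmul, LinearMap.add_apply, map_add]; module
  have h2 : ∀ (r : ℝ) c, mulB R d (r • c) = r • mulB R d c := fun r c =>
    TensorProduct.ext' fun x y => by
      simp only [mulB_tmul, LinearMap.smul_apply, map_smul]; module
  refine ⟨fun c c' => ?_, fun r c => ?_⟩
  · rw [dmLin, h1, LinearMap.add_comp, LinearMap.add_comp, dmLin, dmLin]; module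
  · rw [dmLin, h2, LinearMap.smul_comp, LinearMap.smul_comp, dmLin]; module

theorem dlLin_linear (d : ℤ) : IsLinearMap ℝ (dlLin R d) := by
  have h1 : ∀ c c', actB R d (c + c') = actB R d c + actB R d c' := fun c c' =>
    TensorProduct.ext' fun x y => by
      simp only [actB_tmul, LinearMap.add_apply, map_add]; module
  have h2 : ∀ (r : ℝ) c, actB R d (r • c) = r • actB R d c := fun r c =>
    TensorProduct.ext' fun x y => by
      simp only [actB_tmul, LinearMap.smul_apply, map_smul]; module
  refine ⟨fun c c' => ?_, fun r c => ?_⟩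
  · rw [dlLin, h1, LinearMap.add_comp, LinearMap.add_comp, dlLin, dlLin]; module
  · rw [dlLin, h2, LinearMap.smul_comp, LinearMap.smul_comp, dlLin]; module

/-! ### Homogeneity -/

theorem lc_mem {α : Type*} (N : Submodule ℝ M) (l : List (ℝ × α)) {g : α → M}
    (h : ∀ t ∈ l, g t.2 ∈ N) : lc l g ∈ N := by
  refine list_sum_mem fun v hv => ?_
  obtain ⟨t, ht, rfl⟩ := List.mem_map.1 hv
  exact N.smul_mem _ (h t ht)

theorem mem_gr_of_eq {S : ℤ → Submodule ℝ M} {i j : ℤ} {v : M} (hv : v ∈ S i) (h : i = j) :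
    v ∈ S j := h ▸ hv

theorem MW_mem {V : Type*} [AddCommGroup V] [Module ℝ V] {O : Ops V} (hO : O.Regular)
    (S : ℤ → Submodule ℝ M) (e : ℤ) (X : Word O.gr) {g : Word O.gr → M}
    (hg : ∀ w, g w ∈ S (wordDeg w + e)) : MW O X g ∈ S (wordDeg X + e + 1) :=
  lc_mem _ _ fun t ht => mem_gr_of_eq (hg t.2) (by rw [mWord_deg hO X t ht]; ring)

theorem BR_mem {V : Type*} [AddCommGroup V] [Module ℝ V] {O : Ops V} (hO : O.Regular)
    (S : ℤ → Submodule ℝ M) (e : ℤ) (X Y : Word O.gr) {g : Word O.gr → M}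
    (hg : ∀ w, g w ∈ S (wordDeg w + e)) : BR O X Y g ∈ S (wordDeg X + wordDeg Y + 1 + e) :=
  lc_mem _ _ fun t ht => mem_gr_of_eq (hg t.2) (by
    rw [wordDeg_eq t.2, (bracketWord_spec hO X Y t ht).1, wordDeg_eq, wordDeg_eq]; ring)

theorem br_mem (e : ℤ) (X Y : Word A.gr) {g : Word A.gr → M}
    (hg : ∀ w, g w ∈ R.gr (wordDeg w + e)) : br A X Y g ∈ R.gr (wordDeg X + wordDeg Y + 1 + e) :=
  BR_mem (O := A.ops) A.lift.regular R.gr e X Y hg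

theorem letter_mem (a : Letter A.gr) : a.1.2 ∈ A.gr (letterDeg a + 1) :=
  mem_gr_of_eq a.2 (sub_add_cancel _ _).symm

theorem hoch_mem (d e : ℤ) (X : Word A.gr) {g : Word A.gr → M}
    (hg : ∀ w, g w ∈ R.gr (wordDeg w + e)) : hoch R d X g ∈ R.gr (wordDeg X + e + 1) := by
  by_cases hX : X = []
  · rw [hX, hoch_nil]; exact zero_mem _
  obtain ⟨a, x, x', z, h, h'⟩ := exists_decomposition hX
  rw [hoch_eq R d h h']
  refine sub_mem (sub_mem (Submodule.smul_mem _ _ ?_) (Submodule.smul_mem _ _ ?_))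
    (Submodule.smul_mem _ _ (MW_mem (O := A.ops) A.lift.regular R.gr e X hg))
  · refine mem_gr_of_eq (R.smul_mem (letter_mem a) (hg x)) ?_
    rw [h, wordDeg_eq, wordDeg_eq, lettersDeg_cons]; ring
  · refine mem_gr_of_eq (R.smul_mem (letter_mem z) (hg x')) ?_
    rw [h', wordDeg_eq, wordDeg_eq, lettersDeg_append, lettersDeg_cons, lettersDeg_nil]; ring

theorem dM_mem : ∀ (L : Sentence A.gr) (d : ℤ) {f : Sentence A.gr → M},
    (∀ K, f K ∈ R.gr (sentenceDeg K + d + 2)) → dM R d f L ∈ R.gr (sentenceDeg L + (d + 1) + 2)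
  | [], d, f, hf => by simp [dM, kap, mS_nil]
  | X :: L, d, f, hf => by
    rw [dM_cons]
    refine add_mem (mem_gr_of_eq (hoch_mem R d (sentenceDeg L + d + 2) X fun w =>
      mem_gr_of_eq (hf (w :: L)) ?_) ?_) (mem_gr_of_eq (dM_mem L (d + wordDeg X) fun K =>
      mem_gr_of_eq (hf (X :: K)) ?_) ?_) <;>
    · simp only [sentenceDeg_cons]; ring

theorem adS_mem (X : Word A.gr) : ∀ (L : Sentence A.gr) (d : ℤ) {f : Sentence A.gr → M},
    (∀ K, f K ∈ R.gr (sentenceDeg K + d + 2)) →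
    adS A X L f ∈ R.gr (wordDeg X + sentenceDeg L + d + 3)
  | [], d, f, hf => zero_mem _
  | Y :: L, d, f, hf => by
    rw [adS_cons]
    refine add_mem (Submodule.smul_mem _ _ (mem_gr_of_eq (br_mem R
      (sentenceDeg L + d + 2) X Y fun w => mem_gr_of_eq (hf (w :: L)) ?_) ?_))
      (Submodule.smul_mem _ _ (mem_gr_of_eq (adS_mem X L (d + wordDeg Y) fun K =>
      mem_gr_of_eq (hf (Y :: K)) ?_) ?_))
    all_goals simp only [sentenceDeg_cons]; ring

theorem dL_mem : ∀ (L : Sentence A.gr) (d : ℤ) {f : Sentence A.gr → M},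
    (∀ K, f K ∈ R.gr (sentenceDeg K + d + 2)) → dL R d f L ∈ R.gr (sentenceDeg L + (d + 1) + 2)
  | [], d, f, hf => by simp [dL, cop, ellS_nil, actPair_eq_zero]
  | X :: L, d, f, hf => by
    rw [dL_cons]
    refine add_mem (sub_mem (Submodule.smul_mem _ _ (Submodule.smul_mem _ _ (mem_gr_of_eq
      (R.act_mem (cogenVal_mem [X]) (hf L)) ?_))) (Submodule.smul_mem _ _ (mem_gr_of_eq
      (adS_mem R X L d hf) ?_))) (mem_gr_of_eq (dL_mem L (d + wordDeg X) fun K =>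
      mem_gr_of_eq (hf (X :: K)) ?_) ?_) <;>
    · simp only [sentenceDeg_cons, sentenceDeg_nil]; ring

/-- The operator `d_m` on cochains. -/
def dm (d : ℤ) : cochains R d →ₗ[ℝ] cochains R (d + 1) where
  toFun c := ⟨dmLin R d c.1, fun L => by rw [dmLin_mk R c.2]; exact dM_mem R L d c.2⟩
  map_add' c c' := Subtype.ext ((dmLin_linear R d).map_add c.1 c'.1)
  map_smul' r c := Subtype.ext ((dmLin_linear R d).map_smul r c.1)

/-- The operator `d_ℓ` on cochains. -/
def dl (d : ℤ) : cochains R d →ₗ[ℝ] cochains R (d + 1) where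
  toFun c := ⟨dlLin R d c.1, fun L => by rw [dlLin_mk R c.2]; exact dL_mem R L d c.2⟩
  map_add' c c' := Subtype.ext ((dlLin_linear R d).map_add c.1 c'.1)
  map_smul' r c := Subtype.ext ((dlLin_linear R d).map_smul r c.1)

theorem dm_mk (d : ℤ) (c : cochains R d) (L : Sentence A.gr) :
    (dm R d c).1 (mk L) = dM R d (fun K => c.1 (mk K)) L := dmLin_mk R c.2 L

theorem dl_mk (d : ℤ) (c : cochains R d) (L : Sentence A.gr) :
    (dl R d c).1 (mk L) = dL R d (fun K => c.1 (mk K)) L := dlLin_mk R c.2 L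

theorem dm_add_dl_sq (d : ℤ) (c : cochains R d) :
    dm R (d + 1) (dm R d c + dl R d c) + dl R (d + 1) (dm R d c + dl R d c) = 0 := by
  refine Subtype.ext (mk_induction _ _ fun L => ?_)
  have h := dT_dT R L d (mk_good.comp c.1)
  have e : (fun K => (dm R d c + dl R d c).1 (mk K)) = dT R d fun K => c.1 (mk K) :=
    funext fun K => congrArg₂ (· + ·) (dm_mk R d c K) (dl_mk R d c K)
  refine (congrArg₂ (· + ·) (dm_mk R (d + 1) (dm R d c + dl R d c) L)
    (dl_mk R (d + 1) (dm R d c + dl R d c) L)).trans ?_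
  rw [e]
  exact h

/-! ### Morphisms and coderivations -/

theorem signOp_zero {V : Type*} [AddCommGroup V] [Module ℝ V] {gr : ℤ → Submodule ℝ V}
    (x : Space gr) : signOp gr 0 x = x := by
  refine LinearMap.congr_fun (f := signOp gr 0) (g := LinearMap.id)
    (mk_induction _ _ fun L => ?_) x
  rw [signOp_mk, zero_mul, sg_zero, one_smul, LinearMap.id_apply]

/-- A morphism is not linear in its projection `ι + c`, but the coboundary is linear in `c`:
products of two elements of `M` are zero in `G ⋉ M`, so no quadratic term appears. -/
theorem mulT_morphism (c : Space A.gr →ₗ[ℝ] M) (t : Space A.gr ⊗[ℝ] Space A.gr) :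
    R.lift.mulT (TensorProduct.map ((cogen A.gr).prod c) ((cogen A.gr).prod c) t) =
      (A.lift.mulT (TensorProduct.map (cogen A.gr) (cogen A.gr) t), mulB R 0 c t) := by
  refine LinearMap.congr_fun
    (f := R.lift.mulT ∘ₗ TensorProduct.map ((cogen A.gr).prod c) ((cogen A.gr).prod c))
    (g := (A.lift.mulT ∘ₗ TensorProduct.map (cogen A.gr) (cogen A.gr)).prod (mulB R 0 c))
    (TensorProduct.ext' fun x y => ?_) t
  change _ = (A.lift.mulT (cogen A.gr x ⊗ₜ cogen A.gr y), mulB R 0 c (x ⊗ₜ y))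
  rw [mulB_tmul, signOp_zero]
  rfl

theorem bracketT_morphism (c : Space A.gr →ₗ[ℝ] M) (t : Space A.gr ⊗[ℝ] Space A.gr) :
    R.lift.bracketT (TensorProduct.map ((cogen A.gr).prod c) ((cogen A.gr).prod c) t) =
      (A.lift.bracketT (TensorProduct.map (cogen A.gr) (cogen A.gr) t), actB R 0 c t) := by
  refine LinearMap.congr_fun
    (f := R.lift.bracketT ∘ₗ TensorProduct.map ((cogen A.gr).prod c) ((cogen A.gr).prod c))
    (g := (A.lift.bracketT ∘ₗ TensorProduct.map (cogen A.gr) (cogen A.gr)).prod (actB R 0 c))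
    (TensorProduct.ext' fun x y => ?_) t
  change _ = (A.lift.bracketT (cogen A.gr x ⊗ₜ cogen A.gr y), actB R 0 c (x ⊗ₜ y))
  rw [actB_tmul, signOp_zero]
  rfl

theorem mulT_tmul (u v : G × M) : R.lift.mulT (u ⊗ₜ v) =
    (1 / 2 : ℝ) • (A.mul u.1 v.1, R.smul u.1 v.2 + R.rmul v.1 u.2) := rfl

theorem bracketT_tmul (u v : G × M) : R.lift.bracketT (u ⊗ₜ v) =
    (1 / 2 : ℝ) • (A.bracket (A.s u.1) v.1, R.act (A.s u.1) v.2 + R.ract v.1 (R.s u.2)) := rfl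

/-- The projection to the cogenerators of a coderivation along the inclusion. -/
def coderT (d : ℤ) (c : Space A.gr →ₗ[ℝ] M) :
    Space A.gr ⊗[ℝ] Space A.gr →ₗ[ℝ] (G × M) ⊗[ℝ] (G × M) :=
  TensorProduct.map (LinearMap.inr ℝ G M ∘ₗ c) (LinearMap.inl ℝ G M ∘ₗ cogen A.gr) +
    TensorProduct.map (LinearMap.inl ℝ G M ∘ₗ cogen A.gr ∘ₗ signOp A.gr d)
      (LinearMap.inr ℝ G M ∘ₗ c)

theorem mulT_coderivation (d : ℤ) (c : Space A.gr →ₗ[ℝ] M) (t : Space A.gr ⊗[ℝ] Space A.gr) :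
    R.lift.mulT (coderT d c t) = (0, mulB R d c t) := by
  refine LinearMap.congr_fun (f := R.lift.mulT ∘ₗ coderT d c)
    (g := LinearMap.inr ℝ G M ∘ₗ mulB R d c) (TensorProduct.ext' fun x y => ?_) t
  rw [LinearMap.comp_apply, LinearMap.comp_apply, mulB_tmul, coderT, LinearMap.add_apply, map_add,
    TensorProduct.map_tmul, TensorProduct.map_tmul, mulT_tmul, mulT_tmul]
  simp only [LinearMap.comp_apply, LinearMap.inl_apply, LinearMap.inr_apply, map_zero,
    LinearMap.zero_apply, zero_add, add_zero, Prod.smul_mk, smul_zero, Prod.mk_add_mk, smul_add]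
  rw [add_comm]

theorem bracketT_coderivation (d : ℤ) (c : Space A.gr →ₗ[ℝ] M)
    (t : Space A.gr ⊗[ℝ] Space A.gr) :
    R.lift.bracketT (coderT d c t) = (0, actB R d c t) := by
  refine LinearMap.congr_fun (f := R.lift.bracketT ∘ₗ coderT d c)
    (g := LinearMap.inr ℝ G M ∘ₗ actB R d c) (TensorProduct.ext' fun x y => ?_) t
  rw [LinearMap.comp_apply, LinearMap.comp_apply, actB_tmul, coderT, LinearMap.add_apply, map_add,
    TensorProduct.map_tmul, TensorProduct.map_tmul, bracketT_tmul, bracketT_tmul]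
  simp only [LinearMap.comp_apply, LinearMap.inl_apply, LinearMap.inr_apply, map_zero,
    LinearMap.zero_apply, zero_add, add_zero, Prod.smul_mk, smul_zero, Prod.mk_add_mk, smul_add]
  rw [add_comm]

theorem codiff_ops_apply (φ : Space A.gr →ₗ[ℝ] M) (x : Space A.gr) :
    φ (codiff A.ops x) = φ (mLin A x) + φ (ellLin A x) := φ.map_add _ _

theorem dm_add_dl_apply (d : ℤ) (c : cochains R d) (x : Space A.gr) :
    (dm R d c + dl R d c).1 x = sg d • mulB R d c.1 (cobracket A.gr x) +
      actB R d c.1 (coprod A.gr x) - sg d • c.1 (codiff A.ops x) := by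
  rw [codiff_ops_apply]
  change sg d • (mulB R d c.1 (cobracket A.gr x) - c.1 (mLin A x)) +
    (actB R d c.1 (coprod A.gr x) - sg d • c.1 (ellLin A x)) = _
  module

/-- Compatibility with `Δ` and `κ` moves the corestriction of `G ⋉ M` onto the projection of `F`.
The `G`-component cancels by the same corestriction formula for `G`, and the `M`-component is `∂ c`.
-/
theorem morphism_equation (c : cochains R 0) (F : Space A.gr →ₗ[ℝ] Space R.semidirect.gr)
    (hF : IsBicoalgebraMorphism F)
    (hc : ∀ x, cogen R.semidirect.gr (F x) = (cogen A.gr x, c.1 x)) (x : Space A.gr) :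
    cogen R.semidirect.gr (codiff R.semidirect (F x) - F (codiff A.ops x)) =
      (0, (dm R 0 c + dl R 0 c).1 x) := by
  have e : cogen R.semidirect.gr ∘ₗ F = (cogen A.gr).prod c.1 := LinearMap.ext hc
  have k : ∀ t, TensorProduct.map (cogen R.semidirect.gr) (cogen R.semidirect.gr)
      (TensorProduct.map F F t) =
      TensorProduct.map ((cogen A.gr).prod c.1) ((cogen A.gr).prod c.1) t := fun t => by
    rw [← LinearMap.comp_apply, ← TensorProduct.map_comp, e]
  have h1 : cobracket R.semidirect.gr (F x) = TensorProduct.map F F (cobracket A.gr x) :=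
    LinearMap.congr_fun hF.2 x
  have h2 : coprod R.semidirect.gr (F x) = TensorProduct.map F F (coprod A.gr x) :=
    LinearMap.congr_fun hF.1 x
  have h3 := cogen_codiff A.lift x
  have h4 : cogen R.semidirect.gr (F (codiff A.ops x)) =
      (cogen A.gr (codiff A.ops x), c.1 (codiff A.ops x)) := hc _
  rw [map_sub, cogen_codiff R.lift, h1, h2, k, k, mulT_morphism, bracketT_morphism, h4,
    dm_add_dl_apply, sg_zero, one_smul, one_smul, Prod.mk_add_mk, Prod.mk_sub_mk]
  exact congrArg₂ Prod.mk (sub_eq_zero.2 h3.symm) rfl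

theorem cogen_incl (x : Space A.gr) :
    cogen R.semidirect.gr (incl R x) = (cogen A.gr x, 0) := by
  refine LinearMap.congr_fun (f := cogen R.semidirect.gr ∘ₗ incl R)
    (g := LinearMap.inl ℝ G M ∘ₗ cogen A.gr) (mk_induction _ _ fun L => ?_) x
  have h : incl R (mk L) = inclVal R L := inclVal_descends R L
  rw [LinearMap.comp_apply, LinearMap.comp_apply, h, inclVal, cogen_mk, cogen_mk]
  by_cases hL : ∃ a, L = [[a]]
  · obtain ⟨a, rfl⟩ := hL
    rfl
  · have h1 : cogenVal L = 0 := by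
      unfold cogenVal
      split
      · exact absurd ⟨_, rfl⟩ hL
      · rfl
    rw [h1, map_zero]
    rcases L with _ | ⟨X, _ | ⟨Y, L⟩⟩
    · rfl
    · refine cogenVal_eq_zero' ?_
      rw [List.length_map]
      intro hX
      obtain ⟨a, rfl⟩ := List.length_eq_one_iff.1 hX
      exact hL ⟨a, rfl⟩
    · exact cogenVal_eq_zero (by simp)

theorem coderivation_equation (d : ℤ) (c : cochains R d)
    (D : Space A.gr →ₗ[ℝ] Space R.semidirect.gr) (hD : IsBicoalgebraCoderivation d (incl R) D)
    (hc : ∀ x, cogen R.semidirect.gr (D x) = (0, c.1 x)) (x : Space A.gr) :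
    cogen R.semidirect.gr
        (codiff R.semidirect (D x) - (-1 : ℝ) ^ d • D (codiff A.ops x)) =
      (0, (dm R d c + dl R d c).1 x) := by
  have e1 : cogen R.semidirect.gr ∘ₗ D = LinearMap.inr ℝ G M ∘ₗ c.1 := LinearMap.ext hc
  have e2 : cogen R.semidirect.gr ∘ₗ incl R = LinearMap.inl ℝ G M ∘ₗ cogen A.gr :=
    LinearMap.ext (cogen_incl R)
  have k : ∀ t, TensorProduct.map (cogen R.semidirect.gr) (cogen R.semidirect.gr)
      ((TensorProduct.map D (incl R) + TensorProduct.map (incl R ∘ₗ signOp A.gr d) D) t) =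
      coderT d c.1 t := fun t => by
    rw [← LinearMap.comp_apply, LinearMap.comp_add, ← TensorProduct.map_comp,
      ← TensorProduct.map_comp, ← LinearMap.comp_assoc, e1, e2, LinearMap.comp_assoc]
    rfl
  have h1 : sg d • cobracket R.semidirect.gr (D x) = (TensorProduct.map D (incl R) +
      TensorProduct.map (incl R ∘ₗ signOp A.gr d) D) (cobracket A.gr x) :=
    LinearMap.congr_fun hD.2 x
  have h1' := congrArg (fun t => R.lift.mulT (TensorProduct.map (cogen R.semidirect.gr)
    (cogen R.semidirect.gr) t)) h1
  simp only [k, mulT_coderivation, map_smul] at h1'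
  -- The rule for `κ ∘ D` carries the factor `(-1)^d`. Multiplying by it once more isolates `κ ∘ D`
  -- and explains the sign in front of the product terms of `d_m`.
  have h1'' := smul_of_eq (sg d) h1'
  rw [sg_smul_self] at h1''
  have h2 : coprod R.semidirect.gr (D x) = (TensorProduct.map D (incl R) +
      TensorProduct.map (incl R ∘ₗ signOp A.gr d) D) (coprod A.gr x) :=
    LinearMap.congr_fun hD.1 x
  have h4 : cogen R.semidirect.gr (D (codiff A.ops x)) = (0, c.1 (codiff A.ops x)) := hc _
  rw [map_sub, map_smul, cogen_codiff R.lift, h1'', h2, k, bracketT_coderivation, h4,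
    dm_add_dl_apply, neg_one_zpow_eq_sg]
  ext <;> simp

end Cochains

section Types

variable {V : Type*} [AddCommGroup V] [Module ℝ V] {gr : ℤ → Submodule ℝ V}

/-! ### Types of sentences -/

theorem sentenceType_cons (X : Word gr) (L : Sentence gr) :
    sentenceType (X :: L) = X.length ::ₘ sentenceType L := rfl

theorem weight_eq_sum (L : Sentence gr) : weight L = (sentenceType L).sum := by
  rw [weight, sentenceType, Multiset.sum_coe]

theorem sentenceType_append_cons (A B : Sentence gr) (X : Word gr) :
    sentenceType (A ++ X :: B) = X.length ::ₘ sentenceType (A ++ B) := by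
  simp only [sentenceType, List.map_append, List.map_cons, Multiset.cons_coe]
  exact Multiset.coe_eq_coe.2 List.perm_middle

open Classical in
/-- The part of type `t` of a sentence. -/
def typeVal (t : Multiset ℕ) (L : Sentence gr) : Space gr :=
  if sentenceType L = t then mk L else 0

/-- All relations are homogeneous for the type: shuffles preserve the number of letters, and
exchanging words does not change a multiset. Hence the type is a grading of the quotient. -/
theorem typeVal_good (t : Multiset ℕ) : Good (typeVal (gr := gr) t) where
  swap A B X Y := by
    have : sentenceType (A ++ X :: Y :: B) = sentenceType (A ++ Y :: X :: B) := by
      simp only [sentenceType_append_cons]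
      exact Multiset.cons_swap _ _ _
    rw [typeVal, typeVal, this]
    split
    · exact mk_good.swap A B X Y
    · rw [smul_zero]
  word A B :=
    { llin := fun u v N hN => by
        have h (p : Letter gr) : sentenceType (A ++ (u ++ p :: v) :: B) =
            (u.length + (v.length + 1)) ::ₘ sentenceType (A ++ B) := by
          rw [sentenceType_append_cons, List.length_append, List.length_cons]
        simp only [typeVal, h]
        split
        · exact (mk_good.word A B).llin u v N hN
        · exact lc_zero _
      shuffle := fun x y hx hy => by
        by_cases h : (x.length + y.length) ::ₘ sentenceType (A ++ B) = t
        · rw [← (mk_good.word A B).shuffle x y hx hy]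
          refine SH_congr fun w _ hw => ?_
          rw [typeVal, sentenceType_append_cons, hw, if_pos h]
        · rw [SH_congr (g' := fun _ => 0)]
          · exact lc_zero _
          · intro w _ hw
            rw [typeVal, sentenceType_append_cons, hw, if_neg h]
      nil := by
        rw [typeVal]
        split
        · exact (mk_good.word A B).nil
        · rfl }

theorem typeVal_descends (t : Multiset ℕ) : Descends (typeVal (gr := gr) t) :=
  (typeVal_good t).descends (by rw [typeVal, mk_nil, ite_self])

theorem SwapGood.move {W : Type*} [AddCommGroup W] [Module ℝ W] (Y : Word gr) (B : Sentence gr) :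
    ∀ (A : Sentence gr) {f : Sentence gr → W}, SwapGood f →
    f (Y :: (A ++ B)) = sg (wordDeg Y * sentenceDeg A) • f (A ++ Y :: B)
  | [], f, _ => by simp [sg_zero]
  | X :: A, f, hf => by
    have := SwapGood.move Y B A (hf.ins X)
    rw [List.cons_append, hf.head, this, smul_smul, ← sg_add, sentenceDeg_cons, mul_add]
    rfl

theorem lc_ellWord_move {O : Ops V} (hO : O.Regular) {W : Type*} [AddCommGroup W] [Module ℝ W]
    {f : Sentence O.gr → W} (hf : SwapGood f) (X Y : Word O.gr) (A B : Sentence O.gr) :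
    lc (ellWord O X Y) (fun w => f (w :: (A ++ B))) =
      sg ((wordDeg Y + (wordDeg X + 1)) * sentenceDeg A) •
        lc (ellWord O X Y) fun w => f (A ++ w :: B) := by
  rw [← lc_smul]
  exact lc_congr fun t ht => by rw [hf.move t.2 B A, ellWord_deg hO X Y t ht]

end Types

section Components

variable {G : Type*} [AddCommGroup G] [Module ℝ G] {A : GerstenhaberAlgebra G}
  {M : Type*} [AddCommGroup M] [Module ℝ M] (R : GerstenhaberModule A M)

/-! ### Supports -/

theorem hoch_eq_zero (d : ℤ) (X : Word A.gr) {g : Word A.gr → M}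
    (h : ∀ w : Word A.gr, w.length + 1 = X.length → g w = 0) : hoch R d X g = 0 := by
  by_cases hX : X = []
  · rw [hX, hoch_nil]
  obtain ⟨a, x, x', z, e, e'⟩ := exists_decomposition hX
  rw [hoch_eq R d e e', h x (by rw [e, List.length_cons]), h x' (by rw [e']; simp),
    mW_eq_zero X h]
  simp

/-- Every term of `d_m` evaluates the cochain on a sentence in which a single word has lost one
letter, by an outer multiplication or by an inner product. -/
theorem dM_eq_zero : ∀ (L : Sentence A.gr) (d : ℤ) {f : Sentence A.gr → M},
    (∀ K k T, sentenceType L = (k + 1) ::ₘ T → sentenceType K = k ::ₘ T → f K = 0) →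
    dM R d f L = 0
  | [], d, f, h => by simp [dM, kap, mS_nil]
  | X :: L, d, f, h => by
    rw [dM_cons, hoch_eq_zero R d X, dM_eq_zero L, add_zero]
    · intro K k T h1 h2
      refine h (X :: K) k (X.length ::ₘ T) ?_ ?_
      · rw [sentenceType_cons, h1, Multiset.cons_swap]
      · rw [sentenceType_cons, h2, Multiset.cons_swap]
    · intro w hw
      refine h (w :: L) w.length (sentenceType L) ?_ rfl
      rw [sentenceType_cons, hw]

theorem adS_eq_zero (X : Word A.gr) (hX : X ≠ []) : ∀ (L : Sentence A.gr) {f : Sentence A.gr → M},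
    (∀ K q T, 1 ≤ q → sentenceType L = q ::ₘ T →
      sentenceType K = (X.length + q - 1) ::ₘ T → f K = 0) → adS A X L f = 0
  | [], f, h => adS_nil X f
  | Y :: L, f, h => by
    have h1 : br A X Y (fun w => f (w :: L)) = 0 := by
      by_cases hY : Y = []
      · rw [hY]; exact BR_nil_right A.ops X _
      have := List.length_pos_of_ne_nil hY
      refine br_eq_zero X Y fun w hw => h (w :: L) Y.length (sentenceType L) this rfl ?_
      rw [sentenceType_cons, ← hw, Nat.add_sub_cancel]
    rw [adS_cons, h1, adS_eq_zero X hX L, smul_zero, smul_zero, add_zero]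
    intro K q T hq h2 h3
    refine h (Y :: K) q (Y.length ::ₘ T) hq ?_ ?_
    · rw [sentenceType_cons, h2, Multiset.cons_swap]
    · rw [sentenceType_cons, h3, Multiset.cons_swap]

theorem adS_nil_left : ∀ (L : Sentence A.gr) (f : Sentence A.gr → M), adS A [] L f = 0
  | [], f => adS_nil [] f
  | Y :: L, f => by
    have h1 : br A [] Y (fun w => f (w :: L)) = 0 := BR_nil_left A.ops Y _
    rw [adS_cons, h1, adS_nil_left L, smul_zero, smul_zero, add_zero]

/-- The terms of `d_ℓ` either delete a one-letter word, which acts, or merge two nonempty words of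
lengths `q₁`, `q₂` into one of length `q₁ + q₂ - 1`. -/
theorem dL_eq_zero : ∀ (L : Sentence A.gr) (d : ℤ) {f : Sentence A.gr → M},
    (∀ K, sentenceType L = 1 ::ₘ sentenceType K → f K = 0) →
    (∀ K q₁ q₂ T, 1 ≤ q₁ → 1 ≤ q₂ → sentenceType L = q₁ ::ₘ q₂ ::ₘ T →
      sentenceType K = (q₁ + q₂ - 1) ::ₘ T → f K = 0) → dL R d f L = 0
  | [], d, f, h, h' => by simp [dL, cop, ellS_nil, actPair_eq_zero]
  | X :: L, d, f, h, h' => by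
    have h1 : actLin R X (f L) = 0 := by
      by_cases hX : X.length = 1
      · rw [h L (by rw [sentenceType_cons, hX]), map_zero]
      · rw [actLin_eq_zero R hX, LinearMap.zero_apply]
    have h2 : adS A X L f = 0 := by
      by_cases hX : X = []
      · rw [hX, adS_nil_left]
      · refine adS_eq_zero X hX L fun K q T hq e e' =>
          h' K X.length q T (List.length_pos_of_ne_nil hX) hq ?_ e'
        rw [sentenceType_cons, e]
    rw [dL_cons, h1, h2, dL_eq_zero L, smul_zero, smul_zero, sub_zero, add_zero]
    · intro K e
      refine h (X :: K) ?_
      rw [sentenceType_cons, sentenceType_cons, e, Multiset.cons_swap]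
    · intro K q₁ q₂ T hq₁ hq₂ e e'
      refine h' (X :: K) q₁ q₂ (X.length ::ₘ T) hq₁ hq₂ ?_ ?_
      · rw [sentenceType_cons, e, Multiset.cons_swap, Multiset.cons_swap X.length]
      · rw [sentenceType_cons, e', Multiset.cons_swap]

theorem dm_mem_weight (d : ℤ) (N : ℕ) {c : cochains R d} (hc : c ∈ cochainsOfWeight R d N) :
    dm R d c ∈ cochainsOfWeight R (d + 1) (N + 1) := by
  intro L hL
  refine (dm_mk R d c L).trans (dM_eq_zero R L d fun K k T h1 h2 => hc K fun hK => hL ?_)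
  rw [weight_eq_sum, h1, Multiset.sum_cons]
  rw [weight_eq_sum, h2, Multiset.sum_cons] at hK
  omega

theorem dl_mem_weight (d : ℤ) (N : ℕ) {c : cochains R d} (hc : c ∈ cochainsOfWeight R d N) :
    dl R d c ∈ cochainsOfWeight R (d + 1) (N + 1) := by
  intro L hL
  refine (dl_mk R d c L).trans (dL_eq_zero R L d (fun K h => hc K fun hK => hL ?_)
    fun K q₁ q₂ T hq₁ hq₂ h1 h2 => hc K fun hK => hL ?_)
  · rw [weight_eq_sum, h, Multiset.sum_cons, ← weight_eq_sum, hK, add_comm]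
  · rw [weight_eq_sum, h1, Multiset.sum_cons, Multiset.sum_cons]
    rw [weight_eq_sum, h2, Multiset.sum_cons] at hK
    omega

/-- The component of type `t` of a cochain. -/
def typePart (d : ℤ) (t : Multiset ℕ) (c : cochains R d) : cochains R d :=
  ⟨c.1 ∘ₗ descend (typeVal t), fun L => by
    rw [LinearMap.comp_apply, typeVal_descends, typeVal]
    split
    · exact c.2 L
    · rw [map_zero]; exact zero_mem _⟩

theorem typePart_mk (d : ℤ) (t : Multiset ℕ) (c : cochains R d) (L : Sentence A.gr) :
    (typePart R d t c).1 (mk L) = c.1 (typeVal t L) :=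
  congrArg c.1 (typeVal_descends t L)

theorem typePart_mem (d : ℤ) (t : Multiset ℕ) (c : cochains R d) :
    typePart R d t c ∈ cochainsOfType R d t := fun L hL => by
  rw [typePart_mk, typeVal, if_neg hL, map_zero]

/-- A cochain supported on finitely many types is the finite sum of its parts of these types, so a
statement about supports becomes membership in a sum of subspaces. -/
theorem mem_of_types (d : ℤ) {c : cochains R d} {P : Submodule ℝ (cochains R d)}
    (S : Finset (Multiset ℕ)) (hS : ∀ L, sentenceType L ∉ S → c.1 (mk L) = 0)
    (hP : ∀ t ∈ S, cochainsOfType R d t ≤ P) : c ∈ P := by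
  have e : c = ∑ t ∈ S, typePart R d t c := by
    refine Subtype.ext (mk_induction _ _ fun L => ?_)
    have e' : (∑ t ∈ S, typePart R d t c).1 (mk L) = ∑ t ∈ S, c.1 (typeVal t L) := by
      rw [Submodule.coe_sum, LinearMap.sum_apply]
      exact Finset.sum_congr rfl fun t _ => typePart_mk R d t c L
    rw [e']
    by_cases h : sentenceType L ∈ S
    · rw [Finset.sum_eq_single_of_mem _ h fun t _ ht => by
        rw [typeVal, if_neg ht.symm, map_zero], typeVal, if_pos rfl]
    · rw [hS L h]
      refine (Finset.sum_eq_zero fun t ht => ?_).symm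
      rw [typeVal, if_neg (by rintro rfl; exact h ht), map_zero]
  rw [e]
  exact P.sum_mem fun t ht => hP t ht (typePart_mem R d t c)

theorem dm_mem_type (d : ℤ) (p : Multiset ℕ) {c : cochains R d} (hc : c ∈ cochainsOfType R d p) :
    dm R d c ∈ (⨆ k ∈ p, cochainsOfType R (d + 1) ((k + 1) ::ₘ p.erase k)) := by
  refine mem_of_types R (d + 1) (p.toFinset.image fun k => (k + 1) ::ₘ p.erase k)
    (fun L hL => ?_) fun t ht => ?_
  · refine (dm_mk R d c L).trans (dM_eq_zero R L d fun K k T h1 h2 => hc K fun hK => hL ?_)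
    rw [h2] at hK
    refine Finset.mem_image.2 ⟨k, ?_, ?_⟩
    · rw [Multiset.mem_toFinset, ← hK]
      exact Multiset.mem_cons_self k T
    · rw [h1, ← hK, Multiset.erase_cons_head]
  · obtain ⟨k, hk, rfl⟩ := Finset.mem_image.1 ht
    exact le_iSup₂_of_le k (Multiset.mem_toFinset.1 hk) le_rfl

/-- The action terms of `d_ℓ` are listed below as a splitting of some length `k ≥ 1` occurring in
`p`. Such a `k` exists wherever the cochain does not vanish, since the empty sentence and empty
words have class zero. -/
theorem exists_word_of_ne_zero (c : Space A.gr →ₗ[ℝ] M) {K : Sentence A.gr} (h : c (mk K) ≠ 0) :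
    ∃ k, 1 ≤ k ∧ k ∈ sentenceType K := by
  rcases K with _ | ⟨Y, K⟩
  · exact absurd (by rw [mk_nil, map_zero]) h
  · refine ⟨Y.length, List.length_pos_of_ne_nil ?_,
      Multiset.mem_cons_self Y.length (sentenceType K)⟩
    rintro rfl
    exact h ((congrArg c (mk_good.word [] K).nil).trans (map_zero c))

theorem dl_mem_type (d : ℤ) (p : Multiset ℕ) {c : cochains R d} (hc : c ∈ cochainsOfType R d p) :
    dl R d c ∈ (⨆ k ∈ p, ⨆ q : ℕ × ℕ, ⨆ _ : 1 ≤ q.1 ∧ 1 ≤ q.2 ∧ q.1 + q.2 = k + 1,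
      cochainsOfType R (d + 1) (q.1 ::ₘ q.2 ::ₘ p.erase k)) := by
  refine mem_of_types R (d + 1) (p.toFinset.biUnion fun k =>
    ((Finset.range (k + 2) ×ˢ Finset.range (k + 2)).filter fun q =>
      1 ≤ q.1 ∧ 1 ≤ q.2 ∧ q.1 + q.2 = k + 1).image fun q => q.1 ::ₘ q.2 ::ₘ p.erase k)
    (fun L hL => ?_) fun t ht => ?_
  · have key : ∀ k q₁ q₂, k ∈ p → 1 ≤ q₁ → 1 ≤ q₂ → q₁ + q₂ = k + 1 →
        sentenceType L ≠ q₁ ::ₘ q₂ ::ₘ p.erase k := by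
      intro k q₁ q₂ hk h1 h2 h3 h4
      refine hL (Finset.mem_biUnion.2 ⟨k, Multiset.mem_toFinset.2 hk,
        Finset.mem_image.2 ⟨(q₁, q₂), Finset.mem_filter.2 ⟨?_, h1, h2, h3⟩, h4.symm⟩⟩)
      rw [Finset.mem_product, Finset.mem_range, Finset.mem_range]
      omega
    refine (dl_mk R d c L).trans (dL_eq_zero R L d (fun K h => ?_)
      fun K q₁ q₂ T hq₁ hq₂ h1 h2 => hc K fun hK => ?_)
    · by_contra h0
      have hK : sentenceType K = p := by_contra fun h' => h0 (hc K h')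
      obtain ⟨k, hk, hk'⟩ := exists_word_of_ne_zero c.1 h0
      rw [hK] at hk' h
      -- An action term adds a word of length one, so its type `1 ::ₘ p` arises by splitting `k` as
      -- `1 + k = k + 1`.
      exact key k 1 k hk' le_rfl hk (add_comm 1 k) (by rw [h, Multiset.cons_erase hk'])
    · rw [h2] at hK
      refine key (q₁ + q₂ - 1) q₁ q₂ ?_ hq₁ hq₂ (by omega) ?_
      · rw [← hK]
        exact Multiset.mem_cons_self _ T
      · rw [h1, ← hK, Multiset.erase_cons_head]
  · obtain ⟨k, hk, ht⟩ := Finset.mem_biUnion.1 ht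
    obtain ⟨q, hq, rfl⟩ := Finset.mem_image.1 ht
    exact le_iSup₂_of_le k (Multiset.mem_toFinset.1 hk)
      (le_iSup₂_of_le q (Finset.mem_filter.1 hq).2 le_rfl)

/-! ### The terms of `d_ℓ` for two distinguished words -/

theorem dellOther_eq (d : ℤ) (c : Space A.gr →ₗ[ℝ] M) (Y₁ Y₂ : Word A.gr) (X : Sentence A.gr) :
    dellOther R d c Y₁ Y₂ X =
      lc (picks wordDeg X) (fun t =>
        (sg (wordDeg t.1 * (wordDeg Y₁ + wordDeg Y₂)) * sg (d * wordDeg t.1)) •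
          ellAct R t.1 (c (mk (Y₁ :: Y₂ :: t.2)))) -
      sg d • (lc (picks wordDeg X) (fun t =>
          sg (wordDeg t.1 * wordDeg Y₂) • evalEll c [] Y₁ t.1 (Y₂ :: t.2) +
          sg (wordDeg Y₁ * (wordDeg Y₂ + wordDeg t.1)) • evalEll c [] Y₂ t.1 (Y₁ :: t.2)) +
        lc (pickPairs wordDeg X) fun t =>
          sg ((wordDeg t.1 + wordDeg t.2.1) * (wordDeg Y₁ + wordDeg Y₂)) •
            evalEll c [] t.1 t.2.1 (Y₁ :: Y₂ :: t.2.2)) := by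
  simp only [dellOther, lc, neg_one_zpow_eq_sg, smul_smul, smul_add, mul_assoc]

theorem dellFormula_eq_lc (d : ℤ) (c : Space A.gr →ₗ[ℝ] M) (L : Sentence A.gr) :
    dellFormula R d c L =
      lc (picks wordDeg L) (fun t => sg (d * wordDeg t.1) • ellAct R t.1 (c (mk t.2))) -
      sg d • lc (pickPairs wordDeg L) fun t => evalEll c [] t.1 t.2.1 t.2.2 := by
  simp only [dellFormula, lc, neg_one_zpow_eq_sg, smul_smul]

theorem ellAct_move (c : Space A.gr →ₗ[ℝ] M) (X Y : Word A.gr) (L₁ L₂ : Sentence A.gr) :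
    ellAct R X (c (mk (Y :: (L₁ ++ L₂)))) =
      sg (wordDeg Y * sentenceDeg L₁) • ellAct R X (c (mk (L₁ ++ Y :: L₂))) := by
  rw [← actLin_apply, ← actLin_apply, (mk_good.comp c).swap.move Y L₂ L₁, map_smul]

theorem evalEll_move (c : Space A.gr →ₗ[ℝ] M) (X Y : Word A.gr) (L₁ L₂ : Sentence A.gr) :
    evalEll c [] X Y (L₁ ++ L₂) =
      sg ((wordDeg Y + (wordDeg X + 1)) * sentenceDeg L₁) • evalEll c L₁ X Y L₂ :=
  lc_ellWord_move (O := A.ops) A.lift.regular (mk_good.comp c).swap X Y L₁ L₂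

/-- Unfolding the choice of words at the first two places isolates the actions of `Y₁` and `Y₂` and
their common bracket. These are moved between `L₁` and `L₂` with Koszul signs, and all other choices
make up `dellOther`. -/
theorem dellFormula_two (d : ℤ) (c : Space A.gr →ₗ[ℝ] M) (Y₁ Y₂ : Word A.gr)
    (L₁ L₂ : Sentence A.gr) :
    dellFormula R d c (Y₁ :: Y₂ :: (L₁ ++ L₂)) =
      dellActFirst R d c Y₁ Y₂ L₁ L₂ + dellActSecond R d c Y₁ Y₂ L₁ L₂ +
        dellBracket d c Y₁ Y₂ L₁ L₂ + dellOther R d c Y₁ Y₂ (L₁ ++ L₂) := by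
  rw [dellFormula_eq_lc, dellOther_eq]
  simp only [lc_picks_cons, lc_pickPairs_cons, lc_add]
  rw [ellAct_move, ellAct_move, evalEll_move, dellActFirst, dellActSecond, dellBracket]
  simp only [neg_one_zpow_eq_sg]
  generalize ellAct R Y₁ _ = u, ellAct R Y₂ _ = v, evalEll c L₁ Y₁ Y₂ L₂ = w
  simp only [smul_add, smul_sub, smul_smul, sign_rules]
  module

theorem ellAct_eq_zero {X : Word A.gr} (hX : X.length ≠ 1) (v : M) : ellAct R X v = 0 := by
  rw [← actLin_apply, actLin_eq_zero R hX, LinearMap.zero_apply]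

theorem dellActFirst_eq_zero (d : ℤ) (c : Space A.gr →ₗ[ℝ] M) {Y₁ : Word A.gr}
    (h : 1 < Y₁.length) (Y₂ : Word A.gr) (L₁ L₂ : Sentence A.gr) :
    dellActFirst R d c Y₁ Y₂ L₁ L₂ = 0 := by
  rw [dellActFirst, ellAct_eq_zero R h.ne', smul_zero, smul_zero]

theorem dellActSecond_eq_zero (d : ℤ) (c : Space A.gr →ₗ[ℝ] M) (Y₁ : Word A.gr) {Y₂ : Word A.gr}
    (h : 1 < Y₂.length) (L₁ L₂ : Sentence A.gr) : dellActSecond R d c Y₁ Y₂ L₁ L₂ = 0 := by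
  rw [dellActSecond, ellAct_eq_zero R h.ne', smul_zero, smul_zero]

theorem dl_mk_eq (d : ℤ) (c : cochains R d) (L : Sentence A.gr) :
    (dl R d c).1 (mk L) = dellFormula R d c.1 L :=
  (dl_mk R d c L).trans (dellFormula_eq R d c.1 L).symm

end Components

end ChevalleyHarrison

end

theorem mainTheorem7 {G : Type*} [AddCommGroup G] [Module ℝ G] (A : GerstenhaberAlgebra G)
    {M : Type*} [AddCommGroup M] [Module ℝ M] (R : GerstenhaberModule A M) :
    -- the enveloping algebras of `G` and `G ⋉ M` and the inclusion are well defined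
    StructureMapsDescend A.ops ∧ StructureMapsDescend R.semidirect ∧ Descends (inclVal R) ∧
    ∃ dm dl : ∀ d : ℤ, cochains R d →ₗ[ℝ] cochains R (d + 1),
      -- the explicit formula for `d_m`
      (∀ (d : ℤ) (c : cochains R d) (L : Sentence A.gr),
        (dm d c).1 (mk L) = dmFormula R d c.1 L) ∧
      -- the explicit formula for `d_ℓ`
      (∀ (d : ℤ) (c : cochains R d) (L : Sentence A.gr),
        (dl d c).1 (mk L) = dellFormula R d c.1 L) ∧
      -- the cases for the terms of `d_ℓ` according to the sizes of two words
      (∀ (d : ℤ) (c : cochains R d) (Y₁ Y₂ : Word A.gr) (L₁ L₂ : Sentence A.gr),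
        (1 < Y₁.length → 1 < Y₂.length →
          (dl d c).1 (mk (Y₁ :: Y₂ :: (L₁ ++ L₂))) =
            dellBracket d c.1 Y₁ Y₂ L₁ L₂ + dellOther R d c.1 Y₁ Y₂ (L₁ ++ L₂)) ∧
        (Y₁.length = 1 → 1 < Y₂.length →
          (dl d c).1 (mk (Y₁ :: Y₂ :: (L₁ ++ L₂))) =
            dellBracket d c.1 Y₁ Y₂ L₁ L₂ + dellActFirst R d c.1 Y₁ Y₂ L₁ L₂
              + dellOther R d c.1 Y₁ Y₂ (L₁ ++ L₂)) ∧
        (1 < Y₁.length → Y₂.length = 1 →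
          (dl d c).1 (mk (Y₁ :: Y₂ :: (L₁ ++ L₂))) =
            dellBracket d c.1 Y₁ Y₂ L₁ L₂ + dellActSecond R d c.1 Y₁ Y₂ L₁ L₂
              + dellOther R d c.1 Y₁ Y₂ (L₁ ++ L₂)) ∧
        (Y₁.length = 1 → Y₂.length = 1 →
          (dl d c).1 (mk (Y₁ :: Y₂ :: (L₁ ++ L₂))) =
            dellActFirst R d c.1 Y₁ Y₂ L₁ L₂ + dellActSecond R d c.1 Y₁ Y₂ L₁ L₂
              + dellBracket d c.1 Y₁ Y₂ L₁ L₂ + dellOther R d c.1 Y₁ Y₂ (L₁ ++ L₂))) ∧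
      -- `d_m` and `d_ℓ` map `C^N` to `C^{N+1}`
      (∀ (d : ℤ) (N : ℕ), ∀ c ∈ cochainsOfWeight R d N,
        dm d c ∈ cochainsOfWeight R (d + 1) (N + 1) ∧
        dl d c ∈ cochainsOfWeight R (d + 1) (N + 1)) ∧
      -- the components of `d_m` and `d_ℓ`
      (∀ (d : ℤ) (p : Multiset ℕ), ∀ c ∈ cochainsOfType R d p,
        dm d c ∈ (⨆ k ∈ p, cochainsOfType R (d + 1) ((k + 1) ::ₘ p.erase k)) ∧
        dl d c ∈ (⨆ k ∈ p, ⨆ q : ℕ × ℕ, ⨆ _ : 1 ≤ q.1 ∧ 1 ≤ q.2 ∧ q.1 + q.2 = k + 1,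
          cochainsOfType R (d + 1) (q.1 ::ₘ q.2 ::ₘ p.erase k))) ∧
      -- `d_m + d_ℓ` is the coboundary given by the equation of morphisms, in degree `0`
      (∀ (c : cochains R 0) (F : Space A.gr →ₗ[ℝ] Space R.semidirect.gr),
        IsBicoalgebraMorphism F →
        (∀ x, cogen R.semidirect.gr (F x) = (cogen A.gr x, c.1 x)) →
        ∀ x, cogen R.semidirect.gr (codiff R.semidirect (F x) - F (codiff A.ops x)) =
          (0, (dm 0 c + dl 0 c).1 x)) ∧
      -- and by its linear version in any degree
      (∀ (d : ℤ) (c : cochains R d) (D : Space A.gr →ₗ[ℝ] Space R.semidirect.gr),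
        IsBicoalgebraCoderivation d (incl R) D →
        (∀ x, cogen R.semidirect.gr (D x) = (0, c.1 x)) →
        ∀ x, cogen R.semidirect.gr
            (codiff R.semidirect (D x) - (-1 : ℝ) ^ d • D (codiff A.ops x)) =
          (0, (dm d c + dl d c).1 x)) ∧
      -- the square of `d_m + d_ℓ` is zero
      (∀ (d : ℤ) (c : cochains R d),
        dm (d + 1) (dm d c + dl d c) + dl (d + 1) (dm d c + dl d c) = 0) := by
  refine ⟨structureMapsDescend A.lift.regular, structureMapsDescend R.lift.regular,
    inclVal_descends R, dm R, dl R,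
    fun d c L => (dm_mk R d c L).trans (dmFormula_eq R d c.1 L).symm, dl_mk_eq R,
    fun d c Y₁ Y₂ L₁ L₂ => ?_,
    fun d N c hc => ⟨dm_mem_weight R d N hc, dl_mem_weight R d N hc⟩,
    fun d p c hc => ⟨dm_mem_type R d p hc, dl_mem_type R d p hc⟩,
    morphism_equation R, coderivation_equation R, dm_add_dl_sq R⟩
  -- The formula with both action terms holds for all lengths. The cases differ only because a word
  -- with more than one letter does not act.
  have h := (dl_mk_eq R d c _).trans (dellFormula_two R d c.1 Y₁ Y₂ L₁ L₂)
  refine ⟨fun h1 h2 => ?_, fun h1 h2 => ?_, fun h1 h2 => ?_, fun _ _ => h⟩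
  · rw [h, dellActFirst_eq_zero R d c.1 h1, dellActSecond_eq_zero R d c.1 Y₁ h2, zero_add, zero_add]
  · rw [h, dellActSecond_eq_zero R d c.1 Y₁ h2, add_zero, add_comm (dellActFirst R d c.1 Y₁ Y₂ L₁ L₂)]
  · rw [h, dellActFirst_eq_zero R d c.1 h1, zero_add, add_comm (dellActSecond R d c.1 Y₁ Y₂ L₁ L₂)]
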